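/- **Model.** Let $\mathcal K=\{1,2\}$, $\tilde j$ the element of $\mathcal K$ other than $j$, and let $\lambda^{(j)},t^{(j)},\tau,p_0,i_0,p_{\max}>0$, $\alpha>2$, $\epsilon\in\mathbb R$. Base stations (BSs) of tier $j$ form a homogeneous Poisson point process $\Phi^{(j)}$ on $\mathbb R^2$ of density $\lambda^{(j)}$; $\Phi^{(1)},\Phi^{(2)}$ are independent. The typical terminal sits at the origin; $R^{(j)}_{(q)}$ is its distance to the $q$-th nearest BS of tier $j$. Put $$\mathcal X^{(j)}=\{t^{(j)}(\tau R^{(j)}_{(1)})^{-\alpha}>t^{(\tilde j)}(\tau R^{(\tilde j)}_{(1)})^{-\alpha}\}\quad\text{(association with tier } j),$$ $\mathcal X^{(j,m)}=\mathcal X^{(j)}\cap\{R^{(j)}_{(2)}>R^{(m)}_{(1)}\}$ if $m\ne j$, $\mathcal X^{(j,j)}=\mathcal X^{(j)}\cap\{R^{(j)}_{(2)}<R^{(\tilde j)}_{(1)}\}$ (the most interfered BS is in tier $m$), and $\Pr(\mathcal Q^{(m)}|\mathcal X^{(j)})=\Pr(\mathcal X^{(j,m)})/\Pr(\mathcal X^{(j)})$.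 On $\mathcal X^{(j)}$ let $R=R^{(j)}_{(1)}$ (distance to the serving BS) and $U=\min(R^{(j)}_{(2)},R^{(\tilde j)}_{(1)})$ (distance to the most interfered BS). The transmit power is $$p(r,u)=\min\bigl(p_0(\tau r)^{\alpha\epsilon},\,i_0(\tau u)^{\alpha},\,p_{\max}\bigr).$$ The probe BS $\mathrm{BS}_0$ is the BS serving the typical terminal. The interferers of tier $k$ form a homogeneous Poisson process $\Psi^{(k)}$ of density $\lambda^{(k)}$ on $\mathbb R^2$ with independent marks $(R_i,U_i)$, distributed as $(R,U)$ given $\mathcal X^{(k)}$, and $H_i$, exponential with mean $1$; $\Psi^{(1)},\Psi^{(2)}$ and the BSs are independent. With $D_i$ the distance of interferer $i$ to $\mathrm{BS}_0$ and $P_i=p(R_i,U_i)$, the interference is, on $\mathcal X^{(j)}$, $$I=\sum_{k\in\mathcal K}\sum_{i\in\Psi^{(k)}}H_i(\tau D_i)^{-\alpha}P_i\,\mathbf 1\bigl(t^{(k)}(\tau R_i)^{-\alpha}>t^{(j)}(\tau D_i)^{-\alpha}\bigr)\,\mathbf 1\bigl(P_i(\tau D_i)^{-\alpha}<i_0\bigr).$$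 **Densities.** For $0<v$, let $$f(v,w|\mathcal X^{(j,m)})=\frac{2\pi\lambda^{(m)}w\,e^{-\pi\lambda^{(m)}w^2}\;2\pi\lambda^{(j)}v\,e^{-\pi\lambda^{(j)}\max(v,w)^2}}{\Pr(\mathcal X^{(j,m)})}\,\mathbf 1\Bigl(w>\bigl(\tfrac{t^{(m)}}{t^{(j)}}\bigr)^{1/\alpha}v\Bigr)\quad(j\neq m),$$ $$f(v,w|\mathcal X^{(j,j)})=\frac{e^{-\pi\lambda^{(\tilde j)}\max\left((t^{(\tilde j)}/t^{(j)})^{1/\alpha}v,\;w\right)^2}\;4(\pi\lambda^{(j)})^2vw\,e^{-\pi\lambda^{(j)}w^2}}{\Pr(\mathcal X^{(j,j)})}\,\mathbf 1(w>v).$$ For $g=g(k,r,u)$ write $$\mathcal A[g]=-\sum_{k\in\mathcal K}2\pi\lambda^{(k)}\sum_{n\in\mathcal K}\Pr(\mathcal Q^{(n)}|\mathcal X^{(k)})\int_0^\infty\int_{(t^{(n)}/t^{(k)})^{1/\alpha}r}^\infty f(r,u|\mathcal X^{(k,n)})\,g(k,r,u)\,du\,dr,$$ let $M=M^{(j,k)}(r,u)=\max\bigl((t^{(j)}/t^{(k)})^{1/\alpha}r,\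 \tfrac1\tau(p(r,u)/i_0)^{1/\alpha}\bigr)$, and $\beta^{(j)}(s)=\mathcal A[\chi]$ with $$\chi=\frac{s\,p(r,u)\tau^{-\alpha}}{\alpha-2}\,M^{2-\alpha}\;{}_2F_1\Bigl(1,\tfrac{\alpha-2}{\alpha};2-\tfrac2\alpha;-s\,p(r,u)\tau^{-\alpha}M^{-\alpha}\Bigr).$$ **Proposition.** The function $f(\cdot,\cdot|\mathcal X^{(j,m)})$ is the joint density of $(R,U)$ conditional on $\mathcal X^{(j,m)}$. The interference $I$ is almost surely finite and square integrable, with $$\mathbb E[I]=-\sum_{j\in\mathcal K}\Pr(\mathcal X^{(j)})\,\beta'^{(j)}(0),$$ $$\operatorname{var}(I)=\sum_{j\in\mathcal K}\Pr(\mathcal X^{(j)})\Bigl(\beta''^{(j)}(0)+\bigl(\beta'^{(j)}(0)\bigr)^2-\bigl(\mathbb E[I]\bigr)^2\Bigr).$$ Here $\beta^{(j)}$ is differentiable near $0$ and twice differentiable at $0$, and $$\beta'^{(j)}(0)=\mathcal A\Bigl[\frac{\tau^{-\alpha}p(r,u)}{\alpha-2}\,M^{2-\alpha}\Bigr],\qquad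 \beta''^{(j)}(0)=\mathcal A\Bigl[\frac{(\tau^{-\alpha}p(r,u))^2}{1-\alpha}\,M^{2(1-\alpha)}\Bigr].$$ -/

import Mathlib

open MeasureTheory ProbabilityTheory Set Filter Topology
open scoped ENNReal NNReal

noncomputable section

namespace Uplink

/-! ### Point processes -/

/-- The sigma-algebra on `Ω` generated by the counts `#(Ψ ∩ A)` of a random set of points. -/
abbrev countAlgebra {Ω E : Type*} [MeasurableSpace E] (Ψ : Ω → Set E) : MeasurableSpace Ω :=
  ⨆ (A : Set E) (_ : MeasurableSet A),
    MeasurableSpace.comap (fun ω => (Ψ ω ∩ A).encard) inferInstance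

/-- `Ψ` is a (simple) Poisson point process with intensity measure `μ`: the number of points in
a set of finite intensity is Poisson distributed with that parameter, and the numbers of points
in disjoint sets are independent. -/
structure IsPoissonProcess {Ω E : Type*} [MeasurableSpace Ω] [MeasurableSpace E]
    (P : Measure Ω) (μ : Measure E) (Ψ : Ω → Set E) : Prop where
  measurable_count : ∀ A : Set E, MeasurableSet A → Measurable fun ω => (Ψ ω ∩ A).encard
  law_count : ∀ A : Set E, MeasurableSet A → μ A ≠ ∞ → ∀ n : ℕ,
    P {ω | (Ψ ω ∩ A).encard = (n : ℕ∞)} = poissonMeasure (μ A).toNNReal {n}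
  indep_count : ∀ (N : ℕ) (A : Fin N → Set E), (∀ i, MeasurableSet (A i)) →
    Pairwise (fun i i' => Disjoint (A i) (A i')) →
    iIndepFun (fun i ω => (Ψ ω ∩ A i).encard) P

/-- The plane with its Euclidean norm. -/
abbrev Plane : Type := EuclideanSpace ℝ (Fin 2)

/-- An interfering mobile terminal: its position, the pair (distance to its serving base station,
distance to its most interfered base station), and its multi-path fading. -/
abbrev Interferer : Type := Plane × (ℝ × ℝ) × ℝ

/-- Distance from the origin to the `q`-th nearest point of `S`. -/
def nearestDist (S : Set Plane) (q : ℕ) : ℝ :=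
  sInf {r : ℝ | 0 ≤ r ∧ (q : ℕ∞) ≤ (S ∩ Metric.closedBall 0 r).encard}

/-! ### Parameters, association, power control -/

/-- Parameters of a two-tier network (the tiers are indexed by `Fin 2`; `j.rev` is the tier
complementary to `j`). -/
structure Params where
  /-- densities of the tiers (the effect of shadowing included) -/
  lam : Fin 2 → ℝ
  /-- association weights -/
  t : Fin 2 → ℝ
  /-- path loss slope -/
  τ : ℝ
  /-- path loss exponent -/
  α : ℝ
  /-- desired received power -/
  p0 : ℝ
  /-- maximum interference level -/
  i0 : ℝ
  /-- maximum transmit power -/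
  pmax : ℝ
  /-- partial compensation factor -/
  ε : ℝ
  lam_pos : ∀ j, 0 < lam j
  t_pos : ∀ j, 0 < t j
  τ_pos : 0 < τ
  two_lt_α : 2 < α
  p0_pos : 0 < p0
  i0_pos : 0 < i0
  pmax_pos : 0 < pmax

/-- Transmit power of a terminal at distance `r` from its serving base station and at distance
`u` from its most interfered base station. -/
def Params.pMT (c : Params) (r u : ℝ) : ℝ :=
  min (min (c.p0 * (c.τ * r) ^ (c.α * c.ε)) (c.i0 * (c.τ * u) ^ c.α)) c.pmax

section Association

variable {Ω : Type*} (c : Params) (Φ : Fin 2 → Ω → Set Plane)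

/-- The event that the typical terminal (at the origin) is associated with tier `j`. -/
def assoc (j : Fin 2) : Set Ω :=
  {ω | c.t j * (c.τ * nearestDist (Φ j ω) 1) ^ (-c.α) >
    c.t j.rev * (c.τ * nearestDist (Φ j.rev ω) 1) ^ (-c.α)}

/-- The event that the typical terminal is associated with tier `j` and that its most interfered
base station belongs to tier `m`. -/
def assocInterf (j m : Fin 2) : Set Ω :=
  if j = m then
    assoc c Φ j ∩ {ω | nearestDist (Φ j ω) 2 < nearestDist (Φ j.rev ω) 1}
  else
    assoc c Φ j ∩ {ω | nearestDist (Φ j ω) 2 > nearestDist (Φ m ω) 1}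

/-- Distance from the typical terminal to its serving base station. -/
def servDist (ω : Ω) : ℝ :=
  ∑ j, (assoc c Φ j).indicator (fun ω => nearestDist (Φ j ω) 1) ω

/-- Distance from the typical terminal to its most interfered base station, i.e. the nearest one
apart from the serving one. -/
def interfDist (ω : Ω) : ℝ :=
  ∑ j, (assoc c Φ j).indicator
    (fun ω => min (nearestDist (Φ j ω) 2) (nearestDist (Φ j.rev ω) 1)) ω

end Association

/-! ### The interference -/

/-- Contribution of an interferer `p` of tier `k` at the probe base station, which belongs to
tier `j` and is located at `b`; it is kept only if `p` receives a higher weighted power from its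
serving base station than from the probe one, and if it causes less interference than `i0`. -/
def Params.contribution (c : Params) (j k : Fin 2) (b : Plane) (p : Interferer) : ℝ≥0∞ :=
  open Classical in
  let D : ℝ := ‖p.1 - b‖
  let r : ℝ := p.2.1.1
  let u : ℝ := p.2.1.2
  let h : ℝ := p.2.2
  if c.t k * (c.τ * r) ^ (-c.α) > c.t j * (c.τ * D) ^ (-c.α) ∧
      c.pMT r u * (c.τ * D) ^ (-c.α) < c.i0 then
    ENNReal.ofReal (h * (c.τ * D) ^ (-c.α) * c.pMT r u)
  else 0

/-- The interference at the probe base station `B`, when the probe terminal is associated with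
tier `j` on the event `assoc c Φ j`. -/
def interference {Ω : Type*} (c : Params) (Φ : Fin 2 → Ω → Set Plane) (B : Ω → Plane)
    (Ψ : Fin 2 → Ω → Set Interferer) (ω : Ω) : ℝ≥0∞ :=
  ∑ j, (assoc c Φ j).indicator
    (fun ω => ∑ k, ∑' p : Ψ k ω, c.contribution j k (B ω) (p : Interferer)) ω

/-- The network model. `Φ j` are the base stations of tier `j`, `B` is the location of the probe
base station (the one that serves the typical terminal), and `Ψ k` are the interferers of tier
`k`: a homogeneous Poisson process of density `lam k` whose points carry independent marks, the
pair of distances being distributed as that of the typical terminal given that it is associated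
with tier `k`, and the fading being exponential with unit mean. -/
structure IsNetwork {Ω : Type*} [MeasurableSpace Ω] (P : Measure Ω) (c : Params)
    (Φ : Fin 2 → Ω → Set Plane) (B : Ω → Plane) (Ψ : Fin 2 → Ω → Set Interferer) : Prop where
  poisson_bs : ∀ j, IsPoissonProcess P (ENNReal.ofReal (c.lam j) • (volume : Measure Plane)) (Φ j)
  indep_bs : Indep (countAlgebra (Φ 0)) (countAlgebra (Φ 1)) P
  measurable_probe : Measurable B
  probe_serves : ∀ᵐ ω ∂P, ∀ j, ω ∈ assoc c Φ j →
    B ω ∈ Φ j ω ∧ ‖B ω‖ = nearestDist (Φ j ω) 1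
  poisson_interferers : ∀ k, IsPoissonProcess P
    ((ENNReal.ofReal (c.lam k) • (volume : Measure Plane)).prod
      (((P[|assoc c Φ k]).map (fun ω => (servDist c Φ ω, interfDist c Φ ω))).prod
        (expMeasure 1))) (Ψ k)
  indep_interferers : iIndep
    ![countAlgebra (Φ 0) ⊔ countAlgebra (Φ 1) ⊔ MeasurableSpace.comap B inferInstance,
      countAlgebra (Ψ 0), countAlgebra (Ψ 1)] P

/-! ### The exponent of the Laplace transform of the interference -/

/-- Gauss's hypergeometric function for real arguments `z < 1` and `0 < b < c`: the
hypergeometric series for `|z| < 1`, and its analytic continuation, given by Euler's integral,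
beyond. -/
def gaussHypergeometric (a b c z : ℝ) : ℝ :=
  if |z| < 1 then ordinaryHypergeometric a b c z
  else Real.Gamma c / (Real.Gamma b * Real.Gamma (c - b)) *
    ∫ x in (0 : ℝ)..1, x ^ (b - 1) * (1 - x) ^ (c - b - 1) * (1 - x * z) ^ (-a)

section Exponent

variable {Ω : Type*} [MeasurableSpace Ω] (P : Measure Ω) (c : Params)
  (Φ : Fin 2 → Ω → Set Plane)

/-- The density of the distance to the nearest base station of tier `j`. -/
def Params.nearestPdf (c : Params) (j : Fin 2) (w : ℝ) : ℝ :=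
  2 * Real.pi * c.lam j * w * Real.exp (-Real.pi * c.lam j * w ^ 2)

/-- The probability that the nearest base station of tier `j` is further away than `w ≥ 0`. -/
def Params.nearestCcdf (c : Params) (j : Fin 2) (w : ℝ) : ℝ :=
  Real.exp (-Real.pi * c.lam j * w ^ 2)

/-- The joint density, at `0 < v < w`, of the distances to the nearest and the second nearest base
station of tier `j`. -/
def Params.nearestTwoPdf (c : Params) (j : Fin 2) (v w : ℝ) : ℝ :=
  4 * (Real.pi * c.lam j) ^ 2 * v * w * Real.exp (-Real.pi * c.lam j * w ^ 2)

/-- `ζ⁽ʲ⁾(v, w)` -/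
def Params.zeta (c : Params) (j : Fin 2) (v w : ℝ) : ℝ :=
  2 * Real.pi * c.lam j * v * Real.exp (-Real.pi * c.lam j * (max v w) ^ 2)

/-- The joint density of (serving distance, distance to the most interfered base station), given
association with tier `j` and most interfered base station in tier `m`. -/
def jointPdf (j m : Fin 2) (v w : ℝ) : ℝ :=
  open Classical in
  if j = m then
    if 0 < v ∧ v < w then
      c.nearestCcdf j.rev (max ((c.t j.rev / c.t j) ^ (1 / c.α) * v) w) * c.nearestTwoPdf j v w /
        P.real (assocInterf c Φ j j)
    else 0
  else
    if 0 < v ∧ (c.t m / c.t j) ^ (1 / c.α) * v < w then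
      c.nearestPdf m w * c.zeta j v w / P.real (assocInterf c Φ j m)
    else 0

/-- The minimal distance of a surviving interferer of tier `k` to a probe base station of
tier `j`. -/
def Params.minDist (c : Params) (j k : Fin 2) (r u : ℝ) : ℝ :=
  max ((c.t j / c.t k) ^ (1 / c.α) * r) (1 / c.τ * (c.pMT r u / c.i0) ^ (1 / c.α))

/-- `χ(s, r, u)` -/
def Params.chi (c : Params) (j k : Fin 2) (s r u : ℝ) : ℝ :=
  s * c.pMT r u * c.τ ^ (-c.α) / (c.α - 2) * c.minDist j k r u ^ (2 - c.α) *
    gaussHypergeometric 1 ((c.α - 2) / c.α) (2 - 2 / c.α)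
      (-s * c.pMT r u * c.τ ^ (-c.α) * c.minDist j k r u ^ (-c.α))

/-- `- ∑ₖ 2πλ⁽ᵏ⁾ ∑ₙ Pr(Q⁽ⁿ⁾ | X⁽ᵏ⁾) ∫₀^∞ ∫_{(t⁽ⁿ⁾/t⁽ᵏ⁾)^(1/α) r}^∞ f(r, u | X⁽ᵏ'ⁿ⁾) g(k, r, u) du dr` -/
def averaged (g : Fin 2 → ℝ → ℝ → ℝ) : ℝ :=
  -∑ k, 2 * Real.pi * c.lam k * ∑ n, (P[|assoc c Φ k]).real (assocInterf c Φ k n) *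
    ∫ r in Ioi (0 : ℝ), ∫ u in Ioi ((c.t n / c.t k) ^ (1 / c.α) * r),
      jointPdf P c Φ k n r u * g k r u

/-- `β⁽ʲ⁾(s)` -/
def beta (j : Fin 2) (s : ℝ) : ℝ :=
  averaged P c Φ fun k r u => c.chi j k s r u

end Exponent

end Uplink

end

noncomputable section

namespace Uplink

/-! ### Counting measures -/

section CountMeasure

variable {Ω E : Type*} [MeasurableSpace E]

/-! The moments of `I` are computed directly and matched with the derivatives of `β`; no Laplace
transform is needed.

Moments. The interferers are independent of the base stations and of the probe location `B`. On
association with tier `j`, freezing `B = b` therefore leaves a sum over two independent marked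
Poisson processes. Campbell's formulas (`lintegral_lintegral`, `lintegral_lintegral_mul`) give the
mean as the sum of the `∫ f dμ_k`, and the second moment as the square of that mean plus the sum of
the `∫ f² dμ_k`. Both indicators in the contribution are lower bounds on `D`, together `D > M`. In
polar coordinates the `i`-th power of the path loss then integrates to `2π M^(2 - iα) / (iα - 2)`,
and the fading contributes `i!` (`lintegral_contribution_pow`). Translation invariance removes `b`,
so only the tier `j` is left to average over (`lintegral_interference_pow`).

Derivatives. Write `χ = (m / (α - 2)) · s F(-sκ)` with `m = τ^(-α) p M^(2-α)`, `κ = τ^(-α) p M^(-α)`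
and `F` the hypergeometric function. The cap `i0` on the received interference is built into `M` and
forces `0 ≤ κ ≤ i0`. It also bounds `m`, together with `pmax` (`peakKernel_mem`, `meanKernel_mem`).
For `|s| < 1 / (2 i0)` the argument of `F` thus stays in `[-1/2, 1/2]`, where `F` is analytic, and
one may differentiate under the integral (`hasDerivAt_integral_mul_comp`). The values `F(0) = 1` and
`F'(0) = (α - 2) / (2(α - 1))` turn `β'(0)` into minus the conditional mean and `β''(0)` into the
conditional variance.

Marks. The two nearest distances of one tier have an explicit joint density, found from Poisson
counts in a disc and an annulus (`map_nearestDist`), and are independent of the nearest distance of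
the other tier. Integrating out whichever of the three distances is neither `R` nor `U` yields the
stated densities (`map_restrict_assocInterf`). Ties are null, so these events partition the
association event, and `averaged` becomes an integral against the law of the marks (`averaged_eq`).
-/

/-- The counting measure of a set of points, as a sum of Dirac masses. -/
def countMeasure (S : Set E) : Measure E := Measure.sum fun p : S => Measure.dirac (p : E)

lemma lintegral_countMeasure (S : Set E) {f : E → ℝ≥0∞} (hf : Measurable f) :
    ∫⁻ p, f p ∂countMeasure S = ∑' p : S, f p := by
  simp [countMeasure, lintegral_sum_measure, lintegral_dirac' _ hf]

lemma countMeasure_apply (S : Set E) {A : Set E} (hA : MeasurableSet A) :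
    countMeasure S A = ((S ∩ A).encard : ℝ≥0∞) := by
  rw [← lintegral_indicator_one hA, lintegral_countMeasure S (measurable_one.indicator hA),
    ← ENNReal.tsum_set_one, tsum_subtype S (A.indicator 1),
    tsum_subtype (S ∩ A) (fun _ => (1 : ℝ≥0∞)), ← indicator_indicator]
  rfl

lemma measurable_encard_inter (Ψ : Ω → Set E) {A : Set E}
    (hA : MeasurableSet A) : Measurable[countAlgebra Ψ] fun ω => (Ψ ω ∩ A).encard := by
  refine Measurable.mono (comap_measurable _) ?_ le_rfl
  exact le_iSup₂ (f := fun (A : Set E) (_ : MeasurableSet A) =>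
    MeasurableSpace.comap (fun ω => (Ψ ω ∩ A).encard) inferInstance) A hA

/-- Measurability for `countAlgebra Ψ`, and not only for the ambient σ-algebra, lets independence of
the count algebras pass to sums over the points. -/
lemma measurable_countMeasure (Ψ : Ω → Set E) :
    Measurable[countAlgebra Ψ] fun ω => countMeasure (Ψ ω) := by
  refine @Measure.measurable_of_measurable_coe E Ω _ (countAlgebra Ψ) _ fun A hA => ?_
  simp only [countMeasure_apply _ hA]
  exact (measurable_of_countable (fun n : ℕ∞ => (n : ℝ≥0∞))).comp
    (measurable_encard_inter Ψ hA)

end CountMeasure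

/-! ### Moments of the Poisson distribution -/

lemma lintegral_poissonMeasure (r : ℝ≥0) (f : ℕ → ℝ≥0∞) :
    ∫⁻ n, f n ∂poissonMeasure r =
      ∑' n, f n * ENNReal.ofReal (Real.exp (-r) * r ^ n / n.factorial) := by
  simp [lintegral_countable', poissonMeasure_singleton]

/-- The Stein–Chen identity: `(n + 1) · r^(n+1) / (n+1)! = r · r^n / n!`, and the term `n = 0`
vanishes. The first two moments follow with `f = 1` and `f = id`. -/
lemma lintegral_nat_mul_poissonMeasure (r : ℝ≥0) (f : ℕ → ℝ≥0∞) :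
    ∫⁻ n, n * f n ∂poissonMeasure r = r * ∫⁻ n, f (n + 1) ∂poissonMeasure r := by
  rw [lintegral_poissonMeasure, lintegral_poissonMeasure,
    tsum_eq_zero_add' ENNReal.summable, ← ENNReal.tsum_mul_left]
  simp only [CharP.cast_eq_zero, zero_mul, zero_add]
  congr 1 with n
  have h : ENNReal.ofReal (Real.exp (-r) * r ^ n / n.factorial) * r =
      ((n + 1 : ℕ) : ℝ≥0∞) *
        ENNReal.ofReal (Real.exp (-r) * r ^ (n + 1) / (n + 1).factorial) := by
    rw [← ENNReal.ofReal_coe_nnreal, ← ENNReal.ofReal_natCast (n + 1),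
      ← ENNReal.ofReal_mul (by positivity), ← ENNReal.ofReal_mul (by positivity)]
    congr 1
    rw [Nat.factorial_succ]
    push_cast
    field_simp
    ring
  calc _ = f (n + 1) * (((n + 1 : ℕ) : ℝ≥0∞) *
        ENNReal.ofReal (Real.exp (-r) * r ^ (n + 1) / (n + 1).factorial)) := by ring
    _ = _ := by rw [← h]; ring

lemma lintegral_nat_poissonMeasure (r : ℝ≥0) : ∫⁻ n, (n : ℝ≥0∞) ∂poissonMeasure r = r := by
  simpa using lintegral_nat_mul_poissonMeasure r 1

lemma lintegral_nat_sq_poissonMeasure (r : ℝ≥0) :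
    ∫⁻ n, (n : ℝ≥0∞) ^ 2 ∂poissonMeasure r = r ^ 2 + r := by
  have h := lintegral_nat_mul_poissonMeasure r (fun n => n)
  simp only [← sq] at h
  rw [h]
  push_cast
  rw [lintegral_add_right _ measurable_const, lintegral_nat_poissonMeasure]
  simp
  ring

/-! ### Moment measures of a Poisson process -/

namespace IsPoissonProcess

variable {Ω E : Type*} [mΩ : MeasurableSpace Ω] [MeasurableSpace E] {P : Measure Ω} {μ : Measure E}
  {Ψ : Ω → Set E}

lemma countAlgebra_le (h : IsPoissonProcess P μ Ψ) : countAlgebra Ψ ≤ mΩ :=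
  iSup₂_le fun A hA => (h.measurable_count A hA).comap_le

lemma measurable_countMeasure (h : IsPoissonProcess P μ Ψ) :
    Measurable fun ω => countMeasure (Ψ ω) :=
  (Uplink.measurable_countMeasure Ψ).mono h.countAlgebra_le le_rfl

/-- `law_count` fixes the masses at finite `n` only. They already add up to one, which settles the
mass at `⊤`. -/
lemma map_encard [IsProbabilityMeasure P] (h : IsPoissonProcess P μ Ψ) {A : Set E}
    (hA : MeasurableSet A) (hμ : μ A ≠ ∞) :
    P.map (fun ω => (Ψ ω ∩ A).encard) =
      (poissonMeasure (μ A).toNNReal).map (fun n : ℕ => (n : ℕ∞)) := by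
  have hm := h.measurable_count A hA
  have hc : Measurable (fun n : ℕ => (n : ℕ∞)) := measurable_of_countable _
  have hn (n : ℕ) : P.map (fun ω => (Ψ ω ∩ A).encard) {(n : ℕ∞)} =
      (poissonMeasure (μ A).toNNReal).map (fun n : ℕ => (n : ℕ∞)) {(n : ℕ∞)} := by
    rw [Measure.map_apply hm (measurableSet_singleton _),
      Measure.map_apply hc (measurableSet_singleton _)]
    have e : (fun n : ℕ => (n : ℕ∞)) ⁻¹' {(n : ℕ∞)} = {n} := by ext m; simp
    rw [e]
    exact h.law_count A hA hμ n
  have := Measure.isProbabilityMeasure_map (μ := P) hm.aemeasurable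
  have := Measure.isProbabilityMeasure_map (μ := poissonMeasure (μ A).toNNReal) hc.aemeasurable
  have hr : MeasurableSet (range (fun n : ℕ => (n : ℕ∞))) := (countable_range _).measurableSet
  have hrange : P.map (fun ω => (Ψ ω ∩ A).encard) (range (fun n : ℕ => (n : ℕ∞))) =
      (poissonMeasure (μ A).toNNReal).map (fun n : ℕ => (n : ℕ∞))
        (range (fun n : ℕ => (n : ℕ∞))) := by
    rw [← iUnion_singleton_eq_range]
    rw [measure_iUnion, measure_iUnion]
    · exact tsum_congr hn
    · intro i j hij; simpa using hij
    · exact fun _ => measurableSet_singleton _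
    · intro i j hij; simpa using hij
    · exact fun _ => measurableSet_singleton _
  have htop : ({⊤} : Set ℕ∞) = (range (fun n : ℕ => (n : ℕ∞)))ᶜ := by
    ext x
    induction x using ENat.recTopCoe <;> simp
  refine Measure.ext_of_singleton fun x => ?_
  induction x using ENat.recTopCoe with
  | top => rw [htop, prob_compl_eq_one_sub hr, prob_compl_eq_one_sub hr, hrange]
  | coe n => exact hn n

lemma lintegral_comp_countMeasure [IsProbabilityMeasure P] (h : IsPoissonProcess P μ Ψ) {A : Set E}
    (hA : MeasurableSet A) (hμ : μ A ≠ ∞) (g : ℝ≥0∞ → ℝ≥0∞) :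
    ∫⁻ ω, g (countMeasure (Ψ ω) A) ∂P = ∫⁻ n, g (n : ℝ≥0∞) ∂poissonMeasure (μ A).toNNReal := by
  have hm := h.measurable_count A hA
  have hg : Measurable fun n : ℕ∞ => g (n : ℝ≥0∞) := measurable_of_countable _
  simp only [countMeasure_apply _ hA]
  rw [← lintegral_map (f := fun n : ℕ∞ => g (n : ℝ≥0∞)) hg hm, h.map_encard hA hμ,
    lintegral_map hg (measurable_of_countable _)]
  simp

lemma lintegral_countMeasure_apply [IsProbabilityMeasure P] (h : IsPoissonProcess P μ Ψ) {A : Set E}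
    (hA : MeasurableSet A) (hμ : μ A ≠ ∞) : ∫⁻ ω, countMeasure (Ψ ω) A ∂P = μ A := by
  rw [h.lintegral_comp_countMeasure hA hμ (fun x => x), lintegral_nat_poissonMeasure,
    ENNReal.coe_toNNReal hμ]

lemma lintegral_countMeasure_apply_sq [IsProbabilityMeasure P] (h : IsPoissonProcess P μ Ψ)
    {A : Set E} (hA : MeasurableSet A) (hμ : μ A ≠ ∞) :
    ∫⁻ ω, countMeasure (Ψ ω) A ^ 2 ∂P = μ A ^ 2 + μ A := by
  rw [h.lintegral_comp_countMeasure hA hμ (fun x => x ^ 2), lintegral_nat_sq_poissonMeasure,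
    ENNReal.coe_toNNReal hμ]

lemma measurable_countMeasure_apply (h : IsPoissonProcess P μ Ψ) {A : Set E}
    (hA : MeasurableSet A) : Measurable fun ω => countMeasure (Ψ ω) A :=
  (Measure.measurable_coe hA).comp h.measurable_countMeasure

lemma measurable_lintegral_countMeasure (h : IsPoissonProcess P μ Ψ) {f : E → ℝ≥0∞}
    (hf : Measurable f) : Measurable fun ω => ∫⁻ p, f p ∂countMeasure (Ψ ω) :=
  (Measure.measurable_lintegral hf).comp h.measurable_countMeasure

lemma lintegral_countMeasure_mul_of_disjoint [IsProbabilityMeasure P] (h : IsPoissonProcess P μ Ψ)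
    {A B : Set E} (hA : MeasurableSet A) (hB : MeasurableSet B) (hAB : Disjoint A B)
    (hμA : μ A ≠ ∞) (hμB : μ B ≠ ∞) :
    ∫⁻ ω, countMeasure (Ψ ω) A * countMeasure (Ψ ω) B ∂P = μ A * μ B := by
  have hi := (h.indep_count 2 ![A, B] (by simp [Fin.forall_fin_two, hA, hB]) (by
    intro i j hij
    fin_cases i <;> fin_cases j <;> simp_all [disjoint_comm])).indepFun
      (show (0 : Fin 2) ≠ 1 by simp)
  have hc : Measurable fun n : ℕ∞ => (n : ℝ≥0∞) := measurable_of_countable _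
  have hi' := hi.comp hc hc
  have e (S : Set E) (hS : MeasurableSet S) : (fun n : ℕ∞ => (n : ℝ≥0∞)) ∘
      (fun ω => (Ψ ω ∩ S).encard) = fun ω => countMeasure (Ψ ω) S := by
    ext ω; simp [countMeasure_apply _ hS]
  simp only [Matrix.cons_val_zero, Matrix.cons_val_one, e _ hA, e _ hB] at hi'
  have := lintegral_mul_eq_lintegral_mul_lintegral_of_indepFun
    (h.measurable_countMeasure_apply hA) (h.measurable_countMeasure_apply hB) hi'
  simp only [Pi.mul_apply] at this
  rw [this, h.lintegral_countMeasure_apply hA hμA, h.lintegral_countMeasure_apply hB hμB]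

/-- Cutting into `A ∩ B`, `A \ B` and `B \ A` leaves products over disjoint sets, which factor by
independence, and one square; the second Poisson moment of that square is the source of `μ (A ∩ B)`.
-/
lemma lintegral_countMeasure_mul [IsProbabilityMeasure P] (h : IsPoissonProcess P μ Ψ)
    {A B : Set E} (hA : MeasurableSet A) (hB : MeasurableSet B) (hμA : μ A ≠ ∞) (hμB : μ B ≠ ∞) :
    ∫⁻ ω, countMeasure (Ψ ω) A * countMeasure (Ψ ω) B ∂P = μ A * μ B + μ (A ∩ B) := by
  have eA (ν : Measure E) : ν A = ν (A ∩ B) + ν (A \ B) := (measure_inter_add_sdiff A hB).symm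
  have eB (ν : Measure E) : ν B = ν (A ∩ B) + ν (B \ A) := by
    rw [inter_comm]; exact (measure_inter_add_sdiff B hA).symm
  have mC := hA.inter hB
  have mA := hA.diff hB
  have mB := hB.diff hA
  have fC : μ (A ∩ B) ≠ ∞ := measure_ne_top_of_subset inter_subset_left hμA
  have fA : μ (A \ B) ≠ ∞ := measure_ne_top_of_subset sdiff_subset hμA
  have fB : μ (B \ A) ≠ ∞ := measure_ne_top_of_subset sdiff_subset hμB
  have e (ω : Ω) : countMeasure (Ψ ω) A * countMeasure (Ψ ω) B =
      countMeasure (Ψ ω) (A ∩ B) ^ 2 + countMeasure (Ψ ω) (A ∩ B) * countMeasure (Ψ ω) (B \ A) +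
      countMeasure (Ψ ω) (A \ B) * countMeasure (Ψ ω) (A ∩ B) +
      countMeasure (Ψ ω) (A \ B) * countMeasure (Ψ ω) (B \ A) := by
    rw [eA, eB (countMeasure (Ψ ω))]; ring
  have nC := h.measurable_countMeasure_apply mC
  have nA := h.measurable_countMeasure_apply mA
  have nB := h.measurable_countMeasure_apply mB
  have nAB : Measurable fun ω => countMeasure (Ψ ω) (A \ B) * countMeasure (Ψ ω) (B \ A) :=
    nA.mul nB
  have nAC : Measurable fun ω => countMeasure (Ψ ω) (A \ B) * countMeasure (Ψ ω) (A ∩ B) :=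
    nA.mul nC
  have nCB : Measurable fun ω => countMeasure (Ψ ω) (A ∩ B) * countMeasure (Ψ ω) (B \ A) :=
    nC.mul nB
  simp_rw [e]
  rw [lintegral_add_right _ nAB, lintegral_add_right _ nAC, lintegral_add_right _ nCB,
    h.lintegral_countMeasure_apply_sq mC fC,
    h.lintegral_countMeasure_mul_of_disjoint mC mB _ fC fB,
    h.lintegral_countMeasure_mul_of_disjoint mA mC _ fA fC,
    h.lintegral_countMeasure_mul_of_disjoint mA mB _ fA fB, eA μ, eB μ]
  · ring
  · exact disjoint_sdiff_right.mono_left sdiff_subset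
  · exact disjoint_sdiff_left.mono_right inter_subset_right
  · exact disjoint_sdiff_right.mono_left inter_subset_left

end IsPoissonProcess

/-- Two measures which agree on the measurable sets of finite measure with respect to a third,
sigma-finite measure are equal. -/
lemma measure_ext_of_finite {E : Type*} [MeasurableSpace E] (μ : Measure E) [SigmaFinite μ]
    {ν₁ ν₂ : Measure E} (h : ∀ A, MeasurableSet A → μ A ≠ ∞ → ν₁ A = ν₂ A) : ν₁ = ν₂ := by
  refine (Measure.ext_iff_of_iUnion_eq_univ (iUnion_spanningSets μ)).2 fun i => ?_
  ext A hA
  rw [Measure.restrict_apply hA, Measure.restrict_apply hA]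
  exact h _ (hA.inter (measurableSet_spanningSets μ i)) (measure_ne_top_of_subset inter_subset_right
    (measure_spanningSets_lt_top μ i).ne)

namespace IsPoissonProcess

variable {Ω E : Type*} [mΩ : MeasurableSpace Ω] [MeasurableSpace E] {P : Measure Ω} {μ : Measure E}
  {Ψ : Ω → Set E}

/-- The `bind` is the mean counting measure weighted by `Y`. Packaging the expectations as a measure
lets identities on sets pass to integrals of functions through uniqueness of measures. -/
lemma bind_apply (h : IsPoissonProcess P μ Ψ) {Y : Ω → ℝ≥0∞} (hY : Measurable Y) {A : Set E}
    (hA : MeasurableSet A) : (P.withDensity Y).bind (fun ω => countMeasure (Ψ ω)) A =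
      ∫⁻ ω, Y ω * countMeasure (Ψ ω) A ∂P := by
  rw [Measure.bind_apply hA h.measurable_countMeasure.aemeasurable,
    lintegral_withDensity_eq_lintegral_mul _ hY (h.measurable_countMeasure_apply hA)]
  rfl

lemma lintegral_bind (h : IsPoissonProcess P μ Ψ) {Y : Ω → ℝ≥0∞} (hY : Measurable Y)
    {f : E → ℝ≥0∞} (hf : Measurable f) :
    ∫⁻ p, f p ∂(P.withDensity Y).bind (fun ω => countMeasure (Ψ ω)) =
      ∫⁻ ω, Y ω * ∫⁻ p, f p ∂countMeasure (Ψ ω) ∂P := by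
  rw [Measure.lintegral_bind h.measurable_countMeasure.aemeasurable hf.aemeasurable,
    lintegral_withDensity_eq_lintegral_mul _ hY (h.measurable_lintegral_countMeasure hf)]
  rfl

/-- Campbell's formula for the mean. -/
lemma lintegral_lintegral [IsProbabilityMeasure P] [SigmaFinite μ] (h : IsPoissonProcess P μ Ψ)
    {f : E → ℝ≥0∞} (hf : Measurable f) :
    ∫⁻ ω, ∫⁻ p, f p ∂countMeasure (Ψ ω) ∂P = ∫⁻ p, f p ∂μ := by
  -- With weight `Y = 1` this is the unweighted mean measure.
  have : (P.withDensity 1).bind (fun ω => countMeasure (Ψ ω)) = μ :=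
    measure_ext_of_finite μ fun A hA hμ => by
      rw [h.bind_apply measurable_one hA]
      simpa using h.lintegral_countMeasure_apply hA hμ
  rw [← this, h.lintegral_bind measurable_one hf]
  simp

/-- The product formula for counts needs both sets to have finite intensity. Extensionality is
applied twice: fixing a finite `B` frees `A`, and the symmetry of the product then frees `B`. -/
lemma bind_countMeasure [IsProbabilityMeasure P] [SigmaFinite μ] (h : IsPoissonProcess P μ Ψ)
    {A : Set E} (hA : MeasurableSet A) :
    (P.withDensity fun ω => countMeasure (Ψ ω) A).bind (fun ω => countMeasure (Ψ ω)) =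
      μ A • μ + μ.restrict A := by
  refine measure_ext_of_finite μ fun B hB hμB => ?_
  rw [h.bind_apply (h.measurable_countMeasure_apply hA) hB]
  have : (P.withDensity fun ω => countMeasure (Ψ ω) B).bind (fun ω => countMeasure (Ψ ω)) =
      μ B • μ + μ.restrict B := by
    refine measure_ext_of_finite μ fun A hA hμA => ?_
    rw [h.bind_apply (h.measurable_countMeasure_apply hB) hA,
      h.lintegral_countMeasure_mul hB hA hμB hμA]
    simp [Measure.restrict_apply hA, inter_comm]
  have h2 := DFunLike.congr_fun this A
  rw [h.bind_apply (h.measurable_countMeasure_apply hB) hA] at h2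
  simp_rw [mul_comm (countMeasure _ A), h2]
  simp [Measure.restrict_apply hA, Measure.restrict_apply hB, inter_comm, mul_comm]

/-- Campbell's formula for second moments. -/
lemma lintegral_lintegral_mul [IsProbabilityMeasure P] [SigmaFinite μ]
    (h : IsPoissonProcess P μ Ψ) {f g : E → ℝ≥0∞} (hf : Measurable f) (hg : Measurable g) :
    ∫⁻ ω, (∫⁻ p, f p ∂countMeasure (Ψ ω)) * ∫⁻ p, g p ∂countMeasure (Ψ ω) ∂P =
      (∫⁻ p, f p ∂μ) * (∫⁻ p, g p ∂μ) + ∫⁻ p, f p * g p ∂μ := by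
  have hF := h.measurable_lintegral_countMeasure hf
  -- The same symmetry once more: the count of `A` weighted by `∫ f` is read as the integral of `f`
  -- weighted by the count of `A`, to which `bind_countMeasure` applies.
  have : (P.withDensity fun ω => ∫⁻ p, f p ∂countMeasure (Ψ ω)).bind
      (fun ω => countMeasure (Ψ ω)) = (∫⁻ p, f p ∂μ) • μ + μ.withDensity f := by
    ext A hA
    rw [h.bind_apply hF hA]
    simp_rw [mul_comm _ (countMeasure _ A)]
    rw [← h.lintegral_bind (h.measurable_countMeasure_apply hA) hf, h.bind_countMeasure hA]
    simp [lintegral_add_measure, withDensity_apply _ hA, mul_comm]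
  rw [← h.lintegral_bind hF hg, this, lintegral_add_measure, lintegral_smul_measure,
    lintegral_withDensity_eq_lintegral_mul _ hf hg]
  rfl

end IsPoissonProcess

/-! ### Locally finite kernels -/

/-- Slice the base according to the integer part `m` of the total mass; on the slice `m` the mass is
uniformly below `m + 1`, so each piece is a finite kernel. -/
lemma isSFiniteKernel_of_forall_lt_top {S E : Type*} [MeasurableSpace S] [MeasurableSpace E]
    (κ : Kernel S E) (h : ∀ a, κ a univ < ∞) : IsSFiniteKernel κ := by
  classical
  let s (m : ℕ) : Set S := {a | (m : ℝ≥0∞) ≤ κ a univ ∧ κ a univ < (m + 1 : ℕ)}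
  have hs (m : ℕ) : MeasurableSet (s m) :=
    (measurableSet_le measurable_const (κ.measurable_coe .univ)).inter
      (measurableSet_lt (κ.measurable_coe .univ) measurable_const)
  have hκ : κ = Kernel.sum fun m => Kernel.piecewise (hs m) κ 0 := by
    ext a A hA
    rw [Kernel.sum_apply' _ _ hA, tsum_eq_single ⌊(κ a univ).toReal⌋₊]
    · rw [Kernel.piecewise_apply', if_pos]
      have h1 := Nat.floor_le (a := (κ a univ).toReal) ENNReal.toReal_nonneg
      have h2 := Nat.lt_floor_add_one (κ a univ).toReal
      refine ⟨?_, ?_⟩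
      · rw [← ENNReal.ofReal_natCast]
        exact ENNReal.ofReal_le_of_le_toReal h1
      · refine (ENNReal.lt_ofReal_iff_toReal_lt (h a).ne).2 (b := _) ?_ |>.trans_eq
          (ENNReal.ofReal_natCast _)
        exact_mod_cast h2
    · intro m hm
      rw [Kernel.piecewise_apply', if_neg]
      · simp
      · rintro ⟨h1, h2⟩
        refine hm ((Nat.floor_eq_iff ENNReal.toReal_nonneg).2 ⟨?_, ?_⟩).symm
        · simpa using ENNReal.toReal_mono (h a).ne h1
        · have := ENNReal.toReal_strict_mono (ENNReal.natCast_ne_top _) h2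
          rw [ENNReal.toReal_natCast] at this
          exact_mod_cast this
  rw [hκ]
  have (m : ℕ) : IsFiniteKernel (Kernel.piecewise (hs m) κ 0) := by
    refine ⟨(m + 1 : ℕ), ENNReal.natCast_lt_top _, fun a => ?_⟩
    rw [Kernel.piecewise_apply']
    split_ifs with ha
    · exact ha.2.le
    · simp
  infer_instance

/-- Here the target is sliced instead: restriction to the disjointed `B n` has finite mass at each
point of the base. -/
lemma isSFiniteKernel_of_iUnion_eq_univ {S E : Type*} [MeasurableSpace S] [MeasurableSpace E]
    (κ : Kernel S E) {B : ℕ → Set E} (hB : ∀ n, MeasurableSet (B n)) (hU : ⋃ n, B n = univ)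
    (h : ∀ a n, κ a (B n) < ∞) : IsSFiniteKernel κ := by
  have hD (n : ℕ) : MeasurableSet (disjointed B n) := MeasurableSet.disjointed hB n
  have hκ : κ = Kernel.sum fun n => κ.restrict (hD n) := by
    ext a A hA
    rw [Kernel.sum_apply' _ _ hA]
    simp_rw [Kernel.restrict_apply' κ (hD _) a hA]
    rw [← measure_iUnion, ← inter_iUnion, iUnion_disjointed, hU, inter_univ]
    · exact fun i j hij => ((disjoint_disjointed B) hij).mono inter_subset_right inter_subset_right
    · exact fun i => hA.inter (hD i)
  have (n : ℕ) : IsSFiniteKernel (κ.restrict (hD n)) := by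
    refine isSFiniteKernel_of_forall_lt_top _ fun a => ?_
    rw [Kernel.restrict_apply' κ (hD n) a .univ, univ_inter]
    exact (measure_mono (disjointed_subset B n)).trans_lt (h a n)
  rw [hκ]
  infer_instance

section LocallyFinite

variable {E : Type*} [MeasurableSpace E] (μ : Measure E) [SigmaFinite μ]

/-- The measures which are finite on all the spanning sets of `μ`. -/
def locallyFiniteSet : Set (Measure E) := {ν | ∀ n, ν (spanningSets μ n) < ∞}

lemma measurableSet_locallyFiniteSet : MeasurableSet (locallyFiniteSet μ) := by
  rw [locallyFiniteSet, ofPred_forall]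
  exact MeasurableSet.iInter fun n => measurableSet_lt
    (Measure.measurable_coe (measurableSet_spanningSets μ n)) measurable_const

open Classical in
/-- The tautological kernel on measures, with the measures which are not finite on the spanning
sets of `μ` replaced by zero. -/
def locallyFiniteKernel : Kernel (Measure E) E where
  toFun ν := if ν ∈ locallyFiniteSet μ then ν else 0
  measurable' := Measurable.ite (measurableSet_locallyFiniteSet μ) measurable_id measurable_const

lemma locallyFiniteKernel_of_mem {ν : Measure E} (h : ν ∈ locallyFiniteSet μ) :
    locallyFiniteKernel μ ν = ν := if_pos h

/-- S-finiteness makes `(x, ν) ↦ ∫ f (x, p) dν(p)` jointly measurable. This is required because the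
contribution of an interferer depends on the random probe location. -/
instance : IsSFiniteKernel (locallyFiniteKernel μ) := by
  refine isSFiniteKernel_of_iUnion_eq_univ _ (measurableSet_spanningSets μ)
    (iUnion_spanningSets μ) fun ν n => ?_
  classical
  change (if ν ∈ locallyFiniteSet μ then ν else 0) _ < ∞
  split_ifs with h
  · exact h n
  · simp

end LocallyFinite

lemma IsPoissonProcess.ae_mem_locallyFiniteSet {Ω E : Type*} [MeasurableSpace Ω]
    [MeasurableSpace E] {P : Measure Ω} [IsProbabilityMeasure P] {μ : Measure E} [SigmaFinite μ]
    {Ψ : Ω → Set E} (h : IsPoissonProcess P μ Ψ) :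
    ∀ᵐ ω ∂P, countMeasure (Ψ ω) ∈ locallyFiniteSet μ := by
  refine ae_all_iff.2 fun n => ?_
  refine ae_lt_top (h.measurable_countMeasure_apply (measurableSet_spanningSets μ n)) ?_
  rw [h.lintegral_countMeasure_apply (measurableSet_spanningSets μ n)
    (measure_spanningSets_lt_top μ n).ne]
  exact (measure_spanningSets_lt_top μ n).ne

/-! ### Moments of random sums over independent Poisson processes -/

lemma lintegral_comp_of_indepFun {Ω S T : Type*} [MeasurableSpace Ω] [MeasurableSpace S]
    [MeasurableSpace T] {P : Measure Ω} [IsProbabilityMeasure P] {X : Ω → S} {Y : Ω → T}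
    (hX : Measurable X) (hY : Measurable Y) (h : IndepFun X Y P) {F : S × T → ℝ≥0∞}
    (hF : Measurable F) :
    ∫⁻ ω, F (X ω, Y ω) ∂P = ∫⁻ ω, ∫⁻ ω', F (X ω, Y ω') ∂P ∂P := by
  have hXY := (indepFun_iff_map_prod_eq_prod_map_map hX.aemeasurable hY.aemeasurable).1 h
  have := Measure.isProbabilityMeasure_map (μ := P) hY.aemeasurable
  rw [← lintegral_map (f := F) (g := fun ω => (X ω, Y ω)) hF (hX.prodMk hY), hXY,
    lintegral_prod _ hF.aemeasurable, lintegral_map hF.lintegral_prod_right' hX]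
  refine lintegral_congr fun ω => ?_
  exact lintegral_map (hF.comp measurable_prodMk_left) hY

section Sums

variable {Ω E S : Type*} {G : MeasurableSpace Ω} [mΩ : MeasurableSpace Ω] [MeasurableSpace E] [MeasurableSpace S]
  {P : Measure Ω} [IsProbabilityMeasure P] {μ : Fin 2 → Measure E} [∀ k, SigmaFinite (μ k)]
  {Ψ : Fin 2 → Ω → Set E} {X : Ω → S}

/-- Freezing: `X` is independent of the pair of point processes, so they may be resampled
independently of it. Independence is applied to the random counting measures themselves, as values
in a space of measures. -/
lemma lintegral_comp_sum_countMeasure (hΨ : ∀ k, IsPoissonProcess P (μ k) (Ψ k))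
    (hG : G ≤ mΩ) (hi : iIndep ![G, countAlgebra (Ψ 0), countAlgebra (Ψ 1)] P)
    (hX : Measurable[G] X) {f : Fin 2 → S × E → ℝ≥0∞} (hf : ∀ k, Measurable (f k))
    {g : S × ℝ≥0∞ → ℝ≥0∞} (hg : Measurable g) :
    ∫⁻ ω, g (X ω, ∑ k, ∫⁻ p, f k (X ω, p) ∂countMeasure (Ψ k ω)) ∂P =
      ∫⁻ ω, ∫⁻ ω', g (X ω, ∑ k, ∫⁻ p, f k (X ω, p) ∂countMeasure (Ψ k ω')) ∂P ∂P := by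
  let Y : Ω → Fin 2 → Measure E := fun ω k => countMeasure (Ψ k ω)
  have hY : Measurable Y := measurable_pi_lambda _ fun k => (hΨ k).measurable_countMeasure
  have hXY : IndepFun X Y P := by
    have hle : ∀ i, ![G, countAlgebra (Ψ 0), countAlgebra (Ψ 1)] i ≤ mΩ := by
      have := (hΨ 0).countAlgebra_le
      have := (hΨ 1).countAlgebra_le
      simp_all [Fin.forall_fin_succ]
    have h := indep_iSup_of_disjoint hle hi (S := {0}) (T := {1, 2}) (by simp)
    refine indep_of_indep_of_le_left (indep_of_indep_of_le_right h ?_) ?_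
    · refine Measurable.comap_le (@measurable_pi_lambda _ _ _ (_) _ _ fun k => ?_)
      refine (measurable_countMeasure (Ψ k)).mono ?_ le_rfl
      fin_cases k
      · exact le_iSup₂_of_le (1 : Fin 3) (by simp) le_rfl
      · exact le_iSup₂_of_le (2 : Fin 3) (by simp) le_rfl
    · simpa using hX.comap_le
  -- The tautological integral is replaced by the one against `locallyFiniteKernel`, which is
  -- jointly measurable; by `hae` the two agree almost surely.
  have hF : Measurable fun q : S × (Fin 2 → Measure E) =>
      g (q.1, ∑ k, ∫⁻ p, f k (q.1, p) ∂locallyFiniteKernel (μ k) (q.2 k)) := by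
    refine hg.comp (measurable_fst.prodMk (Finset.measurable_sum _ fun k _ => ?_))
    let κ : Kernel (S × (Fin 2 → Measure E)) E := (locallyFiniteKernel (μ k)).comap
      (fun q => q.2 k) ((measurable_pi_apply k).comp measurable_snd)
    exact Measurable.lintegral_kernel_prod_right' (κ := κ)
      (f := fun q => f k (q.1.1, q.2)) ((hf k).comp (by fun_prop))
  have hae : ∀ᵐ ω ∂P, ∀ k, locallyFiniteKernel (μ k) (Y ω k) = countMeasure (Ψ k ω) :=
    ae_all_iff.2 fun k => (hΨ k).ae_mem_locallyFiniteSet.mono fun ω h =>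
      locallyFiniteKernel_of_mem _ h
  have h := lintegral_comp_of_indepFun (hX.mono hG le_rfl) hY hXY hF
  refine Eq.trans (lintegral_congr_ae (hae.mono fun ω h => ?_))
    (h.trans (lintegral_congr fun ω => lintegral_congr_ae (hae.mono fun ω' h => ?_)))
  · simp only [h]
  · simp only [h]

lemma IsPoissonProcess.aemeasurable_lintegral_comp {μ : Measure E} [SigmaFinite μ] {Ψ : Ω → Set E}
    (h : IsPoissonProcess P μ Ψ) (hX : Measurable X) {f : S × E → ℝ≥0∞} (hf : Measurable f) :
    AEMeasurable (fun ω => ∫⁻ p, f (X ω, p) ∂countMeasure (Ψ ω)) P := by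
  let κ : Kernel (S × Measure E) E := (locallyFiniteKernel μ).comap Prod.snd measurable_snd
  have hF : Measurable fun q : S × Measure E => ∫⁻ p, f (q.1, p) ∂κ q :=
    Measurable.lintegral_kernel_prod_right' (κ := κ)
      (f := fun q => f (q.1.1, q.2)) (hf.comp (by fun_prop))
  refine ⟨_, hF.comp (hX.prodMk h.measurable_countMeasure), ?_⟩
  filter_upwards [h.ae_mem_locallyFiniteSet] with ω hω
  exact congrArg (fun ν => ∫⁻ p, f (X ω, p) ∂ν) (locallyFiniteKernel_of_mem μ hω).symm

lemma lintegral_sum_countMeasure (hΨ : ∀ k, IsPoissonProcess P (μ k) (Ψ k))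
    {f : Fin 2 → E → ℝ≥0∞} (hf : ∀ k, Measurable (f k)) :
    ∫⁻ ω, ∑ k, ∫⁻ p, f k p ∂countMeasure (Ψ k ω) ∂P = ∑ k, ∫⁻ p, f k p ∂μ k := by
  rw [lintegral_finsetSum _ fun k _ => (hΨ k).measurable_lintegral_countMeasure (hf k)]
  exact Finset.sum_congr rfl fun k _ => (hΨ k).lintegral_lintegral (hf k)

/-- The cross term factors by independence of the two processes, so only the diagonal terms produce
an excess `∫ f²` over the squared mean. -/
lemma lintegral_sum_countMeasure_sq (hΨ : ∀ k, IsPoissonProcess P (μ k) (Ψ k))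
    (hi : Indep (countAlgebra (Ψ 0)) (countAlgebra (Ψ 1)) P)
    {f : Fin 2 → E → ℝ≥0∞} (hf : ∀ k, Measurable (f k)) :
    ∫⁻ ω, (∑ k, ∫⁻ p, f k p ∂countMeasure (Ψ k ω)) ^ 2 ∂P =
      (∑ k, ∫⁻ p, f k p ∂μ k) ^ 2 + ∑ k, ∫⁻ p, f k p ^ 2 ∂μ k := by
  let T (k : Fin 2) (ω : Ω) := ∫⁻ p, f k p ∂countMeasure (Ψ k ω)
  have hT (k) : Measurable (T k) := (hΨ k).measurable_lintegral_countMeasure (hf k)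
  have hTΨ (k) : Measurable[countAlgebra (Ψ k)] (T k) :=
    (Measure.measurable_lintegral (hf k)).comp (measurable_countMeasure (Ψ k))
  have hI : IndepFun (T 0) (T 1) P :=
    indep_of_indep_of_le_left (indep_of_indep_of_le_right hi (hTΨ 1).comap_le) (hTΨ 0).comap_le
  have h2 (k) : ∫⁻ ω, T k ω * T k ω ∂P = (∫⁻ p, f k p ∂μ k) ^ 2 + ∫⁻ p, f k p ^ 2 ∂μ k := by
    simp only [T, (hΨ k).lintegral_lintegral_mul (hf k) (hf k), sq]
  have h1 : ∫⁻ ω, T 0 ω * T 1 ω ∂P = (∫⁻ p, f 0 p ∂μ 0) * ∫⁻ p, f 1 p ∂μ 1 := by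
    have := lintegral_mul_eq_lintegral_mul_lintegral_of_indepFun (hT 0) (hT 1) hI
    simp only [Pi.mul_apply] at this
    rw [this, ← (hΨ 0).lintegral_lintegral (hf 0), ← (hΨ 1).lintegral_lintegral (hf 1)]
  have e (ω : Ω) : (∑ k, ∫⁻ p, f k p ∂countMeasure (Ψ k ω)) ^ 2 =
      T 0 ω * T 0 ω + 2 * (T 0 ω * T 1 ω) + T 1 ω * T 1 ω := by
    simp only [Fin.sum_univ_two, T]; ring
  simp_rw [e]
  have m11 : Measurable fun ω => T 1 ω * T 1 ω := (hT 1).mul (hT 1)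
  have m01 : Measurable fun ω => T 0 ω * T 1 ω := (hT 0).mul (hT 1)
  rw [lintegral_add_right _ m11, lintegral_add_right _ (m01.const_mul 2), lintegral_const_mul _ m01,
    h1, h2, h2, Fin.sum_univ_two, Fin.sum_univ_two]
  ring

end Sums

/-! ### Distances to the nearest points -/

lemma nearestDist_nonneg (S : Set Plane) (q : ℕ) : 0 ≤ nearestDist S q :=
  Real.sInf_nonneg fun _ h => h.1

lemma nearestDist_le {S : Set Plane} {q : ℕ} {r : ℝ} (hr : 0 ≤ r)
    (h : (q : ℕ∞) ≤ (S ∩ Metric.closedBall 0 r).encard) : nearestDist S q ≤ r :=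
  csInf_le ⟨0, fun _ h => h.1⟩ ⟨hr, h⟩

lemma nearestDist_mono {S : Set Plane} {q q' : ℕ} (hq : q ≤ q')
    (h : ∃ n : ℕ, (q' : ℕ∞) ≤ (S ∩ Metric.closedBall 0 n).encard) :
    nearestDist S q ≤ nearestDist S q' := by
  obtain ⟨n, hn⟩ := h
  refine csInf_le_csInf ⟨0, fun _ h => h.1⟩ ⟨n, n.cast_nonneg, hn⟩ fun r hr => ⟨hr.1, ?_⟩
  exact le_trans (by exact_mod_cast hq) hr.2

/-- Local finiteness leaves a gap: some slightly larger ball contains no new point, which makes the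
inequality strict. The hypothesis `hex` excludes the default value `sInf ∅ = 0`. -/
lemma lt_nearestDist_iff {S : Set Plane} {q : ℕ}
    (hfin : ∀ n : ℕ, (S ∩ Metric.closedBall 0 n).Finite)
    (hex : ∃ n : ℕ, (q : ℕ∞) ≤ (S ∩ Metric.closedBall 0 n).encard) {r : ℝ} (hr : 0 ≤ r) :
    r < nearestDist S q ↔ (S ∩ Metric.closedBall 0 r).encard < q := by
  refine ⟨fun h => not_le.1 fun h' => h.not_ge (nearestDist_le hr h'), fun h => ?_⟩
  obtain ⟨n, hn⟩ := hex
  have hfin' : (S ∩ Metric.closedBall 0 (r + 1)).Finite := by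
    obtain ⟨m, hm⟩ := exists_nat_ge (r + 1)
    exact (hfin m).subset (inter_subset_inter_right _ (Metric.closedBall_subset_closedBall hm))
  obtain ⟨r', hr', hS⟩ : ∃ r' > r, S ∩ Metric.closedBall 0 r' ⊆ S ∩ Metric.closedBall 0 r := by
    -- The norms of the finitely many points just outside the ball of radius `r`; any `r'` between
    -- `r` and all of them will do.
    let T : Set ℝ := norm '' ((S ∩ Metric.closedBall 0 (r + 1)) \ Metric.closedBall 0 r)
    have hT : T.Finite := (hfin'.subset sdiff_subset).image _
    have hT' : ∀ᶠ r' in 𝓝[>] r, ∀ x ∈ T, r' < x := by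
      refine (hT.eventually_all).2 fun x hx => ?_
      obtain ⟨y, ⟨_, hy⟩, rfl⟩ := hx
      rw [mem_closedBall_zero_iff, not_le] at hy
      exact nhdsWithin_le_nhds (Iio_mem_nhds hy)
    have h1 : ∀ᶠ r' in 𝓝[>] r, r' < r + 1 := nhdsWithin_le_nhds (Iio_mem_nhds (by linarith))
    obtain ⟨r', ⟨h2, h3⟩, h4⟩ := ((hT'.and h1).and self_mem_nhdsWithin).exists
    refine ⟨r', h4, fun y hy => ⟨hy.1, ?_⟩⟩
    by_contra hy'
    have hy2 := mem_closedBall_zero_iff.1 hy.2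
    exact (h2 ‖y‖ ⟨y, ⟨⟨hy.1, mem_closedBall_zero_iff.2 (by linarith)⟩, hy'⟩, rfl⟩).not_ge hy2
  refine hr'.trans_le (le_csInf ⟨n, n.cast_nonneg, hn⟩ fun s hs => ?_)
  by_contra! hlt
  refine (hs.2.trans (encard_le_encard (Subset.trans ?_ hS))).not_gt h
  exact inter_subset_inter_right _ (Metric.closedBall_subset_closedBall hlt.le)

section Measurability

variable {Ω : Type*} (Φ : Ω → Set Plane)

/-- Only countably many radii occur on the right, which yields measurability. The second alternative
covers sets with fewer than `q` points in every ball, where `nearestDist` is `sInf ∅ = 0`. -/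
lemma nearestDist_lt_iff (S : Set Plane) (q : ℕ) (r : ℝ) : nearestDist S q < r ↔
    (∃ s : ℚ, (s : ℝ) < r ∧ 0 ≤ (s : ℝ) ∧ (q : ℕ∞) ≤ (S ∩ Metric.closedBall 0 s).encard) ∨
      (0 < r ∧ ∀ n : ℕ, (S ∩ Metric.closedBall 0 n).encard < q) := by
  constructor
  · intro h
    by_cases hex : ∃ n : ℕ, (q : ℕ∞) ≤ (S ∩ Metric.closedBall 0 n).encard
    · obtain ⟨n, hn⟩ := hex
      obtain ⟨x, hx, hxr⟩ := exists_lt_of_csInf_lt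
        (show {r : ℝ | 0 ≤ r ∧ (q : ℕ∞) ≤ (S ∩ Metric.closedBall 0 r).encard}.Nonempty from
          ⟨(n : ℝ), n.cast_nonneg, hn⟩) h
      obtain ⟨s, hs1, hs2⟩ := exists_rat_btwn hxr
      refine Or.inl ⟨s, hs2, hx.1.trans hs1.le, hx.2.trans (encard_le_encard ?_)⟩
      exact inter_subset_inter_right _ (Metric.closedBall_subset_closedBall hs1.le)
    · push Not at hex
      exact Or.inr ⟨(nearestDist_nonneg S q).trans_lt h, hex⟩
  · rintro (⟨s, hs, hs0, h⟩ | ⟨hr, h⟩)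
    · exact (nearestDist_le hs0 h).trans_lt hs
    · have : {r : ℝ | 0 ≤ r ∧ (q : ℕ∞) ≤ (S ∩ Metric.closedBall 0 r).encard} = ∅ := by
        refine eq_empty_of_forall_notMem fun x hx => ?_
        obtain ⟨n, hn⟩ := exists_nat_ge x
        refine (hx.2.trans (encard_le_encard ?_)).not_gt (h n)
        exact inter_subset_inter_right _ (Metric.closedBall_subset_closedBall hn)
      rw [nearestDist, this, Real.sInf_empty]
      exact hr

lemma measurable_nearestDist (q : ℕ) :
    Measurable[countAlgebra Φ] fun ω => nearestDist (Φ ω) q := by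
  let := countAlgebra Φ
  refine measurable_of_Iio fun r => ?_
  have h (s : ℝ) (B : Set ℕ∞) :
      MeasurableSet[countAlgebra Φ] {ω | (Φ ω ∩ Metric.closedBall 0 s).encard ∈ B} :=
    measurable_encard_inter Φ measurableSet_closedBall (B.to_countable.measurableSet)
  have e : (fun ω => nearestDist (Φ ω) q) ⁻¹' Iio r =
      (⋃ s : ℚ, {_ω | (s : ℝ) < r ∧ 0 ≤ (s : ℝ)} ∩
        {ω | (Φ ω ∩ Metric.closedBall 0 (s : ℝ)).encard ∈ Ici (q : ℕ∞)}) ∪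
      ({_ω | 0 < r} ∩ ⋂ n : ℕ, {ω | (Φ ω ∩ Metric.closedBall 0 (n : ℝ)).encard ∈ Iio (q : ℕ∞)}) := by
    ext ω
    simp [nearestDist_lt_iff, and_assoc]
  rw [e]
  refine MeasurableSet.union (MeasurableSet.iUnion fun s => ?_) ?_
  · exact (MeasurableSet.const _).inter (h s _)
  · exact (MeasurableSet.const _).inter (MeasurableSet.iInter fun n => h n _)

end Measurability

/-! ### Counts of a homogeneous Poisson process in discs -/

lemma density_closedBall (lam : ℝ) {r : ℝ} (hr : 0 ≤ r) :
    (ENNReal.ofReal lam • (volume : Measure Plane)) (Metric.closedBall 0 r) =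
      ENNReal.ofReal (Real.pi * lam * r ^ 2) := by
  rw [Measure.smul_apply, EuclideanSpace.volume_closedBall_fin_two, smul_eq_mul,
    ← ENNReal.ofReal_pow hr, ← ENNReal.ofReal_mul (by positivity),
    ← ENNReal.ofReal_mul' (by positivity)]
  congr 1
  ring

lemma density_annulus {lam : ℝ} (hlam : 0 < lam) {v w : ℝ} (hv : 0 ≤ v) (hvw : v ≤ w) :
    (ENNReal.ofReal lam • (volume : Measure Plane))
      (Metric.closedBall 0 w \ Metric.closedBall 0 v) =
      ENNReal.ofReal (Real.pi * lam * w ^ 2 - Real.pi * lam * v ^ 2) := by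
  rw [measure_sdiff (Metric.closedBall_subset_closedBall hvw)
    measurableSet_closedBall.nullMeasurableSet, density_closedBall lam hv,
    density_closedBall lam (hv.trans hvw), ENNReal.ofReal_sub _ (by positivity)]
  rw [density_closedBall lam hv]
  exact ENNReal.ofReal_ne_top

namespace IsPoissonProcess

section General

variable {Ω E : Type*} [MeasurableSpace Ω] [MeasurableSpace E] {P : Measure Ω} {μ : Measure E}
  {Ψ : Ω → Set E}

lemma prob_count_lt_one (h : IsPoissonProcess P μ Ψ) {A : Set E} (hA : MeasurableSet A)
    {a : ℝ} (ha : 0 ≤ a) (hμ : μ A = ENNReal.ofReal a) :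
    P {ω | (Ψ ω ∩ A).encard < 1} = ENNReal.ofReal (Real.exp (-a)) := by
  have e : {ω | (Ψ ω ∩ A).encard < 1} = {ω | (Ψ ω ∩ A).encard = (0 : ℕ)} := by
    ext ω; simp
  rw [e, h.law_count A hA (by rw [hμ]; exact ENNReal.ofReal_ne_top), poissonMeasure_singleton, hμ]
  simp [ENNReal.ofReal, Real.coe_toNNReal a ha]

lemma prob_count_lt_two (h : IsPoissonProcess P μ Ψ) {A : Set E} (hA : MeasurableSet A)
    {a : ℝ} (ha : 0 ≤ a) (hμ : μ A = ENNReal.ofReal a) :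
    P {ω | (Ψ ω ∩ A).encard < 2} = ENNReal.ofReal (Real.exp (-a) * (1 + a)) := by
  have e : {ω | (Ψ ω ∩ A).encard < 2} =
      {ω | (Ψ ω ∩ A).encard < 1} ∪ {ω | (Ψ ω ∩ A).encard = (1 : ℕ)} := by
    ext ω
    simp only [mem_ofPred_eq, mem_union]
    rw [← one_add_one_eq_two, ENat.lt_add_one_iff (by simp), le_iff_lt_or_eq]
    simp
  rw [e, measure_union, h.prob_count_lt_one hA ha hμ,
    h.law_count A hA (by rw [hμ]; exact ENNReal.ofReal_ne_top), poissonMeasure_singleton, hμ,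
    ← ENNReal.ofReal_add (by positivity) (by positivity)]
  · simp [ENNReal.ofReal, Real.coe_toNNReal a ha]
    ring_nf
  · refine disjoint_left.2 fun ω h1 h2 => ?_
    simp only [mem_ofPred_eq] at h1 h2
    simp [h2] at h1
  · exact h.measurable_count A hA (measurableSet_singleton _)

end General

variable {Ω : Type*} [MeasurableSpace Ω] {P : Measure Ω} {lam : ℝ}
  {Φ : Ω → Set Plane}

/-- The chance of fewer than two points in the disc of radius `n` is `e^(-x) (1 + x)` with `x =
πλn²`, which tends to zero. -/
lemma ae_exists_two_le (h : IsPoissonProcess P (ENNReal.ofReal lam • volume) Φ) (hlam : 0 < lam) :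
    ∀ᵐ ω ∂P, ∃ n : ℕ, (2 : ℕ∞) ≤ (Φ ω ∩ Metric.closedBall 0 (n : ℝ)).encard := by
  have hle (n : ℕ) : P {ω | ¬ ∃ n : ℕ, (2 : ℕ∞) ≤ (Φ ω ∩ Metric.closedBall 0 (n : ℝ)).encard} ≤
      ENNReal.ofReal (Real.exp (-(Real.pi * lam * (n : ℝ) ^ 2)) *
        (1 + Real.pi * lam * (n : ℝ) ^ 2)) := by
    rw [← h.prob_count_lt_two (measurableSet_closedBall (x := (0 : Plane)) (ε := n)) (by positivity)
      (density_closedBall lam n.cast_nonneg)]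
    refine measure_mono fun ω hω => ?_
    simp only [mem_ofPred_eq, not_exists, not_le] at hω ⊢
    exact hω n
  have hlim : Tendsto (fun x : ℝ => ENNReal.ofReal (Real.exp (-x) * (1 + x))) atTop (𝓝 0) := by
    rw [← ENNReal.ofReal_zero]
    refine ENNReal.tendsto_ofReal ?_
    have h0 := Real.tendsto_pow_mul_exp_neg_atTop_nhds_zero 0
    have h1 := Real.tendsto_pow_mul_exp_neg_atTop_nhds_zero 1
    have := h0.add h1
    rw [add_zero] at this
    exact this.congr fun x => by ring
  have hx : Tendsto (fun n : ℕ => Real.pi * lam * (n : ℝ) ^ 2) atTop atTop :=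
    Tendsto.const_mul_atTop (by positivity)
      ((tendsto_pow_atTop two_ne_zero).comp tendsto_natCast_atTop_atTop)
  exact le_antisymm (ge_of_tendsto' (hlim.comp hx) hle) zero_le

variable [IsProbabilityMeasure P]

lemma ae_finite_closedBall (h : IsPoissonProcess P (ENNReal.ofReal lam • volume) Φ) :
    ∀ᵐ ω ∂P, ∀ n : ℕ, (Φ ω ∩ Metric.closedBall 0 (n : ℝ)).Finite := by
  refine ae_all_iff.2 fun n => ?_
  have hm : MeasurableSet (Metric.closedBall (0 : Plane) (n : ℝ)) := measurableSet_closedBall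
  have hfin : (ENNReal.ofReal lam • (volume : Measure Plane)) (Metric.closedBall 0 (n : ℝ)) ≠ ∞ := by
    rw [density_closedBall lam n.cast_nonneg]; exact ENNReal.ofReal_ne_top
  have := ae_lt_top (h.measurable_countMeasure_apply hm)
    (by rw [h.lintegral_countMeasure_apply hm hfin]; exact hfin)
  filter_upwards [this] with ω hω
  rw [countMeasure_apply _ hm] at hω
  rw [← encard_ne_top_iff]
  intro htop
  simp [htop] at hω

/-- The joint tail of the distances to the two nearest points. -/
lemma prob_nearestDist (h : IsPoissonProcess P (ENNReal.ofReal lam • volume) Φ) (hlam : 0 < lam)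
    {v w : ℝ} (hv : 0 ≤ v) (hvw : v ≤ w) :
    P {ω | v < nearestDist (Φ ω) 1 ∧ w < nearestDist (Φ ω) 2} = ENNReal.ofReal
      (Real.exp (-(Real.pi * lam * w ^ 2)) * (1 + Real.pi * lam * (w ^ 2 - v ^ 2))) := by
  have mV : MeasurableSet (Metric.closedBall (0 : Plane) v) := measurableSet_closedBall
  have mA : MeasurableSet (Metric.closedBall (0 : Plane) w \ Metric.closedBall 0 v) :=
    measurableSet_closedBall.diff mV
  -- When the inner disc is empty, disc and annulus hold the same points. Passing to the annulus
  -- makes the two sets disjoint, hence the two counts independent.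
  have hae : {ω | v < nearestDist (Φ ω) 1 ∧ w < nearestDist (Φ ω) 2} =ᵐ[P]
      ({ω | (Φ ω ∩ Metric.closedBall 0 v).encard < 1} ∩
        {ω | (Φ ω ∩ (Metric.closedBall 0 w \ Metric.closedBall 0 v)).encard < 2} : Set Ω) := by
    filter_upwards [h.ae_finite_closedBall, h.ae_exists_two_le hlam] with ω hfin hex
    refine propext ?_
    have hex1 : ∃ n : ℕ, ((1 : ℕ) : ℕ∞) ≤ (Φ ω ∩ Metric.closedBall 0 (n : ℝ)).encard :=
      hex.imp fun n hn => le_trans (by norm_num) hn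
    have h1 := lt_nearestDist_iff hfin hex1 hv
    have h2 := lt_nearestDist_iff (q := 2) hfin hex (hv.trans hvw)
    change (v < nearestDist (Φ ω) 1 ∧ w < nearestDist (Φ ω) 2) ↔
      (Φ ω ∩ Metric.closedBall 0 v).encard < 1 ∧
        (Φ ω ∩ (Metric.closedBall 0 w \ Metric.closedBall 0 v)).encard < 2
    rw [h1, h2]
    refine and_congr_right fun h0 => ?_
    have h0' : Φ ω ∩ Metric.closedBall 0 v = ∅ := by
      simpa using h0
    have : Φ ω ∩ (Metric.closedBall 0 w \ Metric.closedBall 0 v) = Φ ω ∩ Metric.closedBall 0 w := by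
      ext x
      have := Set.ext_iff.1 h0' x
      simp only [mem_inter_iff, Set.mem_sdiff, mem_empty_iff_false, iff_false] at this ⊢
      tauto
    rw [this]
    rfl
  have hi := (h.indep_count 2 ![Metric.closedBall (0 : Plane) v,
    Metric.closedBall (0 : Plane) w \ Metric.closedBall 0 v]
    (by simp [Fin.forall_fin_two, mV, mA]) (by
      intro i j hij
      fin_cases i <;> fin_cases j <;> simp_all [disjoint_sdiff_right, disjoint_sdiff_left])).indepFun
      (show (0 : Fin 2) ≠ 1 by simp)
  rw [measure_congr hae]
  have := hi.measure_inter_preimage_eq_mul (Iio 1) (Iio 2)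
    (to_countable _).measurableSet (to_countable _).measurableSet
  refine Eq.trans this ?_
  have e1 := h.prob_count_lt_one mV (by positivity) (density_closedBall lam hv)
  have hnn : 0 ≤ Real.pi * lam * w ^ 2 - Real.pi * lam * v ^ 2 := by
    have : v ^ 2 ≤ w ^ 2 := by gcongr
    have := mul_le_mul_of_nonneg_left this (by positivity : 0 ≤ Real.pi * lam)
    linarith
  have e2 := h.prob_count_lt_two mA hnn (density_annulus hlam hv hvw)
  refine (congrArg₂ (· * ·) e1 e2).trans ?_
  rw [← ENNReal.ofReal_mul (by positivity), ← mul_assoc, ← Real.exp_add]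
  ring_nf

end IsPoissonProcess

/-! ### The law of the distances to the two nearest points -/

lemma measure_prod_ext_of_Ioi {μ ν : Measure (ℝ × ℝ)} [IsFiniteMeasure μ] (huniv : μ univ = ν univ)
    (h : ∀ v w, μ (Ioi v ×ˢ Ioi w) = ν (Ioi v ×ˢ Ioi w)) : μ = ν := by
  have hspan : IsCountablySpanning (range (Ioi : ℝ → Set ℝ)) := by
    refine ⟨fun n : ℕ => Ioi (-(n : ℝ)), fun n => mem_range_self _, ?_⟩
    refine eq_univ_of_forall fun x => mem_iUnion.2 ?_
    obtain ⟨n, hn⟩ := exists_nat_gt (-x)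
    exact ⟨n, by simpa using neg_lt.1 hn⟩
  have hb : MeasurableSpace.generateFrom (range (Ioi : ℝ → Set ℝ)) = Real.measurableSpace := by
    rw [← borel_eq_generateFrom_Ioi]
    exact (BorelSpace.measurable_eq (α := ℝ)).symm
  refine ext_of_generate_finite _ (generateFrom_eq_prod hb hb hspan hspan).symm
    (isPiSystem_Ioi.prod isPiSystem_Ioi) ?_ huniv
  rintro _ ⟨_, ⟨v, rfl⟩, _, ⟨w, rfl⟩, rfl⟩
  exact h v w

lemma lintegral_Ioi_gaussian {a : ℝ} (ha : 0 < a) {m : ℝ} (hm : 0 ≤ m) :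
    ∫⁻ x in Ioi m, ENNReal.ofReal (2 * a * x * Real.exp (-(a * x ^ 2))) =
      ENNReal.ofReal (Real.exp (-(a * m ^ 2))) := by
  have hd (x : ℝ) : HasDerivAt (fun x => -Real.exp (-(a * x ^ 2)))
      (2 * a * x * Real.exp (-(a * x ^ 2))) x := by
    have := (((hasDerivAt_pow 2 x).const_mul a).neg.exp).neg
    refine this.congr_deriv ?_
    simp only [Pi.neg_apply, Nat.cast_ofNat, Nat.add_one_sub_one, pow_one]
    ring
  have hlim : Tendsto (fun x : ℝ => -Real.exp (-(a * x ^ 2))) atTop (𝓝 0) := by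
    rw [← neg_zero]
    refine (Real.tendsto_exp_neg_atTop_nhds_zero.comp ?_).neg
    exact (tendsto_pow_atTop two_ne_zero).const_mul_atTop ha
  have hpos : ∀ x ∈ Ioi m, 0 ≤ 2 * a * x * Real.exp (-(a * x ^ 2)) := fun x hx => by
    have : 0 < x := hm.trans_lt hx
    positivity
  have hint := integrableOn_Ioi_deriv_of_nonneg (hd m).continuousAt.continuousWithinAt
    (fun x _ => hd x) hpos hlim
  rw [← ofReal_integral_eq_lintegral_ofReal hint
    ((ae_restrict_mem measurableSet_Ioi).mono hpos),
    integral_Ioi_of_hasDerivAt_of_tendsto' (fun x _ => hd x) hint hlim]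
  simp

lemma lintegral_Ioc_linear {a : ℝ} (ha : 0 < a) {v w : ℝ} (hv : 0 ≤ v) (hvw : v ≤ w) :
    ∫⁻ x in Ioc v w, ENNReal.ofReal (2 * a * x) = ENNReal.ofReal (a * (w ^ 2 - v ^ 2)) := by
  have hc : Continuous fun x : ℝ => 2 * a * x := by fun_prop
  have hint : IntegrableOn (fun x : ℝ => 2 * a * x) (Ioc v w) :=
    (hc.integrableOn_Icc).mono_set Ioc_subset_Icc_self
  rw [← ofReal_integral_eq_lintegral_ofReal hint ((ae_restrict_mem measurableSet_Ioc).mono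
    fun x hx => by have : 0 < x := hv.trans_lt hx.1; simp only [Pi.zero_apply]; positivity),
    ← intervalIntegral.integral_of_le hvw]
  congr 1
  rw [intervalIntegral.integral_const_mul, integral_id]
  ring

namespace Params

variable (c : Params)

/-- The extended nonnegative version of `nearestPdf`. -/
def nearestDensity (j : Fin 2) (w : ℝ) : ℝ≥0∞ :=
  (Ioi 0).indicator (fun w => ENNReal.ofReal (c.nearestPdf j w)) w

/-- The extended nonnegative version of `nearestTwoPdf`. -/
def nearestTwoDensity (j : Fin 2) (q : ℝ × ℝ) : ℝ≥0∞ :=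
  (Ioi 0).indicator 1 q.1 * (Ioi q.1).indicator 1 q.2 *
    ENNReal.ofReal (c.nearestTwoPdf j q.1 q.2)

lemma measurable_nearestPdf (j : Fin 2) : Measurable (c.nearestPdf j) := by
  unfold nearestPdf; fun_prop

lemma measurable_nearestDensity (j : Fin 2) : Measurable (c.nearestDensity j) :=
  (c.measurable_nearestPdf j).ennreal_ofReal.indicator measurableSet_Ioi

lemma measurable_nearestTwoPdf (j : Fin 2) :
    Measurable fun q : ℝ × ℝ => c.nearestTwoPdf j q.1 q.2 := by
  unfold nearestTwoPdf; fun_prop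

lemma measurable_nearestTwoDensity (j : Fin 2) : Measurable (c.nearestTwoDensity j) := by
  refine Measurable.mul (Measurable.mul ?_ ?_) (c.measurable_nearestTwoPdf j).ennreal_ofReal
  · exact (measurable_one.indicator measurableSet_Ioi).comp measurable_fst
  · have : MeasurableSet {q : ℝ × ℝ | q.1 < q.2} := measurableSet_lt measurable_fst measurable_snd
    exact measurable_one.indicator this

lemma lintegral_Ioi_nearestPdf (j : Fin 2) {m : ℝ} (hm : 0 ≤ m) :
    ∫⁻ w in Ioi m, ENNReal.ofReal (c.nearestPdf j w) = ENNReal.ofReal (c.nearestCcdf j m) := by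
  have := lintegral_Ioi_gaussian (mul_pos Real.pi_pos (c.lam_pos j)) hm
  simp only [nearestPdf, nearestCcdf]
  simpa [mul_assoc] using this

/-- The origin of `zeta`: the second nearest distance is integrated out, given that it exceeds `w`.
-/
lemma lintegral_Ioi_nearestTwoPdf (j : Fin 2) {v w : ℝ} (hv : 0 ≤ v) :
    ∫⁻ y in Ioi (max v w), ENNReal.ofReal (c.nearestTwoPdf j v y) =
      ENNReal.ofReal (c.zeta j v w) := by
  have hl := c.lam_pos j
  have := lintegral_Ioi_gaussian (mul_pos Real.pi_pos hl) (hv.trans (le_max_left v w))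
  have e (y : ℝ) : ENNReal.ofReal (c.nearestTwoPdf j v y) =
      ENNReal.ofReal (2 * (Real.pi * c.lam j) * v) * ENNReal.ofReal
        (2 * (Real.pi * c.lam j) * y * Real.exp (-(Real.pi * c.lam j * y ^ 2))) := by
    rw [← ENNReal.ofReal_mul (by positivity), nearestTwoPdf]
    congr 1
    rw [show -Real.pi * c.lam j * y ^ 2 = -(Real.pi * c.lam j * y ^ 2) by ring]
    ring
  simp_rw [e]
  rw [lintegral_const_mul _ (by fun_prop), this, ← ENNReal.ofReal_mul (by positivity), zeta]
  rw [show -Real.pi * c.lam j * max v w ^ 2 = -(Real.pi * c.lam j * max v w ^ 2) by ring]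
  congr 1
  ring

lemma nearestTwoDensity_of_pos (j : Fin 2) {v : ℝ} (hv : 0 < v) (w : ℝ) :
    c.nearestTwoDensity j (v, w) =
      (Ioi v).indicator (fun w => ENNReal.ofReal (c.nearestTwoPdf j v w)) w := by
  by_cases h : v < w <;> simp [nearestTwoDensity, hv, h]

lemma nearestTwoDensity_of_nonpos (j : Fin 2) {v : ℝ} (hv : v ≤ 0) (w : ℝ) :
    c.nearestTwoDensity j (v, w) = 0 := by
  simp [nearestTwoDensity, hv.not_gt]

lemma lintegral_nearestTwoDensity (j : Fin 2) {v w : ℝ} (hv : 0 ≤ v) (hvw : v ≤ w) :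
    ∫⁻ x in Ioi v, ∫⁻ y in Ioi w, c.nearestTwoDensity j (x, y) = ENNReal.ofReal
      (Real.exp (-(Real.pi * c.lam j * w ^ 2)) *
        (1 + Real.pi * c.lam j * (w ^ 2 - v ^ 2))) := by
  have hl := c.lam_pos j
  have ha := mul_pos Real.pi_pos hl
  have e : ∀ x ∈ Ioi v, ∫⁻ y in Ioi w, c.nearestTwoDensity j (x, y) =
      ENNReal.ofReal (c.zeta j x w) := fun x hx => by
    have hx0 : 0 < x := hv.trans_lt hx
    simp_rw [c.nearestTwoDensity_of_pos j hx0]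
    rw [setLIntegral_indicator measurableSet_Ioi, Ioi_inter_Ioi]
    exact c.lintegral_Ioi_nearestTwoPdf j hx0.le
  -- The maximum in `zeta` changes at `w`: below it the integrand is linear in `x`, above it a
  -- Gaussian derivative.
  rw [setLIntegral_congr_fun measurableSet_Ioi e, ← Ioc_union_Ioi_eq_Ioi hvw,
    lintegral_union measurableSet_Ioi (Ioc_disjoint_Ioi le_rfl)]
  have e1 : ∀ x ∈ Ioc v w, ENNReal.ofReal (c.zeta j x w) =
      ENNReal.ofReal (2 * (Real.pi * c.lam j) * x) *
        ENNReal.ofReal (Real.exp (-(Real.pi * c.lam j * w ^ 2))) := fun x hx => by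
    rw [← ENNReal.ofReal_mul' (by positivity), zeta, max_eq_right hx.2]
    ring_nf
  have e2 : ∀ x ∈ Ioi w, ENNReal.ofReal (c.zeta j x w) =
      ENNReal.ofReal (2 * (Real.pi * c.lam j) * x * Real.exp (-(Real.pi * c.lam j * x ^ 2))) :=
    fun x hx => by
      rw [zeta, max_eq_left (le_of_lt hx)]
      ring_nf
  have hsq : 0 ≤ w ^ 2 - v ^ 2 := by nlinarith
  rw [setLIntegral_congr_fun measurableSet_Ioc e1, setLIntegral_congr_fun measurableSet_Ioi e2,
    lintegral_mul_const _ (by fun_prop), lintegral_Ioc_linear ha hv hvw,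
    lintegral_Ioi_gaussian ha (hv.trans hvw), ← ENNReal.ofReal_mul' (by positivity),
    ← ENNReal.ofReal_add (by positivity) (by positivity)]
  ring_nf

lemma withDensity_nearestTwoDensity_Ioi (j : Fin 2) {v w : ℝ} (hv : 0 ≤ v) (hvw : v ≤ w) :
    (volume : Measure (ℝ × ℝ)).withDensity (c.nearestTwoDensity j) (Ioi v ×ˢ Ioi w) =
      ENNReal.ofReal (Real.exp (-(Real.pi * c.lam j * w ^ 2)) *
        (1 + Real.pi * c.lam j * (w ^ 2 - v ^ 2))) := by
  rw [withDensity_apply _ (measurableSet_Ioi.prod measurableSet_Ioi), Measure.volume_eq_prod,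
    ← Measure.prod_restrict, lintegral_prod _ (c.measurable_nearestTwoDensity j).aemeasurable]
  exact c.lintegral_nearestTwoDensity j hv hvw

lemma ae_withDensity_nearestTwoDensity (j : Fin 2) :
    ∀ᵐ q ∂(volume : Measure (ℝ × ℝ)).withDensity (c.nearestTwoDensity j), 0 < q.1 ∧ q.1 < q.2 := by
  rw [ae_withDensity_iff (c.measurable_nearestTwoDensity j)]
  refine ae_of_all _ fun q hq => ?_
  by_contra h
  refine hq ?_
  rw [not_and_or] at h
  rcases h with h | h <;> simp [nearestTwoDensity, h]

end Params

/-- The tails are known only for `0 ≤ v ≤ w`. This suffices, because both measures live on `0 < x ≤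
y`, where every quadrant coincides with one whose corner satisfies these constraints. -/
lemma map_nearestDist {Ω : Type*} [MeasurableSpace Ω] {P : Measure Ω} [IsProbabilityMeasure P]
    (c : Params) (j : Fin 2) {Φ : Ω → Set Plane}
    (h : IsPoissonProcess P (ENNReal.ofReal (c.lam j) • volume) Φ) :
    P.map (fun ω => (nearestDist (Φ ω) 1, nearestDist (Φ ω) 2)) =
      (volume : Measure (ℝ × ℝ)).withDensity (c.nearestTwoDensity j) := by
  have hl := c.lam_pos j
  have hm : Measurable fun ω => (nearestDist (Φ ω) 1, nearestDist (Φ ω) 2) :=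
    ((measurable_nearestDist Φ 1).mono h.countAlgebra_le le_rfl).prodMk
      ((measurable_nearestDist Φ 2).mono h.countAlgebra_le le_rfl)
  set μ := P.map (fun ω => (nearestDist (Φ ω) 1, nearestDist (Φ ω) 2)) with hμ
  set ν := (volume : Measure (ℝ × ℝ)).withDensity (c.nearestTwoDensity j) with hν
  have : IsProbabilityMeasure μ := Measure.isProbabilityMeasure_map hm.aemeasurable
  have key {v w : ℝ} (hv : 0 ≤ v) (hvw : v ≤ w) : μ (Ioi v ×ˢ Ioi w) = ν (Ioi v ×ˢ Ioi w) := by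
    rw [hμ, Measure.map_apply hm (measurableSet_Ioi.prod measurableSet_Ioi),
      c.withDensity_nearestTwoDensity_Ioi j hv hvw, ← h.prob_nearestDist hl hv hvw]
    rfl
  -- The corner `v = w = 0` shows that the distances are almost surely positive and also that the
  -- density has total mass one.
  have h1 : μ (Ioi 0 ×ˢ Ioi 0) = 1 := by
    rw [key le_rfl le_rfl, hν, c.withDensity_nearestTwoDensity_Ioi j le_rfl le_rfl]
    simp
  have hμD : ∀ᵐ q ∂μ, 0 < q.1 ∧ q.1 ≤ q.2 := by
    have a1 : ∀ᵐ q ∂μ, q ∈ Ioi (0 : ℝ) ×ˢ Ioi (0 : ℝ) := by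
      rw [ae_mem_iff_measure_eq (measurableSet_Ioi.prod measurableSet_Ioi).nullMeasurableSet, h1,
        measure_univ]
    have a2 : ∀ᵐ q ∂μ, q.1 ≤ q.2 := by
      rw [hμ, ae_map_iff hm.aemeasurable (measurableSet_le measurable_fst measurable_snd)]
      filter_upwards [h.ae_exists_two_le hl] with ω hω
      exact nearestDist_mono one_le_two hω
    filter_upwards [a1, a2] with q h1 h2 using ⟨h1.1, h2⟩
  have hνD : ∀ᵐ q ∂ν, 0 < q.1 ∧ q.1 ≤ q.2 :=
    (c.ae_withDensity_nearestTwoDensity j).mono fun q hq => ⟨hq.1, hq.2.le⟩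
  have hsets (v w : ℝ) (q : ℝ × ℝ) (hq : 0 < q.1 ∧ q.1 ≤ q.2) : q ∈ Ioi v ×ˢ Ioi w ↔
      q ∈ Ioi (max v 0) ×ˢ Ioi (max w (max v 0)) := by
    simp only [mem_prod, mem_Ioi, max_lt_iff]
    constructor
    · rintro ⟨h1, h2⟩
      exact ⟨⟨h1, hq.1⟩, h2, h1.trans_le hq.2, hq.1.trans_le hq.2⟩
    · rintro ⟨⟨h1, _⟩, h2, _⟩
      exact ⟨h1, h2⟩
  refine measure_prod_ext_of_Ioi ?_ fun v w => ?_
  · rw [measure_univ, ← h1, key le_rfl le_rfl]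
    refine measure_congr (hνD.mono fun q hq => propext ⟨fun _ => trivial, fun _ => ?_⟩)
    exact ⟨hq.1, hq.1.trans_le hq.2⟩
  · rw [measure_congr (eventuallyEq_set.2 (hμD.mono fun q hq => hsets v w q hq)),
      measure_congr (eventuallyEq_set.2 (hνD.mono fun q hq => hsets v w q hq))]
    exact key (le_max_right _ _) (le_max_right _ _)

/-! ### The law of the serving distance and of the distance to the most interfered station -/

namespace Params

variable (c : Params)

/-- The unnormalised version of `jointPdf`. -/
def subPdf (j m : Fin 2) (v w : ℝ) : ℝ :=
  open Classical in
  if j = m then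
    if 0 < v ∧ v < w then
      c.nearestCcdf j.rev (max ((c.t j.rev / c.t j) ^ (1 / c.α) * v) w) * c.nearestTwoPdf j v w
    else 0
  else
    if 0 < v ∧ (c.t m / c.t j) ^ (1 / c.α) * v < w then c.nearestPdf m w * c.zeta j v w else 0

lemma measurable_subPdf (j m : Fin 2) : Measurable fun q : ℝ × ℝ => c.subPdf j m q.1 q.2 := by
  unfold subPdf
  split_ifs
  · refine Measurable.ite ?_ ?_ measurable_const
    · exact (measurableSet_lt measurable_const measurable_fst).inter
        (measurableSet_lt measurable_fst measurable_snd)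
    · unfold nearestCcdf nearestTwoPdf; fun_prop
  · refine Measurable.ite ?_ ?_ measurable_const
    · exact (measurableSet_lt measurable_const measurable_fst).inter
        (measurableSet_lt (by fun_prop) measurable_snd)
    · unfold nearestPdf zeta; fun_prop

lemma ratio_pos (j m : Fin 2) : 0 < (c.t m / c.t j) ^ (1 / c.α) :=
  Real.rpow_pos_of_pos (div_pos (c.t_pos m) (c.t_pos j)) _

lemma α_pos : 0 < c.α := two_pos.trans c.two_lt_α

/-- Comparison of weighted received powers in terms of distances. -/
lemma weighted_lt_iff (j m : Fin 2) {x w : ℝ} (hx : 0 < x) (hw : 0 < w) :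
    c.t m * (c.τ * w) ^ (-c.α) < c.t j * (c.τ * x) ^ (-c.α) ↔
      (c.t m / c.t j) ^ (1 / c.α) * x < w := by
  have hα := c.α_pos
  have hτ := c.τ_pos
  have hj := c.t_pos j
  have hm := c.t_pos m
  have hk := c.ratio_pos j m
  have e : ((c.t m / c.t j) ^ (1 / c.α) * x) ^ c.α = c.t m / c.t j * x ^ c.α := by
    rw [Real.mul_rpow hk.le hx.le, ← Real.rpow_mul (by positivity), one_div_mul_cancel hα.ne',
      Real.rpow_one]
  rw [← Real.rpow_lt_rpow_iff (by positivity) hw.le hα, e, Real.rpow_neg (by positivity),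
    Real.rpow_neg (by positivity), Real.mul_rpow hτ.le hw.le, Real.mul_rpow hτ.le hx.le]
  have h1 : 0 < c.τ ^ c.α := by positivity
  have h2 : 0 < w ^ c.α := by positivity
  have h3 : 0 < x ^ c.α := by positivity
  rw [← div_eq_mul_inv, ← div_eq_mul_inv, div_lt_div_iff₀ (by positivity) (by positivity),
    div_mul_eq_mul_div, div_lt_iff₀ hj]
  constructor
  · intro h
    refine lt_of_mul_lt_mul_left ?_ h1.le
    linarith
  · intro h
    have := mul_lt_mul_of_pos_left h h1
    linarith

end Params

lemma indep_countAlgebra_rev {Ω : Type*} [MeasurableSpace Ω] {P : Measure Ω}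
    {Φ : Fin 2 → Ω → Set Plane}
    (hi : Indep (countAlgebra (Φ 0)) (countAlgebra (Φ 1)) P) (j : Fin 2) :
    Indep (countAlgebra (Φ j)) (countAlgebra (Φ j.rev)) P := by
  fin_cases j
  · exact hi
  · exact hi.symm

lemma measurable_nearestDist_bs {Ω : Type*} [MeasurableSpace Ω] {P : Measure Ω} {c : Params}
    {Φ : Fin 2 → Ω → Set Plane}
    (hΦ : ∀ j, IsPoissonProcess P (ENNReal.ofReal (c.lam j) • volume) (Φ j)) (j : Fin 2) (q : ℕ) :
    Measurable fun ω => nearestDist (Φ j ω) q :=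
  (measurable_nearestDist (Φ j) q).mono (hΦ j).countAlgebra_le le_rfl

section Distances

variable {Ω : Type*} [mΩ : MeasurableSpace Ω] {P : Measure Ω} [IsProbabilityMeasure P] {c : Params}
  {Φ : Fin 2 → Ω → Set Plane}

lemma map_nearestDist_one (j : Fin 2) {Φ : Ω → Set Plane}
    (h : IsPoissonProcess P (ENNReal.ofReal (c.lam j) • volume) Φ) :
    P.map (fun ω => nearestDist (Φ ω) 1) = volume.withDensity (c.nearestDensity j) := by
  have hm1 := (measurable_nearestDist Φ 1).mono h.countAlgebra_le le_rfl
  have hm2 := (measurable_nearestDist Φ 2).mono h.countAlgebra_le le_rfl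
  have e : P.map (fun ω => nearestDist (Φ ω) 1) =
      (P.map (fun ω => (nearestDist (Φ ω) 1, nearestDist (Φ ω) 2))).map Prod.fst :=
    (Measure.map_map measurable_fst (hm1.prodMk hm2)).symm
  ext A hA
  rw [e, map_nearestDist c j h, Measure.map_apply measurable_fst hA,
    withDensity_apply _ (measurable_fst hA), withDensity_apply _ hA, ← prod_univ,
    Measure.volume_eq_prod, ← Measure.prod_restrict,
    lintegral_prod _ (c.measurable_nearestTwoDensity j).aemeasurable, Measure.restrict_univ]
  refine lintegral_congr fun x => ?_
  rcases le_or_gt x 0 with hx | hx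
  · simp [c.nearestTwoDensity_of_nonpos j hx, Params.nearestDensity, hx]
  · simp_rw [c.nearestTwoDensity_of_pos j hx]
    rw [lintegral_indicator measurableSet_Ioi]
    have := c.lintegral_Ioi_nearestTwoPdf j (w := x) hx.le
    rw [max_self] at this
    rw [this]
    simp [Params.nearestDensity, hx, Params.zeta, Params.nearestPdf]

variable (hΦ : ∀ j, IsPoissonProcess P (ENNReal.ofReal (c.lam j) • volume) (Φ j))
include hΦ

/-- These three distances determine association, `R` and `U`. The iterated form leaves open which of
the inner variables is integrated out later. -/
lemma lintegral_comp_dist (hi : Indep (countAlgebra (Φ 0)) (countAlgebra (Φ 1)) P) (j : Fin 2)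
    {G : (ℝ × ℝ) × ℝ → ℝ≥0∞} (hG : Measurable G) :
    ∫⁻ ω, G ((nearestDist (Φ j ω) 1, nearestDist (Φ j ω) 2), nearestDist (Φ j.rev ω) 1) ∂P =
      ∫⁻ x, ∫⁻ y, c.nearestTwoDensity j (x, y) *
        ∫⁻ w, c.nearestDensity j.rev w * G ((x, y), w) := by
  have hX : Measurable fun ω => (nearestDist (Φ j ω) 1, nearestDist (Φ j ω) 2) :=
    (measurable_nearestDist_bs hΦ j 1).prodMk (measurable_nearestDist_bs hΦ j 2)
  have hY := measurable_nearestDist_bs hΦ j.rev 1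
  have hXm : Measurable[countAlgebra (Φ j)]
      fun ω => (nearestDist (Φ j ω) 1, nearestDist (Φ j ω) 2) :=
    Measurable.prodMk (measurable_nearestDist (Φ j) 1) (measurable_nearestDist (Φ j) 2)
  have hI : IndepFun (fun ω => (nearestDist (Φ j ω) 1, nearestDist (Φ j ω) 2))
      (fun ω => nearestDist (Φ j.rev ω) 1) P :=
    indep_of_indep_of_le_left (indep_of_indep_of_le_right (indep_countAlgebra_rev hi j)
      (measurable_nearestDist (Φ j.rev) 1).comap_le) hXm.comap_le
  have hn := c.measurable_nearestDensity j.rev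
  have hH : Measurable fun q : ℝ × ℝ => ∫⁻ w, c.nearestDensity j.rev w * G (q, w) :=
    Measurable.lintegral_prod_right' (f := fun z : (ℝ × ℝ) × ℝ => c.nearestDensity j.rev z.2 * G z)
      ((hn.comp measurable_snd).mul hG)
  have hin (q : ℝ × ℝ) : ∫⁻ ω', G (q, nearestDist (Φ j.rev ω') 1) ∂P =
      ∫⁻ w, c.nearestDensity j.rev w * G (q, w) := by
    have hGq : Measurable fun w => G (q, w) := hG.comp measurable_prodMk_left
    rw [← lintegral_map hGq hY, map_nearestDist_one j.rev (hΦ j.rev),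
      lintegral_withDensity_eq_lintegral_mul _ hn hGq]
    rfl
  rw [lintegral_comp_of_indepFun hX hY hI hG]
  simp_rw [hin]
  rw [← lintegral_map (f := fun q : ℝ × ℝ => ∫⁻ w, c.nearestDensity j.rev w * G (q, w)) hH hX,
    map_nearestDist c j (hΦ j),
    lintegral_withDensity_eq_lintegral_mul _ (c.measurable_nearestTwoDensity j) hH,
    Measure.volume_eq_prod, lintegral_prod _
      ((c.measurable_nearestTwoDensity j).mul hH).aemeasurable]
  rfl

lemma ae_nearestDist_pos : ∀ᵐ ω ∂P, ∀ j, 0 < nearestDist (Φ j ω) 1 ∧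
    nearestDist (Φ j ω) 1 < nearestDist (Φ j ω) 2 := by
  refine ae_all_iff.2 fun j => ?_
  have hX : Measurable fun ω => (nearestDist (Φ j ω) 1, nearestDist (Φ j ω) 2) :=
    (measurable_nearestDist_bs hΦ j 1).prodMk (measurable_nearestDist_bs hΦ j 2)
  have h := c.ae_withDensity_nearestTwoDensity j
  rw [← map_nearestDist c j (hΦ j)] at h
  exact ae_of_ae_map hX.aemeasurable h

end Distances

section Association

variable {Ω : Type*} {c : Params} {Φ : Fin 2 → Ω → Set Plane}

lemma assoc_disjoint (j : Fin 2) : Disjoint (assoc c Φ j) (assoc c Φ j.rev) := by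
  refine disjoint_left.2 fun ω h1 h2 => ?_
  simp only [assoc, mem_ofPred_eq, Fin.rev_rev] at h1 h2
  exact lt_asymm h1 h2

lemma sum_indicator_assoc {M : Type*} [AddCommMonoid M] {j : Fin 2} {ω : Ω} (h : ω ∈ assoc c Φ j)
    (f : Fin 2 → Ω → M) : ∑ i, (assoc c Φ i).indicator (f i) ω = f j ω := by
  have hne : ∀ i ≠ j, (assoc c Φ i).indicator (f i) ω = 0 := fun i hi => by
    refine indicator_of_notMem (fun hi' => ?_) _
    have : i = j.rev := by fin_cases i <;> fin_cases j <;> simp_all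
    subst this
    exact disjoint_left.1 (assoc_disjoint j) h hi'
  rw [Finset.sum_eq_single j (fun i _ hi => hne i hi) (by simp), indicator_of_mem h]

lemma servDist_of_mem {j : Fin 2} {ω : Ω} (h : ω ∈ assoc c Φ j) :
    servDist c Φ ω = nearestDist (Φ j ω) 1 :=
  sum_indicator_assoc h fun j ω => nearestDist (Φ j ω) 1

lemma interfDist_of_mem {j : Fin 2} {ω : Ω} (h : ω ∈ assoc c Φ j) :
    interfDist c Φ ω = min (nearestDist (Φ j ω) 2) (nearestDist (Φ j.rev ω) 1) :=
  sum_indicator_assoc h fun j ω => min (nearestDist (Φ j ω) 2) (nearestDist (Φ j.rev ω) 1)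

lemma assocInterf_subset (j m : Fin 2) : assocInterf c Φ j m ⊆ assoc c Φ j := by
  unfold assocInterf
  split_ifs <;> exact inter_subset_left

lemma measurable_nearestDist_sup (j : Fin 2) (q : ℕ) :
    Measurable[countAlgebra (Φ 0) ⊔ countAlgebra (Φ 1)] fun ω => nearestDist (Φ j ω) q := by
  refine (measurable_nearestDist (Φ j) q).mono ?_ le_rfl
  fin_cases j
  · exact le_sup_left
  · exact le_sup_right

lemma measurableSet_assoc (j : Fin 2) :
    MeasurableSet[countAlgebra (Φ 0) ⊔ countAlgebra (Φ 1)] (assoc c Φ j) := by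
  let := countAlgebra (Φ 0) ⊔ countAlgebra (Φ 1)
  have h0 := measurable_nearestDist_sup (Φ := Φ) j 1
  have h1 := measurable_nearestDist_sup (Φ := Φ) j.rev 1
  exact measurableSet_lt (by fun_prop) (by fun_prop)

lemma measurableSet_assocInterf (j m : Fin 2) :
    MeasurableSet[countAlgebra (Φ 0) ⊔ countAlgebra (Φ 1)] (assocInterf c Φ j m) := by
  let := countAlgebra (Φ 0) ⊔ countAlgebra (Φ 1)
  unfold assocInterf
  split_ifs
  · exact (measurableSet_assoc j).inter
      (measurableSet_lt (measurable_nearestDist_sup j 2) (measurable_nearestDist_sup j.rev 1))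
  · exact (measurableSet_assoc j).inter
      (measurableSet_lt (measurable_nearestDist_sup m 1) (measurable_nearestDist_sup j 2))

lemma measurable_sum_indicator_assoc {f : Fin 2 → Ω → ℝ}
    (hf : ∀ j, Measurable[countAlgebra (Φ 0) ⊔ countAlgebra (Φ 1)] (f j)) :
    Measurable[countAlgebra (Φ 0) ⊔ countAlgebra (Φ 1)]
      fun ω => ∑ j, (assoc c Φ j).indicator (f j) ω := by
  let := countAlgebra (Φ 0) ⊔ countAlgebra (Φ 1)
  exact Finset.measurable_sum _ fun j _ => (hf j).indicator (measurableSet_assoc j)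

lemma measurable_servDist :
    Measurable[countAlgebra (Φ 0) ⊔ countAlgebra (Φ 1)] (servDist c Φ) :=
  measurable_sum_indicator_assoc fun j => measurable_nearestDist_sup j 1

lemma measurable_interfDist :
    Measurable[countAlgebra (Φ 0) ⊔ countAlgebra (Φ 1)] (interfDist c Φ) :=
  measurable_sum_indicator_assoc fun j =>
    (measurable_nearestDist_sup j 2).min (measurable_nearestDist_sup j.rev 1)

end Association

lemma mem_assoc_iff {Ω : Type*} {c : Params} {Φ : Fin 2 → Ω → Set Plane} (j : Fin 2) {ω : Ω} (h : ∀ j, 0 < nearestDist (Φ j ω) 1 ∧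
    nearestDist (Φ j ω) 1 < nearestDist (Φ j ω) 2) :
    ω ∈ assoc c Φ j ↔
      (c.t j.rev / c.t j) ^ (1 / c.α) * nearestDist (Φ j ω) 1 < nearestDist (Φ j.rev ω) 1 :=
  c.weighted_lt_iff j j.rev (h j).1 (h j.rev).1

/-- Distances for which the most interfered station is the nearest one of the other tier. -/
def regionRev (k : ℝ) (A : Set (ℝ × ℝ)) : Set ((ℝ × ℝ) × ℝ) :=
  {z | k * z.1.1 < z.2 ∧ z.2 < z.1.2 ∧ (z.1.1, z.2) ∈ A}

/-- Distances for which the most interfered station is the second nearest one of the same tier. -/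
def regionSelf (k : ℝ) (A : Set (ℝ × ℝ)) : Set ((ℝ × ℝ) × ℝ) :=
  {z | k * z.1.1 < z.2 ∧ z.1.2 < z.2 ∧ z.1 ∈ A}

lemma measurableSet_regionRev (k : ℝ) {A : Set (ℝ × ℝ)} (hA : MeasurableSet A) :
    MeasurableSet (regionRev k A) := by
  have h1 : MeasurableSet {z : (ℝ × ℝ) × ℝ | k * z.1.1 < z.2} :=
    measurableSet_lt (by fun_prop) (by fun_prop)
  have h2 : MeasurableSet {z : (ℝ × ℝ) × ℝ | z.2 < z.1.2} :=
    measurableSet_lt (by fun_prop) (by fun_prop)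
  have h3 : Measurable fun z : (ℝ × ℝ) × ℝ => (z.1.1, z.2) := by fun_prop
  exact h1.inter (h2.inter (h3 hA))

lemma measurableSet_regionSelf (k : ℝ) {A : Set (ℝ × ℝ)} (hA : MeasurableSet A) :
    MeasurableSet (regionSelf k A) := by
  have h1 : MeasurableSet {z : (ℝ × ℝ) × ℝ | k * z.1.1 < z.2} :=
    measurableSet_lt (by fun_prop) (by fun_prop)
  have h2 : MeasurableSet {z : (ℝ × ℝ) × ℝ | z.1.2 < z.2} :=
    measurableSet_lt (by fun_prop) (by fun_prop)
  exact h1.inter (h2.inter (measurable_fst hA))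

lemma countAlgebra_sup_le {Ω : Type*} [mΩ : MeasurableSpace Ω] {P : Measure Ω} {c : Params}
    {Φ : Fin 2 → Ω → Set Plane}
    (hΦ : ∀ j, IsPoissonProcess P (ENNReal.ofReal (c.lam j) • volume) (Φ j)) :
    countAlgebra (Φ 0) ⊔ countAlgebra (Φ 1) ≤ mΩ :=
  sup_le (hΦ 0).countAlgebra_le (hΦ 1).countAlgebra_le

lemma measurable_distPair {Ω : Type*} [MeasurableSpace Ω] {P : Measure Ω} {c : Params}
    {Φ : Fin 2 → Ω → Set Plane}
    (hΦ : ∀ j, IsPoissonProcess P (ENNReal.ofReal (c.lam j) • volume) (Φ j)) :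
    Measurable fun ω => (servDist c Φ ω, interfDist c Φ ω) :=
  (measurable_servDist.mono (countAlgebra_sup_le hΦ) le_rfl).prodMk
    (measurable_interfDist.mono (countAlgebra_sup_le hΦ) le_rfl)

lemma jointPdf_eq {Ω : Type*} [MeasurableSpace Ω] (P : Measure Ω) (c : Params)
    (Φ : Fin 2 → Ω → Set Plane) (j m : Fin 2) (v w : ℝ) :
    jointPdf P c Φ j m v w = c.subPdf j m v w / P.real (assocInterf c Φ j m) := by
  unfold jointPdf Params.subPdf
  split_ifs with h1 h2 h2
  · rw [h1]
  · simp
  · rfl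
  · simp

/-- Here `U` is the distance `w` to the other tier. After Tonelli, `y` enters only through its
density and the condition `y > max x w`, and integrating it out gives `zeta`. -/
lemma Params.lintegral_subPdf_rev (c : Params) (j : Fin 2) {A : Set (ℝ × ℝ)} (hA : MeasurableSet A) (x : ℝ) :
    ∫⁻ y, c.nearestTwoDensity j (x, y) * ∫⁻ w, c.nearestDensity j.rev w *
      (regionRev ((c.t j.rev / c.t j) ^ (1 / c.α)) A).indicator 1 ((x, y), w) =
      ∫⁻ w, A.indicator (fun q => ENNReal.ofReal (c.subPdf j j.rev q.1 q.2)) (x, w) := by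
  have hjr : j ≠ j.rev := by fin_cases j <;> simp
  rcases le_or_gt x 0 with hx | hx
  · have (w : ℝ) : A.indicator (fun q => ENNReal.ofReal (c.subPdf j j.rev q.1 q.2)) (x, w) = 0 :=
      indicator_apply_eq_zero.2 fun _ => by simp [subPdf, hjr, hx.not_gt]
    simp [c.nearestTwoDensity_of_nonpos j hx, this]
  set k := (c.t j.rev / c.t j) ^ (1 / c.α) with hk
  have hk0 : 0 < k := c.ratio_pos j j.rev
  set S := regionRev k A with hSdef
  have hS : MeasurableSet S := measurableSet_regionRev k hA
  have hS1 : Measurable (S.indicator (1 : (ℝ × ℝ) × ℝ → ℝ≥0∞)) := measurable_one.indicator hS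
  have m1 (y : ℝ) : Measurable fun w => c.nearestDensity j.rev w * S.indicator 1 ((x, y), w) :=
    (c.measurable_nearestDensity j.rev).mul (hS1.comp measurable_prodMk_left)
  have m2 : Measurable fun q : ℝ × ℝ => c.nearestTwoDensity j (x, q.1) *
      (c.nearestDensity j.rev q.2 * S.indicator 1 ((x, q.1), q.2)) :=
    ((c.measurable_nearestTwoDensity j).comp (measurable_const.prodMk measurable_fst)).mul
      (((c.measurable_nearestDensity j.rev).comp measurable_snd).mul (hS1.comp (by fun_prop)))
  have e1 (y : ℝ) : c.nearestTwoDensity j (x, y) *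
      ∫⁻ w, c.nearestDensity j.rev w * S.indicator 1 ((x, y), w) =
      ∫⁻ w, c.nearestTwoDensity j (x, y) *
        (c.nearestDensity j.rev w * S.indicator 1 ((x, y), w)) :=
    (lintegral_const_mul _ (m1 y)).symm
  simp_rw [e1]
  rw [lintegral_lintegral_swap m2.aemeasurable]
  refine lintegral_congr fun w => ?_
  by_cases hw : k * x < w ∧ (x, w) ∈ A
  · have hw0 : 0 < w := (mul_pos hk0 hx).trans hw.1
    have e2 (y : ℝ) : c.nearestTwoDensity j (x, y) *
        (c.nearestDensity j.rev w * S.indicator 1 ((x, y), w)) =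
        ENNReal.ofReal (c.nearestPdf j.rev w) * (Ioi (max x w)).indicator
          (fun y => ENNReal.ofReal (c.nearestTwoPdf j x y)) y := by
      rw [c.nearestTwoDensity_of_pos j hx, ← Ioi_inter_Ioi, ← indicator_indicator]
      by_cases hy : w < y
      · have hz : ((x, y), w) ∈ S := ⟨hw.1, hy, hw.2⟩
        by_cases hy' : x < y <;> simp [hz, hy, hy', nearestDensity, hw0, mul_comm]
      · have hz : ((x, y), w) ∉ S := fun h => hy h.2.1
        simp [hz, hy]
    simp_rw [e2]
    rw [lintegral_const_mul _ ((Measurable.ennreal_ofReal (by unfold nearestTwoPdf; fun_prop)).indicator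
      measurableSet_Ioi), lintegral_indicator measurableSet_Ioi,
      c.lintegral_Ioi_nearestTwoPdf j hx.le, indicator_of_mem hw.2, ← ENNReal.ofReal_mul]
    · simp only [subPdf, if_neg hjr, ← hk]
      rw [if_pos ⟨hx, hw.1⟩]
    · unfold nearestPdf
      have := c.lam_pos j.rev
      positivity
  · have hS0 (y : ℝ) : S.indicator (1 : (ℝ × ℝ) × ℝ → ℝ≥0∞) ((x, y), w) = 0 :=
      indicator_of_notMem (fun h => hw ⟨h.1, h.2.2⟩) _
    have hr : A.indicator (fun q => ENNReal.ofReal (c.subPdf j j.rev q.1 q.2)) (x, w) = 0 := by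
      refine indicator_apply_eq_zero.2 fun hwA => ?_
      have : ¬ (k * x < w) := fun h => hw ⟨h, hwA⟩
      simp only [subPdf, if_neg hjr, ← hk]
      rw [if_neg (fun h => this h.2), ENNReal.ofReal_zero]
    simp [hS0, hr]

/-- Here `U` is the second nearest distance `y`. The other tier only has to stay beyond `max (k * x)
y`, which costs the factor `nearestCcdf`. -/
lemma Params.lintegral_subPdf_self (c : Params) (j : Fin 2) {A : Set (ℝ × ℝ)} (x : ℝ) :
    ∫⁻ y, c.nearestTwoDensity j (x, y) * ∫⁻ w, c.nearestDensity j.rev w *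
      (regionSelf ((c.t j.rev / c.t j) ^ (1 / c.α)) A).indicator 1 ((x, y), w) =
      ∫⁻ w, A.indicator (fun q => ENNReal.ofReal (c.subPdf j j q.1 q.2)) (x, w) := by
  refine lintegral_congr fun y => ?_
  by_cases h : 0 < x ∧ x < y
  swap
  · have h1 : c.nearestTwoDensity j (x, y) = 0 := by
      rw [not_and_or] at h
      rcases h with h | h <;> simp [nearestTwoDensity, h]
    rw [h1, zero_mul]
    exact (indicator_apply_eq_zero.2 fun _ => by simp [subPdf, h]).symm
  obtain ⟨hx, hxy⟩ := h
  set k := (c.t j.rev / c.t j) ^ (1 / c.α) with hk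
  have hk0 : 0 < k := c.ratio_pos j j.rev
  by_cases hA : (x, y) ∈ A
  · have e (w : ℝ) : c.nearestDensity j.rev w *
        (regionSelf k A).indicator 1 ((x, y), w) =
        (Ioi (max (k * x) y)).indicator (fun w => ENNReal.ofReal (c.nearestPdf j.rev w)) w := by
      rw [← Ioi_inter_Ioi, ← indicator_indicator]
      by_cases h : k * x < w ∧ y < w
      · have hz : ((x, y), w) ∈ regionSelf k A := ⟨h.1, h.2, hA⟩
        simp [hz, h.1, h.2, nearestDensity, (hx.trans hxy).trans h.2]
      · have hz : ((x, y), w) ∉ regionSelf k A := fun hz => h ⟨hz.1, hz.2.1⟩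
        rw [not_and_or] at h
        rcases h with h | h <;> simp [hz, h, indicator_apply]
    simp_rw [e]
    rw [lintegral_indicator measurableSet_Ioi, c.lintegral_Ioi_nearestPdf j.rev
      ((mul_pos hk0 hx).le.trans (le_max_left _ _)), indicator_of_mem hA,
      c.nearestTwoDensity_of_pos j hx, indicator_of_mem (show y ∈ Ioi x from hxy), mul_comm,
      ← ENNReal.ofReal_mul (by unfold nearestCcdf; positivity)]
    simp [subPdf, hx, hxy, hk]
  · have hz (w : ℝ) : ((x, y), w) ∉ regionSelf k A := fun hz => hA hz.2.2
    simp [hA, hz]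

section Law

variable {Ω : Type*} [mΩ : MeasurableSpace Ω] {P : Measure Ω} [IsProbabilityMeasure P] {c : Params}
  {Φ : Fin 2 → Ω → Set Plane}

variable (hΦ : ∀ j, IsPoissonProcess P (ENNReal.ofReal (c.lam j) • volume) (Φ j))
include hΦ

variable (hi : Indep (countAlgebra (Φ 0)) (countAlgebra (Φ 1)) P)
include hi

/-- Up to a null set the event is a region in the space of the three distances, and on it the
minimum that defines `U` is a single one of them. -/
lemma map_restrict_assocInterf (j m : Fin 2) :
    (P.restrict (assocInterf c Φ j m)).map (fun ω => (servDist c Φ ω, interfDist c Φ ω)) =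
      (volume : Measure (ℝ × ℝ)).withDensity fun q => ENNReal.ofReal (c.subPdf j m q.1 q.2) := by
  have hX := measurableSet_assocInterf (c := c) (Φ := Φ) j m
  have hX' := countAlgebra_sup_le hΦ _ hX
  have hm := measurable_distPair hΦ
  have hpos := ae_nearestDist_pos hΦ
  ext A hA
  rw [Measure.map_apply hm hA, Measure.restrict_apply (hm hA), withDensity_apply _ hA,
    ← lintegral_indicator hA, Measure.volume_eq_prod, lintegral_prod _
      ((c.measurable_subPdf j m).ennreal_ofReal.indicator hA).aemeasurable,
    ← lintegral_indicator_one ((hm hA).inter hX')]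
  by_cases hjm : j = m
  · subst hjm
    simp_rw [← c.lintegral_subPdf_self j]
    have hS := measurableSet_regionSelf ((c.t j.rev / c.t j) ^ (1 / c.α)) hA
    rw [← lintegral_comp_dist hΦ hi j (measurable_one.indicator hS)]
    refine lintegral_congr_ae (hpos.mono fun ω hω => ?_)
    refine indicator_const_eq_indicator_const (c := (1 : ℝ≥0∞)) ?_
    have ha := mem_assoc_iff (c := c) j hω
    simp only [mem_inter_iff, mem_preimage, assocInterf, if_pos, mem_ofPred_eq]
    constructor
    · rintro ⟨h1, h2, h3⟩
      rw [servDist_of_mem h2, interfDist_of_mem h2, min_eq_left h3.le] at h1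
      exact ⟨ha.1 h2, h3, h1⟩
    · rintro ⟨h1, h2, h3⟩
      have h4 := ha.2 h1
      rw [servDist_of_mem h4, interfDist_of_mem h4, min_eq_left h2.le]
      exact ⟨h3, h4, h2⟩
  · have hm : m = j.rev := by fin_cases j <;> fin_cases m <;> simp_all
    subst hm
    simp_rw [← c.lintegral_subPdf_rev j hA]
    have hS := measurableSet_regionRev ((c.t j.rev / c.t j) ^ (1 / c.α)) hA
    rw [← lintegral_comp_dist hΦ hi j (measurable_one.indicator hS)]
    refine lintegral_congr_ae (hpos.mono fun ω hω => ?_)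
    refine indicator_const_eq_indicator_const (c := (1 : ℝ≥0∞)) ?_
    have ha := mem_assoc_iff (c := c) j hω
    simp only [mem_inter_iff, mem_preimage, assocInterf, if_neg hjm, mem_ofPred_eq]
    constructor
    · rintro ⟨h1, h2, h3⟩
      rw [servDist_of_mem h2, interfDist_of_mem h2, min_eq_right (le_of_lt h3)] at h1
      exact ⟨ha.1 h2, h3, h1⟩
    · rintro ⟨h1, h2, h3⟩
      have h4 := ha.2 h1
      rw [servDist_of_mem h4, interfDist_of_mem h4, min_eq_right h2.le]
      exact ⟨h3, h4, h2⟩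

lemma map_cond_assocInterf (j m : Fin 2) :
    (P[|assocInterf c Φ j m]).map (fun ω => (servDist c Φ ω, interfDist c Φ ω)) =
      (volume : Measure (ℝ × ℝ)).withDensity fun q =>
        ENNReal.ofReal (jointPdf P c Φ j m q.1 q.2) := by
  have hmap := map_restrict_assocInterf hΦ hi j m
  -- Conditioning on a null event gives the zero measure, and `jointPdf` is then zero as a quotient
  -- by zero; the identity holds in this case by these conventions.
  by_cases h0 : P (assocInterf c Φ j m) = 0
  · have h1 : P.real (assocInterf c Φ j m) = 0 := by simp [measureReal_def, h0]
    simp [ProbabilityTheory.cond, Measure.restrict_eq_zero.2 h0, jointPdf_eq, h1]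
  · have hne := measure_ne_top P (assocInterf c Φ j m)
    have hr : 0 < P.real (assocInterf c Φ j m) := ENNReal.toReal_pos h0 hne
    simp_rw [jointPdf_eq, div_eq_inv_mul, ENNReal.ofReal_mul (inv_nonneg.2 hr.le)]
    rw [ProbabilityTheory.cond, Measure.map_smul, hmap]
    have := withDensity_smul (μ := (volume : Measure (ℝ × ℝ)))
      (P (assocInterf c Φ j m))⁻¹ (c.measurable_subPdf j m).ennreal_ofReal
    rw [← this, ENNReal.ofReal_inv_of_pos hr, measureReal_def, ENNReal.ofReal_toReal hne]
    rfl

end Law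

lemma measure_smul_cond {Ω : Type*} [MeasurableSpace Ω] (Q : Measure Ω) [IsFiniteMeasure Q]
    (s : Set Ω) : Q s • Q[|s] = Q.restrict s := by
  by_cases h : Q s = 0
  · simp [h, Measure.restrict_eq_zero.2 h]
  · rw [ProbabilityTheory.cond, smul_smul, ENNReal.mul_inv_cancel h (measure_ne_top _ _), one_smul]

/-! ### Almost sure partition by association and by most interfered tier -/

section Partition

variable {Ω : Type*} [mΩ : MeasurableSpace Ω] {P : Measure Ω} [IsProbabilityMeasure P] {c : Params}
  {Φ : Fin 2 → Ω → Set Plane}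
  (hΦ : ∀ j, IsPoissonProcess P (ENNReal.ofReal (c.lam j) • volume) (Φ j))
  (hi : Indep (countAlgebra (Φ 0)) (countAlgebra (Φ 1)) P)
include hΦ hi

/-- The nearest distance of one tier almost surely avoids any function of the distances of the
other one. -/
lemma ae_nearestDist_rev_ne (j : Fin 2) {f : ℝ × ℝ → ℝ} (hf : Measurable f) :
    ∀ᵐ ω ∂P, nearestDist (Φ j.rev ω) 1 ≠ f (nearestDist (Φ j ω) 1, nearestDist (Φ j ω) 2) := by
  have hS : MeasurableSet {z : (ℝ × ℝ) × ℝ | z.2 = f z.1} :=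
    measurableSet_eq_fun measurable_snd (hf.comp measurable_fst)
  have hd (k : Fin 2) := measurable_nearestDist_bs hΦ k
  have hZ : Measurable fun ω => ((nearestDist (Φ j ω) 1, nearestDist (Φ j ω) 2),
      nearestDist (Φ j.rev ω) 1) := ((hd j 1).prodMk (hd j 2)).prodMk (hd j.rev 1)
  have h := lintegral_comp_dist hΦ hi j (measurable_one.indicator hS)
  have h0 (x y : ℝ) : ∫⁻ w, c.nearestDensity j.rev w *
      {z : (ℝ × ℝ) × ℝ | z.2 = f z.1}.indicator 1 ((x, y), w) = 0 := by
    refine (lintegral_congr_ae ?_).trans lintegral_zero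
    filter_upwards [(measure_eq_zero_iff_ae_notMem (μ := volume)).1 (Real.volume_singleton
      (a := f (x, y)))] with w hw
    have : ((x, y), w) ∉ {z : (ℝ × ℝ) × ℝ | z.2 = f z.1} := hw
    simp [indicator_of_notMem this]
  simp only [h0, mul_zero, lintegral_zero] at h
  have h' : P {ω | nearestDist (Φ j.rev ω) 1 =
      f (nearestDist (Φ j ω) 1, nearestDist (Φ j ω) 2)} = 0 :=
    (lintegral_indicator_one (hZ hS)).symm.trans h
  exact measure_eq_zero_iff_ae_notMem.1 h'

/-- Outside both strict inequalities the weighted powers tie, which ties the two nearest distances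
by a fixed ratio; this is a null event by independence and absolute continuity. -/
lemma ae_mem_assoc : ∀ᵐ ω ∂P, ω ∈ assoc c Φ 0 ∨ ω ∈ assoc c Φ 1 := by
  filter_upwards [ae_nearestDist_pos hΦ, ae_nearestDist_rev_ne hΦ hi 0
    (f := fun q => (c.t 1 / c.t 0) ^ (1 / c.α) * q.1) (by fun_prop)] with ω hpos hne
  rw [mem_assoc_iff 0 hpos]
  rcases lt_or_gt_of_ne hne with h | h
  · right
    by_contra h1
    have h2 := (not_congr (c.weighted_lt_iff 1 0 (hpos 1).1 (hpos 0).1)).1 h1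
    have h3 := (not_congr (c.weighted_lt_iff 0 1 (hpos 0).1 (hpos 1).1)).2 (not_lt.2 (le_of_lt h))
    have h4 : ¬ c.t 0 * (c.τ * nearestDist (Φ 0 ω) 1) ^ (-c.α) <
      c.t 1 * (c.τ * nearestDist (Φ 1 ω) 1) ^ (-c.α) := h1
    have heq := le_antisymm (not_lt.1 h3) (not_lt.1 h4)
    have hk := c.ratio_pos 0 1
    have hk' : (c.t 0 / c.t 1) ^ (1 / c.α) = ((c.t 1 / c.t 0) ^ (1 / c.α))⁻¹ := by
      rw [← Real.inv_rpow (div_nonneg (c.t_pos 1).le (c.t_pos 0).le), inv_div]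
    rw [hk', not_lt, inv_mul_eq_div, le_div_iff₀ hk, mul_comm] at h2
    exact h.not_ge h2
  · exact Or.inl h

lemma ae_mem_assocInterf (j : Fin 2) : ∀ᵐ ω ∂P, ω ∈ assoc c Φ j →
    ω ∈ assocInterf c Φ j j ∨ ω ∈ assocInterf c Φ j j.rev := by
  have hjr : j ≠ j.rev := by fin_cases j <;> simp
  filter_upwards [ae_nearestDist_rev_ne hΦ hi j (f := fun q => q.2) measurable_snd] with ω hne hω
  simp only [assocInterf, if_pos, if_neg hjr, mem_inter_iff, hω, true_and, mem_ofPred_eq]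
  exact (lt_or_gt_of_ne hne).symm

lemma prob_assoc_add : P.real (assoc c Φ 0) + P.real (assoc c Φ 1) = 1 := by
  have hm := countAlgebra_sup_le hΦ _ (measurableSet_assoc (c := c) (Φ := Φ) 1)
  have hd : Disjoint (assoc c Φ 0) (assoc c Φ 1) := assoc_disjoint 0
  rw [← measureReal_union hd hm, measureReal_def]
  have : P (assoc c Φ 0 ∪ assoc c Φ 1) = 1 := by
    rw [← measure_univ (μ := P)]
    exact measure_congr (eventuallyEq_univ.2 (ae_mem_assoc hΦ hi))
  simp [this]

/-- Total probability over the tier of the most interfered station. The weights are the `Pr(Q⁽ⁿ⁾ |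
X⁽ʲ⁾)` of the definition of `averaged`. -/
lemma cond_assoc_eq (j : Fin 2) : P[|assoc c Φ j] =
    ∑ n, (P[|assoc c Φ j]) (assocInterf c Φ j n) • P[|assocInterf c Φ j n] := by
  have hle := countAlgebra_sup_le hΦ
  have hm (n : Fin 2) := hle _ (measurableSet_assocInterf (c := c) (Φ := Φ) j n)
  have ha := hle _ (measurableSet_assoc (c := c) (Φ := Φ) j)
  have hjr : j ≠ j.rev := by fin_cases j <;> simp
  have e (n : Fin 2) : (P[|assoc c Φ j]) (assocInterf c Φ j n) • P[|assocInterf c Φ j n] =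
      (P[|assoc c Φ j]).restrict (assocInterf c Φ j n) := by
    rw [← measure_smul_cond, cond_cond_eq_cond_inter ha (hm n),
      inter_eq_self_of_subset_right (assocInterf_subset j n)]
  have hsum : ∑ n, (P[|assoc c Φ j]).restrict (assocInterf c Φ j n) =
      (P[|assoc c Φ j]).restrict (assocInterf c Φ j j) +
        (P[|assoc c Φ j]).restrict (assocInterf c Φ j j.rev) := by
    rw [Fin.sum_univ_two]
    fin_cases j
    · rfl
    · exact add_comm _ _
  simp_rw [e]
  rw [hsum, ← Measure.restrict_union _ (hm _)]
  · refine (Measure.restrict_eq_self_of_ae_mem ?_).symm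
    have h1 : ∀ᵐ ω ∂P[|assoc c Φ j], ω ∈ assoc c Φ j := ae_cond_mem ha
    have h3 : ∀ᵐ ω ∂P[|assoc c Φ j], ω ∈ assoc c Φ j →
        ω ∈ assocInterf c Φ j j ∨ ω ∈ assocInterf c Φ j j.rev :=
      cond_absolutelyContinuous.ae_le (ae_mem_assocInterf hΦ hi j)
    filter_upwards [h1, h3] with ω h1 h3 using h3 h1
  · refine disjoint_left.2 fun ω h1 h2 => ?_
    simp only [assocInterf, if_pos, if_neg hjr, mem_inter_iff, mem_ofPred_eq] at h1 h2
    exact lt_asymm h1.2 h2.2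

end Partition

/-- The law of the pair of distances of a terminal which is associated with tier `k`. -/
def distLaw {Ω : Type*} [MeasurableSpace Ω] (P : Measure Ω) (c : Params)
    (Φ : Fin 2 → Ω → Set Plane) (k : Fin 2) : Measure (ℝ × ℝ) :=
  (P[|assoc c Φ k]).map fun ω => (servDist c Φ ω, interfDist c Φ ω)

lemma Params.subPdf_nonneg (c : Params) (j m : Fin 2) (v w : ℝ) : 0 ≤ c.subPdf j m v w := by
  have h1 := c.lam_pos j
  have h2 := c.lam_pos m
  unfold subPdf
  split_ifs with h h' h'
  · have := h'.1.trans h'.2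
    have := h'.1
    unfold nearestCcdf nearestTwoPdf; positivity
  · exact le_rfl
  · have h3 := (mul_pos (c.ratio_pos j m) h'.1).trans h'.2
    have := h'.1
    unfold nearestPdf zeta; positivity
  · exact le_rfl

lemma Params.subPdf_eq_zero (c : Params) (j m : Fin 2) {v w : ℝ}
    (h : ¬ (0 < v ∧ (c.t m / c.t j) ^ (1 / c.α) * v < w)) : c.subPdf j m v w = 0 := by
  unfold subPdf
  split_ifs with h1 h2
  · subst h1
    rw [div_self (c.t_pos _).ne', Real.one_rpow, one_mul] at h
    exact absurd h2 h
  · rfl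
  · rfl

/-! ### Averages as integrals against the law of the marks -/

section Averaged

variable {Ω : Type*} [mΩ : MeasurableSpace Ω] {P : Measure Ω} [IsProbabilityMeasure P] {c : Params}
  {Φ : Fin 2 → Ω → Set Plane}

instance (k : Fin 2) : IsFiniteMeasure (distLaw P c Φ k) := by
  unfold distLaw; infer_instance

variable (hΦ : ∀ j, IsPoissonProcess P (ENNReal.ofReal (c.lam j) • volume) (Φ j))
include hΦ

lemma ae_distLaw_pos (k : Fin 2) : ∀ᵐ q ∂distLaw P c Φ k, 0 < q.1 ∧ 0 < q.2 := by
  have hS : MeasurableSet {q : ℝ × ℝ | 0 < q.1 ∧ 0 < q.2} :=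
    (measurableSet_lt measurable_const measurable_fst).inter
      (measurableSet_lt measurable_const measurable_snd)
  rw [distLaw, ae_map_iff (measurable_distPair hΦ).aemeasurable hS]
  have ha := countAlgebra_sup_le hΦ _ (measurableSet_assoc (c := c) (Φ := Φ) k)
  have h1 : ∀ᵐ ω ∂P[|assoc c Φ k], ω ∈ assoc c Φ k := ae_cond_mem ha
  filter_upwards [h1, cond_absolutelyContinuous.ae_le (ae_nearestDist_pos hΦ)] with ω h1 h2
  rw [servDist_of_mem h1, interfDist_of_mem h1]
  exact ⟨(h2 k).1, lt_min ((h2 k).1.trans (h2 k).2) (h2 k.rev).1⟩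

variable (hi : Indep (countAlgebra (Φ 0)) (countAlgebra (Φ 1)) P)
include hi

lemma distLaw_eq (k : Fin 2) : distLaw P c Φ k = ∑ n, (P[|assoc c Φ k]) (assocInterf c Φ k n) •
    (volume : Measure (ℝ × ℝ)).withDensity fun q =>
      ENNReal.ofReal (jointPdf P c Φ k n q.1 q.2) := by
  unfold distLaw
  conv_lhs => rw [cond_assoc_eq hΦ hi k]
  rw [Fin.sum_univ_two, Fin.sum_univ_two,
    Measure.map_add _ _ (measurable_distPair hΦ), Measure.map_smul, Measure.map_smul,
    map_cond_assocInterf hΦ hi, map_cond_assocInterf hΦ hi]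

/-- The conditional densities mix to `distLaw`. Fubini, which needs `hg`, gives the iterated
integrals, and their restricted ranges lose nothing since the densities vanish outside. -/
lemma averaged_eq {g : Fin 2 → ℝ → ℝ → ℝ}
    (hg : ∀ k, Integrable (fun q : ℝ × ℝ => g k q.1 q.2) (distLaw P c Φ k)) :
    averaged P c Φ g =
      -∑ k, 2 * Real.pi * c.lam k * ∫ q, g k q.1 q.2 ∂distLaw P c Φ k := by
  unfold averaged
  congr 1
  refine Finset.sum_congr rfl fun k _ => ?_
  congr 1
  let η (n : Fin 2) : Measure (ℝ × ℝ) := (volume : Measure (ℝ × ℝ)).withDensity fun q =>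
      ENNReal.ofReal (jointPdf P c Φ k n q.1 q.2)
  have hpm (n : Fin 2) : Measurable fun q : ℝ × ℝ => jointPdf P c Φ k n q.1 q.2 := by
    simp_rw [jointPdf_eq]; exact (c.measurable_subPdf k n).div_const _
  have hp0 (n : Fin 2) (v w : ℝ) : 0 ≤ jointPdf P c Φ k n v w := by
    rw [jointPdf_eq]; exact div_nonneg (c.subPdf_nonneg k n v w) measureReal_nonneg
  have hle (n : Fin 2) : (P[|assoc c Φ k]) (assocInterf c Φ k n) • η n ≤ distLaw P c Φ k := by
    rw [distLaw_eq hΦ hi]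
    exact Finset.single_le_sum (f := fun n => (P[|assoc c Φ k]) (assocInterf c Φ k n) • η n)
      (fun _ _ => Measure.zero_le _) (Finset.mem_univ n)
  have hint (n : Fin 2) := (hg k).mono_measure (hle n)
  have hsum : ∫ q, g k q.1 q.2 ∂distLaw P c Φ k =
      ∑ n, (P[|assoc c Φ k]).real (assocInterf c Φ k n) * ∫ q, g k q.1 q.2 ∂η n := by
    rw [distLaw_eq hΦ hi, Fin.sum_univ_two, integral_add_measure (hint 0) (hint 1),
      integral_smul_measure, integral_smul_measure, Fin.sum_univ_two]
    rfl
  rw [hsum]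
  refine Finset.sum_congr rfl fun n _ => ?_
  -- With weight zero, integrability against the scaled measure says nothing about `η n`, but the
  -- summand vanishes on both sides.
  by_cases h0 : (P[|assoc c Φ k]) (assocInterf c Φ k n) = 0
  · simp [measureReal_def, h0]
  congr 1
  have hη : Integrable (fun q : ℝ × ℝ => g k q.1 q.2) (η n) :=
    (integrable_smul_measure h0 (measure_ne_top _ _)).1 (hint n)
  have hη' : Integrable (fun q : ℝ × ℝ => jointPdf P c Φ k n q.1 q.2 * g k q.1 q.2) volume := by
    have := (integrable_withDensity_iff_integrable_smul' (hpm n).ennreal_ofReal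
      (ae_of_all _ fun _ => ENNReal.ofReal_lt_top)).1 hη
    simpa only [ENNReal.toReal_ofReal (hp0 n _ _), smul_eq_mul] using this
  have e : ∫ q, g k q.1 q.2 ∂η n = ∫ q : ℝ × ℝ, jointPdf P c Φ k n q.1 q.2 * g k q.1 q.2 := by
    rw [integral_withDensity_eq_integral_toReal_smul (hpm n).ennreal_ofReal
      (ae_of_all _ fun _ => ENNReal.ofReal_lt_top)]
    simp only [ENNReal.toReal_ofReal (hp0 n _ _), smul_eq_mul]
  have hz (r u : ℝ) (h : ¬ (0 < r ∧ (c.t n / c.t k) ^ (1 / c.α) * r < u)) :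
      jointPdf P c Φ k n r u * g k r u = 0 := by
    rw [jointPdf_eq, c.subPdf_eq_zero k n h, zero_div, zero_mul]
  rw [e, Measure.volume_eq_prod, integral_prod _ hη',
    ← setIntegral_eq_integral_of_forall_compl_eq_zero (s := Ioi (0 : ℝ)) (μ := volume)
      (f := fun r => ∫ u, jointPdf P c Φ k n r u * g k r u)]
  · refine setIntegral_congr_fun measurableSet_Ioi fun r _ => ?_
    exact setIntegral_eq_integral_of_forall_compl_eq_zero fun u hu => hz r u fun h => hu h.2
  · intro r hr
    have (u : ℝ) : jointPdf P c Φ k n r u * g k r u = 0 := hz r u fun h => hr h.1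
    simp [this]

end Averaged

/-! ### Moments of the contribution of an interferer -/

lemma lintegral_expMeasure_pow (i : ℕ) :
    ∫⁻ h, ENNReal.ofReal h ^ i ∂expMeasure 1 = i.factorial := by
  have hm : Measurable fun h : ℝ => ENNReal.ofReal h ^ i := by fun_prop
  have hpdf : expMeasure 1 = (volume : Measure ℝ).withDensity (exponentialPDF 1) := rfl
  have hpm : Measurable (exponentialPDF 1) := (measurable_exponentialPDFReal 1).ennreal_ofReal
  rw [hpdf, lintegral_withDensity_eq_lintegral_mul _ hpm hm]
  have e (h : ℝ) : (exponentialPDF 1 * fun h => ENNReal.ofReal h ^ i) h = (Ici 0).indicator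
      (fun h => ENNReal.ofReal (Real.exp (-h) * h ^ ((i + 1 : ℝ) - 1))) h := by
    by_cases hh : 0 ≤ h
    · simp only [Pi.mul_apply, exponentialPDF_of_nonneg hh, indicator_of_mem (mem_Ici.2 hh)]
      rw [← ENNReal.ofReal_pow hh, ← ENNReal.ofReal_mul (by positivity)]
      simp
    · simp [exponentialPDF_of_neg (not_le.1 hh), hh]
  have hpos : (0 : ℝ) < i + 1 := by positivity
  simp_rw [e]
  rw [lintegral_indicator measurableSet_Ici, setLIntegral_congr Ioi_ae_eq_Ici.symm,
    ← ofReal_integral_eq_lintegral_ofReal (Real.GammaIntegral_convergent hpos),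
    ← Real.Gamma_eq_integral hpos, Real.Gamma_nat_eq_factorial]
  · simp
  · filter_upwards [ae_restrict_mem measurableSet_Ioi] with x hx
    have : 0 < x := hx
    simp only [Pi.zero_apply]
    positivity

/-- Translation to the origin, then polar coordinates; `β > 2` gives convergence at infinity. The
value is free of `b`, so the conditional moments depend only on the tier of the probe station. -/
lemma lintegral_norm_rpow {β M : ℝ} (hβ : 2 < β) (hM : 0 < M) (b : Plane) :
    ∫⁻ x : Plane, (Ioi M).indicator (fun D => ENNReal.ofReal (D ^ (-β))) ‖x - b‖ =
      ENNReal.ofReal (2 * Real.pi * (M ^ (2 - β) / (β - 2))) := by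
  rw [lintegral_sub_right_eq_self
    (fun x : Plane => (Ioi M).indicator (fun D => ENNReal.ofReal (D ^ (-β))) ‖x‖) b]
  let f : ℝ → ℝ := (Ioi M).indicator fun D => D ^ (-β)
  have hf0 (D : ℝ) : 0 ≤ f D := indicator_nonneg (fun D hD => Real.rpow_nonneg
    (hM.trans hD).le _) D
  have e (D : ℝ) : (Ioi M).indicator (fun D => ENNReal.ofReal (D ^ (-β))) D =
      ENNReal.ofReal (f D) := by
    by_cases h : D ∈ Ioi M <;> simp [f, h]
  have hdim : Module.finrank ℝ Plane = 2 := by simp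
  have e2 : ∀ y ∈ Ioi (0 : ℝ), y ^ (Module.finrank ℝ Plane - 1) • f y =
      (Ioi M).indicator (fun y => y ^ (1 - β)) y := fun y hy => by
    by_cases h : y ∈ Ioi M
    · simp only [f, indicator_of_mem h, hdim, smul_eq_mul]
      rw [Nat.add_one_sub_one, pow_one, sub_eq_add_neg, Real.rpow_add hy, Real.rpow_one]
    · simp [f, indicator_of_notMem h]
  have hint1 : IntegrableOn (fun y : ℝ => y ^ (1 - β)) (Ioi M) :=
    integrableOn_Ioi_rpow_of_lt (by linarith) hM
  have hsub : Ioi 0 ∩ Ioi M = Ioi M := inter_eq_self_of_subset_right (Ioi_subset_Ioi hM.le)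
  have hint : Integrable (fun x : Plane => f ‖x‖) := by
    rw [integrable_fun_norm_addHaar volume (f := f), integrableOn_congr_fun e2 measurableSet_Ioi,
      IntegrableOn, integrable_indicator_iff measurableSet_Ioi, IntegrableOn,
      Measure.restrict_restrict measurableSet_Ioi, inter_comm, hsub]
    exact hint1
  simp_rw [e]
  rw [← ofReal_integral_eq_lintegral_ofReal hint (ae_of_all _ fun x => hf0 _),
    integral_fun_norm_addHaar volume f, setIntegral_congr_fun measurableSet_Ioi e2,
    setIntegral_indicator measurableSet_Ioi, hsub, integral_Ioi_rpow_of_lt (by linarith) hM, hdim,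
    measureReal_def, EuclideanSpace.volume_ball_fin_two]
  congr 1
  have h1 : 1 - β + 1 = 2 - β := by ring
  have h2 : β - 2 ≠ 0 := by linarith
  have h3 : 2 - β ≠ 0 := by linarith
  rw [h1]
  simp [Real.pi_pos.le]
  field_simp
  ring

namespace Params

variable (c : Params)

lemma measurable_pMT : Measurable fun q : ℝ × ℝ => c.pMT q.1 q.2 := by
  unfold pMT; fun_prop

lemma measurable_minDist (j k : Fin 2) : Measurable fun q : ℝ × ℝ => c.minDist j k q.1 q.2 := by
  have := c.measurable_pMT
  unfold minDist; fun_prop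

lemma pMT_pos {r u : ℝ} (hr : 0 < r) (hu : 0 < u) : 0 < c.pMT r u := by
  have := c.p0_pos
  have := c.i0_pos
  have := c.pmax_pos
  have := c.τ_pos
  exact lt_min (lt_min (by positivity) (by positivity)) c.pmax_pos

lemma minDist_pos (j k : Fin 2) {r : ℝ} (hr : 0 < r) (u : ℝ) : 0 < c.minDist j k r u :=
  lt_max_of_lt_left (mul_pos (c.ratio_pos k j) hr)

lemma power_lt_iff {p D : ℝ} (hp : 0 < p) (hD : 0 < D) :
    p * (c.τ * D) ^ (-c.α) < c.i0 ↔ 1 / c.τ * (p / c.i0) ^ (1 / c.α) < D := by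
  have hα := c.α_pos
  have hτ := c.τ_pos
  have hi := c.i0_pos
  have e : ((p / c.i0) ^ (1 / c.α)) ^ c.α = p / c.i0 := by
    rw [← Real.rpow_mul (by positivity), one_div_mul_cancel hα.ne', Real.rpow_one]
  have h1 : 0 < (c.τ * D) ^ c.α := by positivity
  rw [one_div_mul_eq_div, div_lt_iff₀ hτ, mul_comm D,
    ← Real.rpow_lt_rpow_iff (x := (p / c.i0) ^ (1 / c.α)) (y := c.τ * D) (by positivity)
      (by positivity) hα, e, Real.rpow_neg (by positivity), ← div_eq_mul_inv, div_lt_iff₀ h1, div_lt_iff₀ hi, mul_comm c.i0]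

lemma power_le_iff {p D : ℝ} (hp : 0 < p) (hD : 0 < D) :
    p * (c.τ * D) ^ (-c.α) ≤ c.i0 ↔ 1 / c.τ * (p / c.i0) ^ (1 / c.α) ≤ D := by
  have hα := c.α_pos
  have hτ := c.τ_pos
  have hi := c.i0_pos
  have e : ((p / c.i0) ^ (1 / c.α)) ^ c.α = p / c.i0 := by
    rw [← Real.rpow_mul (by positivity), one_div_mul_cancel hα.ne', Real.rpow_one]
  have h1 : 0 < (c.τ * D) ^ c.α := by positivity
  rw [one_div_mul_eq_div, div_le_iff₀ hτ, mul_comm D,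
    ← Real.rpow_le_rpow_iff (x := (p / c.i0) ^ (1 / c.α)) (y := c.τ * D) (by positivity)
      (by positivity) hα, e, Real.rpow_neg (by positivity), ← div_eq_mul_inv, div_le_iff₀ h1, div_le_iff₀ hi, mul_comm c.i0]

/-- Both survival conditions are lower bounds on the distance to the probe station, and `minDist` is
the larger bound. -/
lemma contribution_eq (j k : Fin 2) (b x : Plane) {r u : ℝ} (hr : 0 < r) (hu : 0 < u) (h : ℝ) :
    c.contribution j k b (x, (r, u), h) = ENNReal.ofReal h *
      (ENNReal.ofReal (c.τ ^ (-c.α) * c.pMT r u) *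
        (Ioi (c.minDist j k r u)).indicator (fun D => ENNReal.ofReal (D ^ (-c.α))) ‖x - b‖) := by
  have hp := c.pMT_pos hr hu
  have hM := c.minDist_pos j k hr u
  have hτ := c.τ_pos
  have hα := c.α_pos
  simp only [contribution]
  -- At distance zero the convention `0 ^ (-α) = 0` makes the contribution zero, in agreement with
  -- the indicator of `D > M`.
  rcases (norm_nonneg (x - b)).eq_or_lt with hD | hD
  · rw [← hD, indicator_of_notMem (by simpa using hM.le), mul_zero,
      Real.zero_rpow (neg_ne_zero.2 hα.ne')]
    simp
  · have hiff : (c.t k * (c.τ * r) ^ (-c.α) > c.t j * (c.τ * ‖x - b‖) ^ (-c.α) ∧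
        c.pMT r u * (c.τ * ‖x - b‖) ^ (-c.α) < c.i0) ↔ ‖x - b‖ ∈ Ioi (c.minDist j k r u) := by
      rw [gt_iff_lt, c.weighted_lt_iff k j hr hD, c.power_lt_iff hp hD, mem_Ioi, minDist, max_lt_iff]
    by_cases hmem : ‖x - b‖ ∈ Ioi (c.minDist j k r u)
    · rw [if_pos (hiff.2 hmem), indicator_of_mem hmem, Real.mul_rpow hτ.le hD.le,
        ← ENNReal.ofReal_mul (by positivity), ← ENNReal.ofReal_mul' (by positivity)]
      congr 1
      ring
    · rw [if_neg (fun h => hmem (hiff.1 h)), indicator_of_notMem hmem, mul_zero, mul_zero]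

lemma measurable_contribution (j k : Fin 2) :
    Measurable fun z : Plane × Interferer => c.contribution j k z.1 z.2 := by
  have hp : Measurable fun z : Plane × Interferer => c.pMT z.2.2.1.1 z.2.2.1.2 :=
    c.measurable_pMT.comp (by fun_prop)
  unfold contribution
  refine Measurable.ite ?_ (by fun_prop) measurable_const
  have h1 : MeasurableSet {z : Plane × Interferer | c.t j * (c.τ * ‖z.2.1 - z.1‖) ^ (-c.α) <
      c.t k * (c.τ * z.2.2.1.1) ^ (-c.α)} := measurableSet_lt (by fun_prop) (by fun_prop)
  have h2 : MeasurableSet {z : Plane × Interferer | c.pMT z.2.2.1.1 z.2.2.1.2 *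
      (c.τ * ‖z.2.1 - z.1‖) ^ (-c.α) < c.i0} := measurableSet_lt (by fun_prop) (by fun_prop)
  exact h1.inter h2

lemma measurable_contribution_right (j k : Fin 2) (b : Plane) :
    Measurable (c.contribution j k b) := by
  have h : Measurable fun p : Interferer => c.contribution j k b p :=
    (c.measurable_contribution j k).comp (g := fun z : Plane × Interferer =>
      c.contribution j k z.1 z.2) (f := fun p : Interferer => (b, p)) measurable_prodMk_left
  exact h

/-- Moments of the contribution in terms of the law of the marks. -/
lemma lintegral_contribution_pow {ν : Measure (ℝ × ℝ)} [IsFiniteMeasure ν]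
    (hν : ∀ᵐ q ∂ν, 0 < q.1 ∧ 0 < q.2) (j k : Fin 2) (b : Plane) {i : ℕ} (hi : i ≠ 0) :
    ∫⁻ p, c.contribution j k b p ^ i
      ∂((ENNReal.ofReal (c.lam k) • (volume : Measure Plane)).prod (ν.prod (expMeasure 1))) =
    ENNReal.ofReal (c.lam k) * (i.factorial * ∫⁻ q, ENNReal.ofReal
      ((c.τ ^ (-c.α) * c.pMT q.1 q.2) ^ i *
        (2 * Real.pi * (c.minDist j k q.1 q.2 ^ (2 - i * c.α) / (i * c.α - 2)))) ∂ν) := by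
  have := isProbabilityMeasure_expMeasure one_pos
  have hβ : 2 < i * c.α := by
    have h1 : (1 : ℝ) ≤ i := by exact_mod_cast Nat.one_le_iff_ne_zero.2 hi
    have := c.two_lt_α
    nlinarith
  have hm : Measurable fun p : Interferer => c.contribution j k b p ^ i :=
    (c.measurable_contribution_right j k b).pow_const i
  have hmp := c.measurable_pMT
  have hmM := c.measurable_minDist j k
  rw [lintegral_prod_symm _ hm.aemeasurable, lintegral_prod _ (by
    exact (Measurable.lintegral_prod_left' hm).aemeasurable)]
  -- The marks are kept outermost: for fixed positive distances, position and fading integrate out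
  -- explicitly and independently.
  have e : ∀ᵐ q ∂ν, ∫⁻ h, ∫⁻ x, c.contribution j k b (x, q, h) ^ i
        ∂(ENNReal.ofReal (c.lam k) • (volume : Measure Plane)) ∂expMeasure 1 =
      ENNReal.ofReal (c.lam k) * i.factorial * ENNReal.ofReal
      ((c.τ ^ (-c.α) * c.pMT q.1 q.2) ^ i *
        (2 * Real.pi * (c.minDist j k q.1 q.2 ^ (2 - i * c.α) / (i * c.α - 2)))) := by
    filter_upwards [hν] with q hq
    have hp := c.pMT_pos hq.1 hq.2
    have hM := c.minDist_pos j k hq.1 q.2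
    have hτ := c.τ_pos
    have e1 (h : ℝ) (x : Plane) : c.contribution j k b (x, q, h) ^ i =
        ENNReal.ofReal h ^ i * ENNReal.ofReal (c.τ ^ (-c.α) * c.pMT q.1 q.2) ^ i *
          (Ioi (c.minDist j k q.1 q.2)).indicator
            (fun D => ENNReal.ofReal (D ^ (-(i * c.α)))) ‖x - b‖ := by
      rw [show q = (q.1, q.2) from rfl, c.contribution_eq j k b x hq.1 hq.2, mul_pow, mul_pow,
        ← mul_assoc]
      congr 1
      by_cases hmem : ‖x - b‖ ∈ Ioi (c.minDist j k q.1 q.2)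
      · have hD : 0 ≤ ‖x - b‖ := norm_nonneg _
        rw [indicator_of_mem hmem, indicator_of_mem hmem,
          ← ENNReal.ofReal_pow (Real.rpow_nonneg hD _), ← Real.rpow_mul_natCast hD]
        ring_nf
      · rw [indicator_of_notMem hmem, indicator_of_notMem hmem, zero_pow hi]
    have e2 (h : ℝ) : ∫⁻ x, c.contribution j k b (x, q, h) ^ i
        ∂(ENNReal.ofReal (c.lam k) • (volume : Measure Plane)) =
        ENNReal.ofReal h ^ i * (ENNReal.ofReal (c.lam k) *
          (ENNReal.ofReal (c.τ ^ (-c.α) * c.pMT q.1 q.2) ^ i * ENNReal.ofReal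
            (2 * Real.pi * (c.minDist j k q.1 q.2 ^ (2 - i * c.α) / (i * c.α - 2))))) := by
      have hmi : Measurable fun x : Plane => (Ioi (c.minDist j k q.1 q.2)).indicator
            (fun D => ENNReal.ofReal (D ^ (-(i * c.α)))) ‖x - b‖ :=
        ((show Measurable fun D : ℝ => ENNReal.ofReal (D ^ (-(i * c.α))) by fun_prop).indicator
          measurableSet_Ioi).comp (by fun_prop)
      simp_rw [e1]
      rw [lintegral_smul_measure, lintegral_const_mul _ hmi, lintegral_norm_rpow hβ hM, smul_eq_mul]
      ring
    simp_rw [e2]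
    rw [lintegral_mul_const _ (by fun_prop), lintegral_expMeasure_pow,
      ENNReal.ofReal_mul (p := (c.τ ^ (-c.α) * c.pMT q.1 q.2) ^ i) (by positivity),
      ENNReal.ofReal_pow (by positivity)]
    ring
  rw [lintegral_congr_ae e, lintegral_const_mul _ (by fun_prop), mul_assoc]

end Params

/-! ### Differentiation of averages -/

lemma integrable_mul_comp {X : Type*} [MeasurableSpace X] {ν : Measure X} [IsFiniteMeasure ν]
    {A K : X → ℝ} (hA : Measurable A) (hK : Measurable K) {C κ₀ : ℝ} (hAC : ∀ᵐ q ∂ν, |A q| ≤ C)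
    (hKκ : ∀ᵐ q ∂ν, K q ∈ Icc 0 κ₀) {h : ℝ → ℝ} (hc : Continuous h) :
    Integrable (fun q => A q * h (K q)) ν := by
  obtain ⟨B, hB⟩ := isCompact_Icc.exists_bound_of_continuousOn (s := Icc 0 κ₀) hc.continuousOn
  refine Integrable.of_bound (hA.mul (hc.measurable.comp hK)).aestronglyMeasurable (C * B) ?_
  filter_upwards [hAC, hKκ] with q h1 h2
  rw [norm_mul]
  exact mul_le_mul h1 (hB _ h2) (norm_nonneg _) ((abs_nonneg _).trans h1)

/-- The dominating function is a constant: `A` is bounded, and `h'` is continuous on the compact set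
`[-δ, δ] × [0, κ₀]`. -/
lemma hasDerivAt_integral_mul_comp {X : Type*} [MeasurableSpace X] {ν : Measure X}
    [IsFiniteMeasure ν] {A K : X → ℝ} (hA : Measurable A) (hK : Measurable K) {C κ₀ δ : ℝ}
    (hAC : ∀ᵐ q ∂ν, |A q| ≤ C) (hKκ : ∀ᵐ q ∂ν, K q ∈ Icc 0 κ₀) {h h' : ℝ → ℝ → ℝ}
    (hc : Continuous (Function.uncurry h)) (hc' : Continuous (Function.uncurry h'))
    (hd : ∀ s ∈ Ioo (-δ) δ, ∀ κ ∈ Icc 0 κ₀, HasDerivAt (fun s => h s κ) (h' s κ) s)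
    {s : ℝ} (hs : s ∈ Ioo (-δ) δ) :
    HasDerivAt (fun s => ∫ q, A q * h s (K q) ∂ν) (∫ q, A q * h' s (K q) ∂ν) s := by
  obtain ⟨B, hB⟩ := (isCompact_Icc.prod isCompact_Icc).exists_bound_of_continuousOn
    (s := Icc (-δ) δ ×ˢ Icc 0 κ₀) hc'.continuousOn
  have hc1 (s : ℝ) : Continuous (h s) := hc.comp (by fun_prop : Continuous fun κ => (s, κ))
  have hc1' (s : ℝ) : Continuous (h' s) := hc'.comp (by fun_prop : Continuous fun κ => (s, κ))
  refine (hasDerivAt_integral_of_dominated_loc_of_deriv_le (s := Ioo (-δ) δ)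
    (F := fun s q => A q * h s (K q)) (F' := fun s q => A q * h' s (K q))
    (bound := fun _ => C * B) (Ioo_mem_nhds hs.1 hs.2)
    (Eventually.of_forall fun s => (integrable_mul_comp hA hK hAC hKκ (hc1 s)).aestronglyMeasurable)
    (integrable_mul_comp hA hK hAC hKκ (hc1 s))
    (integrable_mul_comp hA hK hAC hKκ (hc1' s)).aestronglyMeasurable ?_ (integrable_const _) ?_).2
  · filter_upwards [hAC, hKκ] with q h1 h2 x hx
    rw [norm_mul]
    exact mul_le_mul h1 (hB (x, K q) ⟨Ioo_subset_Icc_self hx, h2⟩) (norm_nonneg _)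
      ((abs_nonneg _).trans h1)
  · filter_upwards [hKκ] with q h2 x hx
    exact (hd x hx _ h2).const_mul _

/-! ### The hypergeometric function -/

section Hypergeometric

variable {b : ℝ} (hb : 0 < b)
include hb

/-- As `b > 0`, no parameter is zero or a negative integer, so the series neither terminates nor
degenerates and its radius is exactly one. -/
lemma hasFPowerSeriesOnBall_hypergeometric :
    HasFPowerSeriesOnBall (ordinaryHypergeometric 1 b (b + 1) : ℝ → ℝ)
      (ordinaryHypergeometricSeries ℝ 1 b (b + 1)) 0 1 := by
  have hr : (ordinaryHypergeometricSeries ℝ 1 b (b + 1)).radius = 1 := by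
    refine ordinaryHypergeometricSeries_radius_eq_one ℝ _ _ _ fun n => ⟨?_, ?_, ?_⟩ <;>
    · have : (0 : ℝ) ≤ n := n.cast_nonneg
      intro h
      linarith
  rw [← hr]
  exact FormalMultilinearSeries.hasFPowerSeriesOnBall _ (by rw [hr]; exact one_pos)

lemma deriv_hypergeometric_zero :
    deriv (ordinaryHypergeometric 1 b (b + 1) : ℝ → ℝ) 0 = b / (b + 1) := by
  rw [(hasFPowerSeriesOnBall_hypergeometric hb).hasFPowerSeriesAt.deriv,
    ordinaryHypergeometricSeries_apply_eq]
  simp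
  ring

lemma analyticOnNhd_hypergeometric :
    AnalyticOnNhd ℝ (ordinaryHypergeometric 1 b (b + 1) : ℝ → ℝ) (Ioo (-1) 1) := by
  have := (hasFPowerSeriesOnBall_hypergeometric hb).analyticOnNhd
  rw [← ENNReal.ofReal_one, Metric.eball_ofReal, Real.ball_eq_Ioo] at this
  simpa using this

end Hypergeometric

/-- Restriction of the argument to `[-1/2, 1/2]`. -/
def clamp (z : ℝ) : ℝ := max (-(1 / 2)) (min z (1 / 2))

lemma clamp_mem (z : ℝ) : clamp z ∈ Ioo (-1 : ℝ) 1 := by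
  have h1 : -(1 / 2) ≤ clamp z := le_max_left _ _
  have h2 : clamp z ≤ 1 / 2 := max_le (by norm_num) (min_le_right _ _)
  constructor <;> linarith

lemma continuous_clamp : Continuous clamp := by unfold clamp; fun_prop

lemma clamp_of_abs_le {z : ℝ} (h : |z| ≤ 1 / 2) : clamp z = z := by
  rw [abs_le] at h
  rw [clamp, min_eq_left h.2, max_eq_right h.1]

/-- Clamping makes functions on `(-1, 1)` globally continuous, as the differentiation lemma
requires, and leaves them unchanged for the arguments that occur, which lie in `[-1/2, 1/2]`. -/
lemma _root_.ContinuousOn.comp_clamp {f : ℝ → ℝ} (hf : ContinuousOn f (Ioo (-1) 1)) :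
    Continuous fun z => f (clamp z) :=
  hf.comp_continuous continuous_clamp clamp_mem

lemma hasDerivAt_comp_clamp {f : ℝ → ℝ} {f' z : ℝ} (hz : |z| < 1 / 2) (h : HasDerivAt f f' z) :
    HasDerivAt (fun z => f (clamp z)) f' z := by
  refine h.congr_of_eventuallyEq ?_
  filter_upwards [continuous_abs.continuousAt.eventually_lt continuousAt_const hz] with x hx
  rw [clamp_of_abs_le (le_of_lt hx)]

section Kernel

variable (f : ℝ → ℝ)

/-- `s f(-sκ)`, with the argument of `f` clamped. -/
def scaled (s κ : ℝ) : ℝ := s * f (clamp (-s * κ))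

/-- The first derivative of `scaled f s κ` with respect to `s`. -/
def scaledDeriv (s κ : ℝ) : ℝ := f (clamp (-s * κ)) - s * κ * deriv f (clamp (-s * κ))

/-- The second derivative of `scaled f s κ` with respect to `s`. -/
def scaledDerivTwo (s κ : ℝ) : ℝ :=
  -2 * κ * deriv f (clamp (-s * κ)) + s * κ ^ 2 * deriv (deriv f) (clamp (-s * κ))

variable {f} (hf : AnalyticOnNhd ℝ f (Ioo (-1) 1))
include hf

lemma continuous_comp_clamp_mul : Continuous fun p : ℝ × ℝ => f (clamp (-p.1 * p.2)) :=
  hf.continuousOn.comp_clamp.comp (by fun_prop : Continuous fun p : ℝ × ℝ => -p.1 * p.2)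

lemma continuous_scaled : Continuous (Function.uncurry (scaled f)) :=
  continuous_fst.mul (continuous_comp_clamp_mul hf)

lemma continuous_scaledDeriv : Continuous (Function.uncurry (scaledDeriv f)) :=
  (continuous_comp_clamp_mul hf).sub
    ((continuous_fst.mul continuous_snd).mul (continuous_comp_clamp_mul hf.deriv))

lemma continuous_scaledDerivTwo : Continuous (Function.uncurry (scaledDerivTwo f)) :=
  ((continuous_const.mul continuous_snd).mul (continuous_comp_clamp_mul hf.deriv)).add
    ((continuous_fst.mul (continuous_snd.pow 2)).mul (continuous_comp_clamp_mul hf.deriv.deriv))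

lemma hasDerivAt_clamp_mul {s κ : ℝ} (h : |-s * κ| < 1 / 2) :
    HasDerivAt (fun s => f (clamp (-s * κ))) (deriv f (clamp (-s * κ)) * -κ) s := by
  have h1 : HasDerivAt (fun s : ℝ => -s * κ) (-κ) s := by
    simpa using (hasDerivAt_id s).neg.mul_const κ
  rw [clamp_of_abs_le h.le]
  have hmem : -s * κ ∈ Ioo (-1 : ℝ) 1 := by
    rw [abs_lt] at h
    constructor <;> linarith
  exact HasDerivAt.comp (h₂ := fun z => f (clamp z)) s
    (hasDerivAt_comp_clamp h (hf _ hmem).differentiableAt.hasDerivAt) h1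

lemma hasDerivAt_scaled {s κ : ℝ} (h : |-s * κ| < 1 / 2) :
    HasDerivAt (fun s => scaled f s κ) (scaledDeriv f s κ) s := by
  refine ((hasDerivAt_id s).mul (hasDerivAt_clamp_mul hf h)).congr_deriv ?_
  simp only [id, scaledDeriv]
  ring

lemma hasDerivAt_scaledDeriv {s κ : ℝ} (h : |-s * κ| < 1 / 2) :
    HasDerivAt (fun s => scaledDeriv f s κ) (scaledDerivTwo f s κ) s := by
  refine ((hasDerivAt_clamp_mul hf h).sub (((hasDerivAt_id s).mul_const κ).mul
    (hasDerivAt_clamp_mul hf.deriv h))).congr_deriv ?_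
  simp only [id, scaledDerivTwo]
  ring

end Kernel

/-! ### Bounds -/

namespace Params

variable (c : Params) (j k : Fin 2)

/-- The mean interference, up to a factor, of the interferers with given distances. -/
def meanKernel (q : ℝ × ℝ) : ℝ :=
  c.τ ^ (-c.α) * c.pMT q.1 q.2 * c.minDist j k q.1 q.2 ^ (2 - c.α)

/-- The largest mean interference caused by an interferer with given distances. -/
def peakKernel (q : ℝ × ℝ) : ℝ :=
  c.τ ^ (-c.α) * c.pMT q.1 q.2 * c.minDist j k q.1 q.2 ^ (-c.α)

lemma measurable_meanKernel : Measurable (c.meanKernel j k) := by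
  have := c.measurable_pMT
  have := c.measurable_minDist j k
  unfold meanKernel; fun_prop

lemma measurable_peakKernel : Measurable (c.peakKernel j k) := by
  have := c.measurable_pMT
  have := c.measurable_minDist j k
  unfold peakKernel; fun_prop

variable {q : ℝ × ℝ} (hq : 0 < q.1 ∧ 0 < q.2)
include hq

/-- The second term of `minDist` is the distance at which the received power equals `i0`. This
bound, uniform in the marks, gives a common interval of `s`. -/
lemma peakKernel_mem : c.peakKernel j k q ∈ Icc 0 c.i0 := by
  have hp := c.pMT_pos hq.1 hq.2
  have hM := c.minDist_pos j k hq.1 q.2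
  have hτ := c.τ_pos
  have hi := c.i0_pos
  have hα := c.α_pos
  refine ⟨by unfold peakKernel; positivity, ?_⟩
  have hle : 1 / c.τ * (c.pMT q.1 q.2 / c.i0) ^ (1 / c.α) ≤ c.minDist j k q.1 q.2 :=
    le_max_right _ _
  have h := (c.power_le_iff hp hM).2 hle
  rw [Real.mul_rpow hτ.le hM.le] at h
  unfold peakKernel
  linarith

/-- Interpolation: with `a = τ^(-α) p`, one has `a M^(2-α) = (a M^(-α))^(1 - 2/α) a^(2/α)`. The
first base is at most `i0`, and `p ≤ pmax` bounds the second. -/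
lemma meanKernel_mem : c.meanKernel j k q ∈
    Icc 0 (c.i0 ^ (1 - 2 / c.α) * (c.τ ^ (-c.α) * c.pmax) ^ (2 / c.α)) := by
  have hp := c.pMT_pos hq.1 hq.2
  have hM := c.minDist_pos j k hq.1 q.2
  have hτ := c.τ_pos
  have hi := c.i0_pos
  have hα := c.α_pos
  refine ⟨by unfold meanKernel; positivity, ?_⟩
  have hs : 0 < c.τ ^ (-c.α) * c.pMT q.1 q.2 := by positivity
  have hK := c.peakKernel_mem j k hq
  have e : c.meanKernel j k q = c.peakKernel j k q ^ (1 - 2 / c.α) *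
      (c.τ ^ (-c.α) * c.pMT q.1 q.2) ^ (2 / c.α) := by
    unfold meanKernel peakKernel
    generalize c.τ ^ (-c.α) * c.pMT q.1 q.2 = s at hs
    rw [Real.mul_rpow hs.le (by positivity), mul_right_comm, ← Real.rpow_add hs,
      ← Real.rpow_mul hM.le]
    congr 2
    · simp
    · field_simp
      ring
  have h2 : (0 : ℝ) ≤ 1 - 2 / c.α := by
    rw [sub_nonneg, div_le_one hα]; exact c.two_lt_α.le
  have hpm : c.pMT q.1 q.2 ≤ c.pmax := min_le_right _ _
  rw [e]
  gcongr
  · exact hK.1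
  · exact hK.2

end Params

/-! ### The derivatives of the exponent -/

namespace Params

variable (c : Params)

/-- The hypergeometric function that enters `chi`. -/
def hyp : ℝ → ℝ := ordinaryHypergeometric (1 : ℝ) ((c.α - 2) / c.α) ((c.α - 2) / c.α + 1)

lemma hyp_param_pos : 0 < (c.α - 2) / c.α := div_pos (sub_pos.2 c.two_lt_α) c.α_pos

lemma analyticOnNhd_hyp : AnalyticOnNhd ℝ c.hyp (Ioo (-1) 1) :=
  analyticOnNhd_hypergeometric c.hyp_param_pos

/-- The radius of an interval on which the argument of the hypergeometric function is small. -/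
def radius : ℝ := 1 / (2 * c.i0)

lemma radius_pos : 0 < c.radius := by
  have := c.i0_pos
  unfold radius; positivity

lemma abs_mul_lt {s κ : ℝ} (hs : s ∈ Ioo (-c.radius) c.radius) (hκ : κ ∈ Icc 0 c.i0) :
    |-s * κ| < 1 / 2 := by
  have hi := c.i0_pos
  have h1 : |s| < c.radius := abs_lt.2 hs
  rw [abs_mul, abs_neg, abs_of_nonneg hκ.1]
  calc |s| * κ ≤ |s| * c.i0 := by gcongr; exact hκ.2
    _ < c.radius * c.i0 := by gcongr
    _ = 1 / 2 := by unfold radius; field_simp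

/-- For small `s` only the series branch of `gaussHypergeometric` is used. With `b = (α - 2) / α`
its third parameter is `b + 1`. -/
lemma chi_eq (j k : Fin 2) {s : ℝ} (hs : s ∈ Ioo (-c.radius) c.radius) {q : ℝ × ℝ}
    (hq : 0 < q.1 ∧ 0 < q.2) : c.chi j k s q.1 q.2 =
      c.meanKernel j k q / (c.α - 2) * scaled c.hyp s (c.peakKernel j k q) := by
  have hlt := c.abs_mul_lt hs (c.peakKernel_mem j k hq)
  have hz : -s * c.pMT q.1 q.2 * c.τ ^ (-c.α) * c.minDist j k q.1 q.2 ^ (-c.α) =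
      -s * c.peakKernel j k q := by unfold peakKernel; ring
  have hc : 2 - 2 / c.α = (c.α - 2) / c.α + 1 := by
    have := c.α_pos.ne'
    field_simp
    ring
  unfold chi
  rw [hz, gaussHypergeometric, if_pos (hlt.trans (by norm_num)), scaled, clamp_of_abs_le hlt.le, hc,
    hyp, meanKernel]
  ring

end Params

lemma zero_mem_radius (c : Params) : (0 : ℝ) ∈ Ioo (-c.radius) c.radius :=
  ⟨neg_lt_zero.2 c.radius_pos, c.radius_pos⟩

lemma clamp_zero : clamp 0 = 0 := clamp_of_abs_le (by norm_num)

lemma scaledDeriv_hyp_zero (c : Params) : scaledDeriv c.hyp 0 = fun _ => 1 := by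
  ext κ
  simp [scaledDeriv, clamp_zero, Params.hyp]

/-- At `s = 0` only `-2κ F'(0)` survives, with `F'(0) = b / (b + 1) = (α - 2) / (2(α - 1))`. -/
lemma scaledDerivTwo_hyp_zero (c : Params) :
    scaledDerivTwo c.hyp 0 = fun κ => -((c.α - 2) / (c.α - 1)) * κ := by
  ext κ
  have hα := c.two_lt_α
  have h1 : c.α - 1 ≠ 0 := by linarith
  have h2 : (c.α - 2) / c.α + 1 ≠ 0 := by have := c.hyp_param_pos; positivity
  have h3 := c.α_pos.ne'
  have h := deriv_hypergeometric_zero c.hyp_param_pos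
  have h4 : (c.α - 2) / c.α / ((c.α - 2) / c.α + 1) = (c.α - 2) / (2 * (c.α - 1)) := by
    rw [div_div]
    congr 1
    field_simp
    ring
  rw [h4] at h
  simp only [scaledDerivTwo, Params.hyp, neg_zero, zero_mul, clamp_zero, add_zero, h]
  field_simp

section Beta

variable {Ω : Type*} [MeasurableSpace Ω] {P : Measure Ω} [IsProbabilityMeasure P] {c : Params}
  {Φ : Fin 2 → Ω → Set Plane}

variable (P c Φ) in
/-- The average over interferers of a function of the peak interference, weighted by the mean
interference. -/
def kernelAverage (j : Fin 2) (h : ℝ → ℝ) : ℝ :=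
  -∑ k, 2 * Real.pi * c.lam k *
    ∫ q, c.meanKernel j k q / (c.α - 2) * h (c.peakKernel j k q) ∂distLaw P c Φ k

variable (hΦ : ∀ j, IsPoissonProcess P (ENNReal.ofReal (c.lam j) • volume) (Φ j))
include hΦ

lemma ae_abs_meanKernel_le (j k : Fin 2) : ∀ᵐ q ∂distLaw P c Φ k,
    |c.meanKernel j k q / (c.α - 2)| ≤
      c.i0 ^ (1 - 2 / c.α) * (c.τ ^ (-c.α) * c.pmax) ^ (2 / c.α) / (c.α - 2) := by
  have hα : 0 < c.α - 2 := sub_pos.2 c.two_lt_α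
  filter_upwards [ae_distLaw_pos hΦ k] with q hq
  have h := c.meanKernel_mem j k hq
  rw [abs_div, abs_of_nonneg h.1, abs_of_pos hα]
  gcongr
  exact h.2

lemma ae_peakKernel_mem (j k : Fin 2) :
    ∀ᵐ q ∂distLaw P c Φ k, c.peakKernel j k q ∈ Icc 0 c.i0 :=
  (ae_distLaw_pos hΦ k).mono fun _ hq => c.peakKernel_mem j k hq

lemma integrable_kernel (j k : Fin 2) {h : ℝ → ℝ} (hh : Continuous h) :
    Integrable (fun q => c.meanKernel j k q / (c.α - 2) * h (c.peakKernel j k q))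
      (distLaw P c Φ k) :=
  integrable_mul_comp ((c.measurable_meanKernel j k).div_const _) (c.measurable_peakKernel j k)
    (ae_abs_meanKernel_le hΦ j k) (ae_peakKernel_mem hΦ j k) hh

lemma hasDerivAt_kernelAverage (j : Fin 2) {h h' : ℝ → ℝ → ℝ}
    (hc : Continuous (Function.uncurry h)) (hc' : Continuous (Function.uncurry h'))
    (hd : ∀ s κ, |-s * κ| < 1 / 2 → HasDerivAt (fun s => h s κ) (h' s κ) s)
    {s : ℝ} (hs : s ∈ Ioo (-c.radius) c.radius) :
    HasDerivAt (fun s => kernelAverage P c Φ j (h s)) (kernelAverage P c Φ j (h' s)) s := by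
  unfold kernelAverage
  refine HasDerivAt.neg (HasDerivAt.fun_sum fun k _ => HasDerivAt.const_mul _ ?_)
  exact hasDerivAt_integral_mul_comp ((c.measurable_meanKernel j k).div_const _)
    (c.measurable_peakKernel j k) (ae_abs_meanKernel_le hΦ j k) (ae_peakKernel_mem hΦ j k) hc hc'
    (fun s hs κ hκ => hd s κ (c.abs_mul_lt hs hκ)) hs

variable (hi : Indep (countAlgebra (Φ 0)) (countAlgebra (Φ 1)) P)
include hi

/-- Agreement at positive distances is enough, since the marks are almost surely positive;
integrability comes from the bounds on the two kernels. -/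
lemma averaged_eq_kernelAverage (j : Fin 2) {g : Fin 2 → ℝ → ℝ → ℝ} {h : ℝ → ℝ} (hh : Continuous h)
    (hg : ∀ k (q : ℝ × ℝ), 0 < q.1 ∧ 0 < q.2 →
      g k q.1 q.2 = c.meanKernel j k q / (c.α - 2) * h (c.peakKernel j k q)) :
    averaged P c Φ g = kernelAverage P c Φ j h := by
  have hae (k : Fin 2) : (fun q : ℝ × ℝ => g k q.1 q.2) =ᵐ[distLaw P c Φ k]
      fun q => c.meanKernel j k q / (c.α - 2) * h (c.peakKernel j k q) :=
    (ae_distLaw_pos hΦ k).mono fun q hq => hg k q hq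
  rw [averaged_eq hΦ hi fun k => (integrable_kernel hΦ j k hh).congr (hae k).symm, kernelAverage]
  simp_rw [integral_congr_ae (hae _)]

lemma beta_eq (j : Fin 2) {s : ℝ} (hs : s ∈ Ioo (-c.radius) c.radius) :
    beta P c Φ j s = kernelAverage P c Φ j (scaled c.hyp s) :=
  averaged_eq_kernelAverage hΦ hi j
    ((continuous_scaled c.analyticOnNhd_hyp).comp (by fun_prop : Continuous fun κ => (s, κ)))
    fun k _ hq => c.chi_eq j k hs hq

/-- Stated on a whole interval, so that `deriv β` is identified near `0` and can be differentiated
again. -/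
lemma hasDerivAt_beta (j : Fin 2) {s : ℝ} (hs : s ∈ Ioo (-c.radius) c.radius) :
    HasDerivAt (beta P c Φ j) (kernelAverage P c Φ j (scaledDeriv c.hyp s)) s := by
  refine (hasDerivAt_kernelAverage hΦ j (continuous_scaled c.analyticOnNhd_hyp)
    (continuous_scaledDeriv c.analyticOnNhd_hyp)
    (fun s κ h => hasDerivAt_scaled c.analyticOnNhd_hyp h) hs).congr_of_eventuallyEq ?_
  filter_upwards [Ioo_mem_nhds hs.1 hs.2] with x hx using beta_eq hΦ hi j hx

lemma hasDerivAt_deriv_beta (j : Fin 2) {s : ℝ} (hs : s ∈ Ioo (-c.radius) c.radius) :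
    HasDerivAt (deriv (beta P c Φ j)) (kernelAverage P c Φ j (scaledDerivTwo c.hyp s)) s := by
  refine (hasDerivAt_kernelAverage hΦ j (continuous_scaledDeriv c.analyticOnNhd_hyp)
    (continuous_scaledDerivTwo c.analyticOnNhd_hyp)
    (fun s κ h => hasDerivAt_scaledDeriv c.analyticOnNhd_hyp h) hs).congr_of_eventuallyEq ?_
  filter_upwards [Ioo_mem_nhds hs.1 hs.2] with x hx using (hasDerivAt_beta hΦ hi j hx).deriv

lemma averaged_first (j : Fin 2) : averaged P c Φ (fun k r u =>
      c.τ ^ (-c.α) * c.pMT r u / (c.α - 2) * c.minDist j k r u ^ (2 - c.α)) =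
    kernelAverage P c Φ j fun _ => 1 :=
  averaged_eq_kernelAverage hΦ hi j continuous_const fun k q _ => by
    unfold Params.meanKernel; ring

lemma averaged_second (j : Fin 2) : averaged P c Φ (fun k r u =>
      (c.τ ^ (-c.α) * c.pMT r u) ^ 2 / (1 - c.α) * c.minDist j k r u ^ (2 * (1 - c.α))) =
    kernelAverage P c Φ j fun κ => -((c.α - 2) / (c.α - 1)) * κ :=
  averaged_eq_kernelAverage hΦ hi j (by fun_prop) fun k q hq => by
    have hM := c.minDist_pos j k hq.1 q.2
    have hα := c.two_lt_α
    have h1 : c.α - 1 ≠ 0 := by linarith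
    have h2 : c.α - 2 ≠ 0 := by linarith
    have h3 : 1 - c.α ≠ 0 := by linarith
    have e : (2 : ℝ) * (1 - c.α) = (2 - c.α) + -c.α := by ring
    rw [e, Real.rpow_add hM, Params.meanKernel, Params.peakKernel,
      show 1 - c.α = -(c.α - 1) by ring]
    field_simp

end Beta

/-! ### Moments of the interference -/

/-- The intensity measure of the interferers of tier `k`. -/
def intensity {Ω : Type*} [MeasurableSpace Ω] (P : Measure Ω) (c : Params)
    (Φ : Fin 2 → Ω → Set Plane) (k : Fin 2) : Measure Interferer :=
  (ENNReal.ofReal (c.lam k) • (volume : Measure Plane)).prod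
    ((distLaw P c Φ k).prod (expMeasure 1))

instance {Ω : Type*} [MeasurableSpace Ω] (P : Measure Ω) [IsProbabilityMeasure P] (c : Params)
    (Φ : Fin 2 → Ω → Set Plane) (k : Fin 2) : SigmaFinite (intensity P c Φ k) := by
  have := isProbabilityMeasure_expMeasure one_pos
  have : SigmaFinite (ENNReal.ofReal (c.lam k) • (volume : Measure Plane)) :=
    inferInstanceAs (SigmaFinite ((c.lam k).toNNReal • (volume : Measure Plane)))
  unfold intensity
  infer_instance

lemma kernelAverage_neg {Ω : Type*} [MeasurableSpace Ω] (P : Measure Ω) (c : Params)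
    (Φ : Fin 2 → Ω → Set Plane) (j : Fin 2) (h : ℝ → ℝ) :
    kernelAverage P c Φ j (fun κ => -h κ) = -kernelAverage P c Φ j h := by
  simp [kernelAverage, mul_neg, integral_neg]

section ContributionMoments

variable {Ω : Type*} [MeasurableSpace Ω] {P : Measure Ω} [IsProbabilityMeasure P] {c : Params}
  {Φ : Fin 2 → Ω → Set Plane}
  (hΦ : ∀ j, IsPoissonProcess P (ENNReal.ofReal (c.lam j) • volume) (Φ j))
include hΦ

lemma kernelAverage_nonpos (j : Fin 2) {h : ℝ → ℝ} (hh : ∀ κ ∈ Icc 0 c.i0, 0 ≤ h κ) :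
    kernelAverage P c Φ j h ≤ 0 := by
  refine neg_nonpos.2 (Finset.sum_nonneg fun k _ => mul_nonneg ?_ (integral_nonneg_of_ae ?_))
  · have := c.lam_pos k
    positivity
  · filter_upwards [ae_distLaw_pos hΦ k] with q hq
    exact mul_nonneg (div_nonneg (c.meanKernel_mem j k hq).1 (sub_pos.2 c.two_lt_α).le)
      (hh _ (c.peakKernel_mem j k hq))

/-- The bridge between moments and derivatives: `he` casts the `i`-th moment, fading included, in
the form `meanKernel · h(peakKernel)` in which the derivatives of `β` appear. -/
lemma sum_lintegral_contribution_pow (j : Fin 2) (b : Plane) {i : ℕ} (hi : i ≠ 0) {h : ℝ → ℝ}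
    (hc : Continuous h) (hh : ∀ κ ∈ Icc 0 c.i0, 0 ≤ h κ)
    (he : ∀ k (q : ℝ × ℝ), 0 < q.1 ∧ 0 < q.2 →
      i.factorial * ((c.τ ^ (-c.α) * c.pMT q.1 q.2) ^ i *
        (2 * Real.pi * (c.minDist j k q.1 q.2 ^ (2 - i * c.α) / (i * c.α - 2)))) =
      2 * Real.pi * (c.meanKernel j k q / (c.α - 2) * h (c.peakKernel j k q))) :
    ∑ k, ∫⁻ p, c.contribution j k b p ^ i ∂intensity P c Φ k =
      ENNReal.ofReal (-kernelAverage P c Φ j h) := by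
  have hnn (k : Fin 2) : ∀ᵐ q ∂distLaw P c Φ k,
      0 ≤ c.meanKernel j k q / (c.α - 2) * h (c.peakKernel j k q) := by
    filter_upwards [ae_distLaw_pos hΦ k] with q hq
    exact mul_nonneg (div_nonneg (c.meanKernel_mem j k hq).1 (sub_pos.2 c.two_lt_α).le)
      (hh _ (c.peakKernel_mem j k hq))
  rw [kernelAverage, neg_neg, ENNReal.ofReal_sum_of_nonneg]
  · refine Finset.sum_congr rfl fun k _ => ?_
    have hl := c.lam_pos k
    have hmp := c.measurable_pMT
    have hmM := c.measurable_minDist j k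
    rw [intensity, c.lintegral_contribution_pow (ae_distLaw_pos hΦ k) j k b hi,
      ← lintegral_const_mul _ (by fun_prop)]
    have e : ∀ᵐ q ∂distLaw P c Φ k, (i.factorial : ℝ≥0∞) * ENNReal.ofReal
        ((c.τ ^ (-c.α) * c.pMT q.1 q.2) ^ i *
          (2 * Real.pi * (c.minDist j k q.1 q.2 ^ (2 - i * c.α) / (i * c.α - 2)))) =
        ENNReal.ofReal (2 * Real.pi) *
          ENNReal.ofReal (c.meanKernel j k q / (c.α - 2) * h (c.peakKernel j k q)) := by
      filter_upwards [ae_distLaw_pos hΦ k] with q hq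
      rw [← ENNReal.ofReal_natCast, ← ENNReal.ofReal_mul (by positivity), he k q hq,
        ENNReal.ofReal_mul (by positivity)]
    have hm : Measurable fun q => c.meanKernel j k q / (c.α - 2) * h (c.peakKernel j k q) :=
      ((c.measurable_meanKernel j k).div_const _).mul
        (hc.measurable.comp (c.measurable_peakKernel j k))
    rw [lintegral_congr_ae e, lintegral_const_mul _ hm.ennreal_ofReal,
      ← ofReal_integral_eq_lintegral_ofReal (integrable_kernel hΦ j k hc) (hnn k), ← mul_assoc,
      ← ENNReal.ofReal_mul hl.le, ← ENNReal.ofReal_mul (by positivity)]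
    congr 1
    ring
  · intro k _
    have := c.lam_pos k
    exact mul_nonneg (by positivity) (integral_nonneg_of_ae (hnn k))

lemma sum_lintegral_contribution (j : Fin 2) (b : Plane) :
    ∑ k, ∫⁻ p, c.contribution j k b p ∂intensity P c Φ k =
      ENNReal.ofReal (-kernelAverage P c Φ j fun _ => 1) := by
  rw [← sum_lintegral_contribution_pow hΦ j b one_ne_zero continuous_const
    (fun _ _ => zero_le_one)]
  · simp
  · intro k q _
    simp only [Nat.factorial_one, Nat.cast_one, one_mul, pow_one, Params.meanKernel]
    ring

/-- The second moment `2` of the fading cancels the `2` in `2α - 2`, and `M^(2-2α)` splits as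
`M^(2-α) M^(-α)`. -/
lemma sum_lintegral_contribution_sq (j : Fin 2) (b : Plane) :
    ∑ k, ∫⁻ p, c.contribution j k b p ^ 2 ∂intensity P c Φ k =
      ENNReal.ofReal (kernelAverage P c Φ j fun κ => -((c.α - 2) / (c.α - 1)) * κ) := by
  have hα := c.two_lt_α
  have h1 : 0 < c.α - 1 := by linarith
  have h2 : 0 < c.α - 2 := by linarith
  simp_rw [neg_mul]
  rw [kernelAverage_neg]
  refine sum_lintegral_contribution_pow hΦ j b two_ne_zero (by fun_prop)
    (fun κ hκ => mul_nonneg (by positivity) hκ.1) fun k q hq => ?_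
  have hM := c.minDist_pos j k hq.1 q.2
  have e : (2 : ℝ) - (2 : ℕ) * c.α = (2 - c.α) + -c.α := by push_cast; ring
  have e2 : ((2 : ℕ) : ℝ) * c.α - 2 = 2 * (c.α - 1) := by push_cast; ring
  rw [e, e2, Real.rpow_add hM, Params.meanKernel, Params.peakKernel]
  simp only [Nat.factorial_two, Nat.cast_ofNat]
  field_simp

end ContributionMoments

lemma IsNetwork.isPoissonProcess_interferers {Ω : Type*} [MeasurableSpace Ω] {P : Measure Ω}
    {c : Params} {Φ : Fin 2 → Ω → Set Plane} {B : Ω → Plane} {Ψ : Fin 2 → Ω → Set Interferer}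
    (hN : IsNetwork P c Φ B Ψ) (k : Fin 2) :
    IsPoissonProcess P (intensity P c Φ k) (Ψ k) := hN.poisson_interferers k

/-- This pair is the variable to be frozen: the association event must be carried along with `B`,
since both depend on the base stations. -/
lemma measurable_probe_indicator_assoc {Ω : Type*} (c : Params) (Φ : Fin 2 → Ω → Set Plane)
    (B : Ω → Plane) (j : Fin 2) :
    Measurable[countAlgebra (Φ 0) ⊔ countAlgebra (Φ 1) ⊔ MeasurableSpace.comap B inferInstance]
      fun ω => (B ω, (assoc c Φ j).indicator (1 : Ω → ℝ≥0∞) ω) := by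
  let := countAlgebra (Φ 0) ⊔ countAlgebra (Φ 1) ⊔ MeasurableSpace.comap B inferInstance
  have h : MeasurableSet (assoc c Φ j) :=
    (le_sup_left : countAlgebra (Φ 0) ⊔ countAlgebra (Φ 1) ≤ this) _ (measurableSet_assoc j)
  exact ((comap_measurable B).mono le_sup_right le_rfl).prodMk (measurable_one.indicator h)

section Interference

variable {Ω : Type*} {c : Params} {Φ : Fin 2 → Ω → Set Plane} {B : Ω → Plane}
  {Ψ : Fin 2 → Ω → Set Interferer}

lemma interference_eq (ω : Ω) : interference c Φ B Ψ ω = ∑ j, (assoc c Φ j).indicator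
    (fun ω => ∑ k, ∫⁻ p, c.contribution j k (B ω) p ∂countMeasure (Ψ k ω)) ω := by
  simp only [interference, lintegral_countMeasure _ (c.measurable_contribution_right _ _ _)]

/-- The association events are disjoint, so powers have no cross terms. Off both events the
interference is `0`, whence `i ≠ 0`. -/
lemma interference_pow (ω : Ω) {i : ℕ} (hi : i ≠ 0) : interference c Φ B Ψ ω ^ i =
    ∑ j, (assoc c Φ j).indicator 1 ω *
      (∑ k, ∫⁻ p, c.contribution j k (B ω) p ∂countMeasure (Ψ k ω)) ^ i := by
  have e (j : Fin 2) : (assoc c Φ j).indicator 1 ω *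
      (∑ k, ∫⁻ p, c.contribution j k (B ω) p ∂countMeasure (Ψ k ω)) ^ i =
      (assoc c Φ j).indicator (fun ω =>
        (∑ k, ∫⁻ p, c.contribution j k (B ω) p ∂countMeasure (Ψ k ω)) ^ i) ω := by
    by_cases h : ω ∈ assoc c Φ j <;> simp [h]
  simp_rw [e]
  rw [interference_eq]
  by_cases h : ∃ j, ω ∈ assoc c Φ j
  · obtain ⟨j, h⟩ := h
    rw [sum_indicator_assoc h fun j ω =>
        ∑ k, ∫⁻ p, c.contribution j k (B ω) p ∂countMeasure (Ψ k ω),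
      sum_indicator_assoc h fun j ω =>
        (∑ k, ∫⁻ p, c.contribution j k (B ω) p ∂countMeasure (Ψ k ω)) ^ i]
  · push Not at h
    simp [h, hi]

variable [MeasurableSpace Ω] {P : Measure Ω} [IsProbabilityMeasure P] (hN : IsNetwork P c Φ B Ψ)
include hN

lemma IsNetwork.aemeasurable_interference : AEMeasurable (interference c Φ B Ψ) P := by
  have ha (j : Fin 2) := countAlgebra_sup_le hN.poisson_bs _ (measurableSet_assoc (c := c) (Φ := Φ) j)
  have : interference c Φ B Ψ = fun ω => ∑ j, (assoc c Φ j).indicator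
    (fun ω => ∑ k, ∫⁻ p, c.contribution j k (B ω) p ∂countMeasure (Ψ k ω)) ω :=
    funext interference_eq
  rw [this]
  refine Finset.aemeasurable_fun_sum _ fun j _ => AEMeasurable.indicator ?_ (ha j)
  exact Finset.aemeasurable_fun_sum _ fun k _ =>
    (hN.isPoissonProcess_interferers k).aemeasurable_lintegral_comp hN.measurable_probe
      (c.measurable_contribution j k)

/-- After freezing the probe location, the inner moment is `m j` for every `b`; it leaves the
integral, and only the probability of association remains. -/
lemma IsNetwork.lintegral_interference_pow {i : ℕ} (hi : i ≠ 0) {m : Fin 2 → ℝ≥0∞}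
    (hm : ∀ j b, ∫⁻ ω, (∑ k, ∫⁻ p, c.contribution j k b p ∂countMeasure (Ψ k ω)) ^ i ∂P = m j) :
    ∫⁻ ω, interference c Φ B Ψ ω ^ i ∂P = ∑ j, P (assoc c Φ j) * m j := by
  have hle := countAlgebra_sup_le hN.poisson_bs
  have ha (j : Fin 2) := hle _ (measurableSet_assoc (c := c) (Φ := Φ) j)
  have hS (j : Fin 2) : AEMeasurable (fun ω =>
      ∑ k, ∫⁻ p, c.contribution j k (B ω) p ∂countMeasure (Ψ k ω)) P :=
    Finset.aemeasurable_fun_sum _ fun k _ =>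
      (hN.isPoissonProcess_interferers k).aemeasurable_lintegral_comp hN.measurable_probe
        (c.measurable_contribution j k)
  simp_rw [interference_pow _ hi]
  have hprod (j : Fin 2) : AEMeasurable (fun ω => (assoc c Φ j).indicator 1 ω *
      (∑ k, ∫⁻ p, c.contribution j k (B ω) p ∂countMeasure (Ψ k ω)) ^ i) P :=
    (measurable_one.indicator (ha j)).aemeasurable.mul ((hS j).pow_const i)
  rw [lintegral_finsetSum' _ fun j _ => hprod j]
  refine Finset.sum_congr rfl fun j _ => ?_
  have hf (k : Fin 2) : Measurable fun z : (Plane × ℝ≥0∞) × Interferer =>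
      c.contribution j k z.1.1 z.2 :=
    Measurable.comp (g := fun z : Plane × Interferer => c.contribution j k z.1 z.2)
      (f := fun z : (Plane × ℝ≥0∞) × Interferer => (z.1.1, z.2))
      (c.measurable_contribution j k) (by fun_prop)
  have h := lintegral_comp_sum_countMeasure (P := P)
    (fun k => hN.isPoissonProcess_interferers k) (sup_le hle hN.measurable_probe.comap_le)
    hN.indep_interferers (measurable_probe_indicator_assoc c Φ B j) (f := fun k z =>
      c.contribution j k z.1.1 z.2) hf (g := fun z => z.1.2 * z.2 ^ i) (by fun_prop)
  refine h.trans ?_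
  have hpow (b : Plane) : Measurable fun ω =>
      (∑ k, ∫⁻ p, c.contribution j k b p ∂countMeasure (Ψ k ω)) ^ i :=
    (Finset.measurable_fun_sum _ fun k _ =>
      (hN.isPoissonProcess_interferers k).measurable_lintegral_countMeasure
        (c.measurable_contribution_right j k b)).pow_const i
  have e (ω : Ω) : ∫⁻ ω', (assoc c Φ j).indicator 1 ω * (∑ k, ∫⁻ p, c.contribution j k (B ω) p
      ∂countMeasure (Ψ k ω')) ^ i ∂P = (assoc c Φ j).indicator 1 ω * m j := by
    rw [lintegral_const_mul _ (hpow _), hm]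
  refine (lintegral_congr e).trans ?_
  rw [lintegral_mul_const _ (measurable_one.indicator (ha j)), lintegral_indicator_one (ha j)]

lemma IsNetwork.lintegral_interference : ∫⁻ ω, interference c Φ B Ψ ω ∂P =
    ∑ j, P (assoc c Φ j) * ENNReal.ofReal (-kernelAverage P c Φ j fun _ => 1) := by
  have := hN.lintegral_interference_pow one_ne_zero (m := fun j =>
    ENNReal.ofReal (-kernelAverage P c Φ j fun _ => 1)) fun j b => by
      simp only [pow_one]
      rw [lintegral_sum_countMeasure (fun k => hN.isPoissonProcess_interferers k)
        fun k => c.measurable_contribution_right j k b]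
      exact sum_lintegral_contribution hN.poisson_bs j b
  simpa only [pow_one] using this

lemma IsNetwork.lintegral_interference_sq : ∫⁻ ω, interference c Φ B Ψ ω ^ 2 ∂P =
    ∑ j, P (assoc c Φ j) * (ENNReal.ofReal (-kernelAverage P c Φ j fun _ => 1) ^ 2 +
      ENNReal.ofReal (kernelAverage P c Φ j fun κ => -((c.α - 2) / (c.α - 1)) * κ)) := by
  refine hN.lintegral_interference_pow two_ne_zero fun j b => ?_
  rw [lintegral_sum_countMeasure_sq (fun k => hN.isPoissonProcess_interferers k)
    (hN.indep_interferers.indep (i := 1) (j := 2) (by decide))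
    fun k => c.measurable_contribution_right j k b]
  exact congrArg₂ (· + ·) (congrArg (· ^ 2) (sum_lintegral_contribution hN.poisson_bs j b))
    (sum_lintegral_contribution_sq hN.poisson_bs j b)

end Interference

end Uplink

end

/-! ### Mean, variance and derivatives at the origin -/

theorem mainTheorem4 {Ω : Type*} [MeasurableSpace Ω] (P : Measure Ω) [IsProbabilityMeasure P]
    (c : Uplink.Params) (Φ : Fin 2 → Ω → Set Uplink.Plane) (B : Ω → Uplink.Plane)
    (Ψ : Fin 2 → Ω → Set Uplink.Interferer) (hmodel : Uplink.IsNetwork P c Φ B Ψ) :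
    -- the density that enters the formulas below is the conditional joint density of distances
    (∀ k n, (P[|Uplink.assocInterf c Φ k n]).map
        (fun ω => (Uplink.servDist c Φ ω, Uplink.interfDist c Φ ω)) =
      (volume : Measure (ℝ × ℝ)).withDensity
        fun q => ENNReal.ofReal (Uplink.jointPdf P c Φ k n q.1 q.2)) ∧
    -- the interference is almost surely finite and square integrable
    (∀ᵐ ω ∂P, Uplink.interference c Φ B Ψ ω ≠ ∞) ∧
    MemLp (fun ω => (Uplink.interference c Φ B Ψ ω).toReal) 2 P ∧
    -- mean
    (∫ ω, (Uplink.interference c Φ B Ψ ω).toReal ∂P =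
      -∑ j, P.real (Uplink.assoc c Φ j) * deriv (Uplink.beta P c Φ j) 0) ∧
    -- variance
    (variance (fun ω => (Uplink.interference c Φ B Ψ ω).toReal) P =
      ∑ j, P.real (Uplink.assoc c Φ j) *
        (deriv (deriv (Uplink.beta P c Φ j)) 0 + (deriv (Uplink.beta P c Φ j) 0) ^ 2 -
          (∫ ω, (Uplink.interference c Φ B Ψ ω).toReal ∂P) ^ 2)) ∧
    -- first and second derivative at the origin
    (∀ j, (∀ᶠ s in 𝓝 (0 : ℝ), DifferentiableAt ℝ (Uplink.beta P c Φ j) s) ∧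
      HasDerivAt (Uplink.beta P c Φ j)
        (Uplink.averaged P c Φ fun k r u =>
          c.τ ^ (-c.α) * c.pMT r u / (c.α - 2) * c.minDist j k r u ^ (2 - c.α)) 0 ∧
      HasDerivAt (deriv (Uplink.beta P c Φ j))
        (Uplink.averaged P c Φ fun k r u =>
          (c.τ ^ (-c.α) * c.pMT r u) ^ 2 / (1 - c.α) *
            c.minDist j k r u ^ (2 * (1 - c.α))) 0) := by
  have hΦ := hmodel.poisson_bs
  have hi := hmodel.indep_bs
  have h0 := Uplink.zero_mem_radius c
  have hd1 (j : Fin 2) := Uplink.hasDerivAt_beta hΦ hi j h0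
  have hd2 (j : Fin 2) := Uplink.hasDerivAt_deriv_beta hΦ hi j h0
  -- From here on the derivatives at `0` are the same kernel averages that occur in the moments of
  -- `I`.
  simp only [Uplink.scaledDeriv_hyp_zero, Uplink.scaledDerivTwo_hyp_zero] at hd1 hd2
  have hm := hmodel.aemeasurable_interference
  have hI1 := hmodel.lintegral_interference
  have hI2 := hmodel.lintegral_interference_sq
  have hk1 (j : Fin 2) : Uplink.kernelAverage P c Φ j (fun _ => 1) ≤ 0 :=
    Uplink.kernelAverage_nonpos hΦ j fun _ _ => zero_le_one
  have hk2 (j : Fin 2) :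
      0 ≤ Uplink.kernelAverage P c Φ j (fun κ => -((c.α - 2) / (c.α - 1)) * κ) := by
    simp_rw [neg_mul]
    rw [Uplink.kernelAverage_neg, neg_nonneg]
    have h2 := c.two_lt_α
    exact Uplink.kernelAverage_nonpos hΦ j fun κ hκ =>
      mul_nonneg (div_nonneg (by linarith) (by linarith)) hκ.1
  have hfin1 : ∫⁻ ω, Uplink.interference c Φ B Ψ ω ∂P ≠ ∞ := by
    rw [hI1]
    exact ENNReal.sum_ne_top.2 fun j _ =>
      ENNReal.mul_ne_top (measure_ne_top _ _) ENNReal.ofReal_ne_top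
  have hfin2 : ∫⁻ ω, Uplink.interference c Φ B Ψ ω ^ 2 ∂P ≠ ∞ := by
    rw [hI2]
    exact ENNReal.sum_ne_top.2 fun j _ => ENNReal.mul_ne_top (measure_ne_top _ _)
      (ENNReal.add_ne_top.2 ⟨ENNReal.pow_ne_top ENNReal.ofReal_ne_top, ENNReal.ofReal_ne_top⟩)
  have hae : ∀ᵐ ω ∂P, Uplink.interference c Φ B Ψ ω < ∞ := ae_lt_top' hm hfin1
  have hmR : AEStronglyMeasurable (fun ω => (Uplink.interference c Φ B Ψ ω).toReal) P :=
    hm.ennreal_toReal.aestronglyMeasurable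
  have hL2 : MemLp (fun ω => (Uplink.interference c Φ B Ψ ω).toReal) 2 P := by
    rw [memLp_two_iff_integrable_sq hmR]
    simp_rw [← ENNReal.toReal_pow]
    exact integrable_toReal_of_lintegral_ne_top (hm.pow_const 2) hfin2
  have hmean : ∫ ω, (Uplink.interference c Φ B Ψ ω).toReal ∂P =
      ∑ j, P.real (Uplink.assoc c Φ j) * -Uplink.kernelAverage P c Φ j (fun _ => 1) := by
    rw [integral_toReal hm hae, hI1, ENNReal.toReal_sum fun j _ =>
      ENNReal.mul_ne_top (measure_ne_top _ _) ENNReal.ofReal_ne_top]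
    refine Finset.sum_congr rfl fun j _ => ?_
    rw [ENNReal.toReal_mul, ENNReal.toReal_ofReal (neg_nonneg.2 (hk1 j)), measureReal_def]
  have hsq : ∫ ω, (Uplink.interference c Φ B Ψ ω).toReal ^ 2 ∂P =
      ∑ j, P.real (Uplink.assoc c Φ j) * (Uplink.kernelAverage P c Φ j (fun _ => 1) ^ 2 +
        Uplink.kernelAverage P c Φ j (fun κ => -((c.α - 2) / (c.α - 1)) * κ)) := by
    simp_rw [← ENNReal.toReal_pow]
    rw [integral_toReal (hm.pow_const 2) (hae.mono fun ω h => ENNReal.pow_lt_top h), hI2,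
      ENNReal.toReal_sum fun j _ => ENNReal.mul_ne_top (measure_ne_top _ _)
      (ENNReal.add_ne_top.2 ⟨ENNReal.pow_ne_top ENNReal.ofReal_ne_top, ENNReal.ofReal_ne_top⟩)]
    refine Finset.sum_congr rfl fun j _ => ?_
    rw [ENNReal.toReal_mul, ENNReal.toReal_add (ENNReal.pow_ne_top ENNReal.ofReal_ne_top)
      ENNReal.ofReal_ne_top, ENNReal.toReal_pow, ENNReal.toReal_ofReal (neg_nonneg.2 (hk1 j)),
      ENNReal.toReal_ofReal (hk2 j), measureReal_def, neg_sq]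
  refine ⟨fun k n => Uplink.map_cond_assocInterf hΦ hi k n, hae.mono fun _ h => h.ne, hL2, ?_, ?_,
    fun j => ⟨?_, ?_, ?_⟩⟩
  · simp only [hmean, (hd1 _).deriv, mul_neg, Finset.sum_neg_distrib]
  · have hp := Uplink.prob_assoc_add hΦ hi
    rw [variance_eq_sub hL2]
    simp only [Pi.pow_apply]
    rw [hsq]
    simp only [(hd1 _).deriv, (hd2 _).deriv, Fin.sum_univ_two]
    -- The two sides differ by `(E I)²` times the sum of the association probabilities minus one.
    linear_combination (-(∫ ω, (Uplink.interference c Φ B Ψ ω).toReal ∂P) ^ 2) * (-hp)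
  · filter_upwards [Ioo_mem_nhds h0.1 h0.2] with s hs
    exact (Uplink.hasDerivAt_beta hΦ hi j hs).differentiableAt
  · rw [Uplink.averaged_first hΦ hi j]
    exact hd1 j
  · rw [Uplink.averaged_second hΦ hi j]
    exact hd2 j
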